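/- **Setting.** Throughout $\log$ is the logarithm in base $2$ and $\ln$ the natural one. Let $\mathcal X\subset\mathbb R^D$ and $\mathcal Y\subset\mathbb R^{D'}$ (Euclidean norms) be contained in balls of diameter $\Delta_{\mathcal X}$ and $\Delta_{\mathcal Y}>0$. The Assouad dimension of $\mathcal X$ is the smallest real $d\ge 0$ such that for every ball $B\subset\mathbb R^D$ the set $B\cap\mathcal X$ can be covered by at most $2^d$ balls of half the radius of $B$. Let $(X,Y)$ be a random pair in $\mathcal X\times\mathcal Y$, let $\mu$ be the law of $X$, and suppose that the regression function $f(x)=\mathbb E[Y\mid X=x]$ is $\lambda$-Lipschitz on $\mathcal X$. The training sample $(\mathbf X,\mathbf Y)=\{(X_i,Y_i)\}_{i=1}^n$ and the test sample $(\mathbf X',\mathbf Y')=\{(X_i',Y_i')\}_{i=1}^n$ consist of $2n$ i.i.d. copies of $(X,Y)$. Let $\delta\in(0,1)$, $n\ge2$, $y_0\in\mathcal Y$. For $A\subseteq\mathcal X$ let $\mu_n(A)$ be the fraction of the $X_i$ that lie in $A$, and $\Delta_n(A)$ the largest distance between two of the $X_i$ lying in $A$ ($0$ if there are none); for a finite collection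 $\mathbf A$ of disjoint sets let $\Delta_n(\mathbf A)=\big(\sum_{A\in\mathbf A}\mu_n(A)\Delta_n(A)^2/\sum_{A\in\mathbf A}\mu_n(A)\big)^{1/2}$ ($0$ if the denominator vanishes). **Algorithm.** The procedure basicRPtree$(A_0,\Delta,l)$ starts from $\mathbf A_0=\{A_0\}$. For $i=1,2,\dots$ it stops if $\Delta_n(\mathbf A_{i-1})\le\Delta$; otherwise it draws $v\sim\mathcal N(0,\frac1DI_D)$ and $\tau$ uniform on $[-1,1]\cdot\frac6{\sqrt D}\Delta_n(A_0)$, independent of each other and of everything else, and obtains $\mathbf A_i$ by splitting each $A\in\mathbf A_{i-1}$ into $\{x\in A: x^\top v\le t\}$ and the rest, where $t=\mathrm{median}\{z^\top v: z\in\mathbf X\cap A_0\}+\tau$ if $l+i$ is odd and $t=\mathrm{median}\{z^\top v: z\in\mathbf X\cap A\}$ if $l+i$ is even. Here $\mathbf X\cap A$ is the set of distinct sample points in $A$. The procedure coreRPtree$(A,\Delta,\delta,l)$ runs basicRPtree$(A,\Delta,l)$ independently $\lceil\log(6n^2/\delta)\rceil$ times and returns a tree of smallest depth. The procedure adaptiveRPtree,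 with the cross-validation option, starts from $\mathbf A^0=\{\mathcal X\}$ (level $0$). For $i=1,2,\dots$ it calls coreRPtree$(A,\Delta_n(A)/2,\delta,l)$ on each cell $A\in\mathbf A^{i-1}$, where $l$ is the level of $A$ in the current tree, and lets $\mathbf A^i$ be the set of leaves of the tree so obtained. It stops at the first $i\ge1$ for which $\Delta_n(\mathbf A^i)=0$ or the maximal level of a cell of $\mathbf A^i$ is at least $\log n^2$. For a partition $\mathbf A$ and $x\in\mathcal X$ with cell $\mathbf A(x)\ni x$, let $f_{n,\mathbf A}(x)$ be the average of the $Y_i$ with $X_i\in\mathbf A(x)$, or $y_0$ if there is no such $i$. The algorithm returns $f_n=f_{n,\mathbf A^{j}}$, where $j$ is any minimiser of $\frac1n\sum_{m=1}^n\|Y_m'-f_{n,\mathbf A^{j}}(X_m')\|^2$ over $0\le j\le i$. For a real $k\ge d$, the algorithm *attains a diameter decrease rate of $k$* if every call of coreRPtree that it makes returns a tree of depth at most $k$. The excess risk of $f_n$ is $\|f_n-f\|^2=\int\|f_n(x)-f(x)\|^2\,\mu(dx)$. **Theorem.** There are universal constants $C,C'>0$ such that the following holds in this setting. Suppose that $\mathcal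 X$ has Assouad dimension $d>1$ and put $$\alpha(n)=(\log^2 n)\,\log\log(n/\delta)+\log(1/\delta).$$ Assume that $n\ge\max\{(\lambda\Delta_{\mathcal X}/\Delta_{\mathcal Y})^2,\ \alpha(n)\}$. Then, with probability at least $1-\delta$ over both samples and the randomness of the algorithm, the algorithm returns a regressor $f_n$, it attains a diameter decrease rate of some $k\in[d,\,C'd\log d]$, and for every rate $k\in[d,\,C'd\log d]$ that it attains, $$\|f_n-f\|^2\le C\,(\lambda\Delta_{\mathcal X})^{2k/(2+k)}\Big(\frac{\Delta_{\mathcal Y}^2\,\alpha(n)}{n}\Big)^{2/(2+k)}+2\Delta_{\mathcal Y}^2\sqrt{\frac{\ln\log n^6+\ln(3/\delta)}{2n}}.$$ -/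

import Mathlib

open MeasureTheory ProbabilityTheory

noncomputable section

namespace RPTree

/-- `ℝ^D` with the Euclidean norm. -/
abbrev E (D : ℕ) : Type := EuclideanSpace ℝ (Fin D)

/-- `d` is the Assouad (doubling) dimension of `S`: the least `d ≥ 0` such that the part of `S` in
any ball can be covered by at most `2 ^ d` balls of half the radius. -/
def HasAssouadDim {D : ℕ} (S : Set (E D)) (d : ℝ) : Prop :=
  IsLeast {s : ℝ | 0 ≤ s ∧ ∀ (z : E D) (r : ℝ), 0 < r →
    ∃ T : Finset (E D), (T.card : ℝ) ≤ (2 : ℝ) ^ s ∧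
      Metric.closedBall z r ∩ S ⊆ ⋃ y ∈ T, Metric.closedBall y (r / 2)} d

/-! ### Data in a set -/

/-- Empirical measure `μ_n(A)` of the sample `X`. -/
def empMass {D n : ℕ} (X : Fin n → E D) (A : Set (E D)) : ℝ :=
  (∑ i, A.indicator (fun _ => (1 : ℝ)) (X i)) / n

/-- Data diameter `Δ_n(A)`: largest distance between two sample points in `A`, and `0` if there is
no sample point in `A`. -/
def dataDiam {D n : ℕ} (X : Fin n → E D) (A : Set (E D)) : ℝ :=
  Metric.diam (Set.range X ∩ A)

/-- The finite set of sample points lying in `A`. -/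
def pointsIn {D n : ℕ} (X : Fin n → E D) (A : Set (E D)) : Finset (E D) :=
  ((Set.finite_range X).inter_of_left A).toFinset

/-- The median of a finite multiset of reals: the middle entry of the sorted list, or the mean of
the two middle entries if the number of entries is even (`0` for the empty multiset). -/
def median (s : Multiset ℝ) : ℝ :=
  let l := s.sort (· ≤ ·)
  (l.getD ((l.length - 1) / 2) 0 + l.getD (l.length / 2) 0) / 2

/-- The median of `zᵀ v` over the sample points `z` lying in `A`. -/
def projMedian {D n : ℕ} (X : Fin n → E D) (A : Set (E D)) (v : E D) : ℝ :=
  median ((pointsIn X A).val.map fun z => inner ℝ z v)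

/-! ### Tree cells and partitions -/

/-- A node of the partition tree: its address (the path from the root, last turn first) together
with the region of space that it represents. -/
structure Cell (D : ℕ) where
  addr : List Bool
  carrier : Set (E D)

/-- Level of a node in the tree; the root is at level `0`. -/
def Cell.level {D : ℕ} (c : Cell D) : ℕ := c.addr.length

/-- Level of a partition: the maximal level of its cells. -/
def partLevel {D : ℕ} (P : List (Cell D)) : ℕ := (P.map Cell.level).foldr max 0

/-- Average data diameter `Δ_n(𝐀)` of a collection of disjoint cells. -/
def avgDiam {D n : ℕ} (X : Fin n → E D) (P : List (Cell D)) : ℝ :=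
  √((P.map fun c => empMass X c.carrier * dataDiam X c.carrier ^ 2).sum /
    (P.map fun c => empMass X c.carrier).sum)

/-- Split a cell by the hyperplane `xᵀ v = t`. -/
def split {D : ℕ} (c : Cell D) (v : E D) (t : ℝ) : List (Cell D) :=
  [⟨false :: c.addr, {x ∈ c.carrier | inner ℝ x v ≤ t}⟩,
   ⟨true :: c.addr, c.carrier \ {x ∈ c.carrier | inner ℝ x v ≤ t}⟩]

/-! ### Randomness of the algorithm

One step of one run of `basicRPtree` uses a seed `(v, u)`: the direction `v ∼ N(0, I_D / D)` and
`u ∼ U[-1, 1]`, the noise being `τ = u * (6 / √D) * Δ_n(A₀)`. Seeds are independent, indexed by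
the node at which `coreRPtree` is called, the run (trial) of `basicRPtree`, and the step of it. -/

/-- Law of one seed. -/
def seedLaw (D : ℕ) : Measure (E D × ℝ) :=
  (multivariateGaussian (0 : E D) ((D : ℝ)⁻¹ • (1 : Matrix (Fin D) (Fin D) ℝ))).prod
    (volume[|Set.Icc (-1 : ℝ) 1])

/-- All the randomness used by the algorithm. -/
abbrev Seeds (D : ℕ) : Type := List Bool × ℕ × ℕ → E D × ℝ

instance (D : ℕ) : IsProbabilityMeasure (seedLaw D) := by
  have : IsProbabilityMeasure (volume[|Set.Icc (-1 : ℝ) 1]) :=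
    cond_isProbabilityMeasure_of_finite (by simp) (by simp)
  unfold seedLaw
  infer_instance

/-- Law of all the randomness: independent seeds. -/
def seedsLaw (D : ℕ) : Measure (Seeds D) := Measure.infinitePi fun _ => seedLaw D

/-! ### `basicRPtree` and `coreRPtree` -/

/-- The partition of `c` after `i` steps of `basicRPtree` (stopping rule disregarded), with seeds
`ξ`. If (level of `c`) + (index of the step) is odd, all cells are split at the noisy median of the
data in `c`; otherwise each cell is split at the median of its own data. -/
def basicPart {D n : ℕ} (X : Fin n → E D) (c : Cell D) (ξ : ℕ → E D × ℝ) : ℕ → List (Cell D)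
  | 0 => [c]
  | i + 1 => (basicPart X c ξ i).flatMap fun a =>
      split a (ξ i).1
        (if Odd (c.level + (i + 1)) then
          projMedian X c.carrier (ξ i).1 + (ξ i).2 * (6 / √(D : ℝ)) * dataDiam X c.carrier
        else
          projMedian X a.carrier (ξ i).1)

/-- Depth of the tree returned by `basicRPtree(c, Δ)`: the first step at which the average data
diameter is at most `Δ` (`⊤` if the procedure never halts). -/
def basicDepth {D n : ℕ} (X : Fin n → E D) (c : Cell D) (Δ : ℝ) (ξ : ℕ → E D × ℝ) : ℕ∞ :=
  ⨅ i ∈ {i : ℕ | avgDiam X (basicPart X c ξ i) ≤ Δ}, (i : ℕ∞)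

/-- Number `log (6 n² / δ)` of runs of `basicRPtree` in one call of `coreRPtree`. -/
def numTrials (n : ℕ) (δ : ℝ) : ℕ := ⌈Real.logb 2 (6 * (n : ℝ) ^ 2 / δ)⌉₊

/-- Seeds of trial `t` of the call of `coreRPtree` at the node `c`. -/
def trialSeeds {D : ℕ} (ω : Seeds D) (c : Cell D) (t : ℕ) : ℕ → E D × ℝ := fun i => ω (c.addr, t, i)

/-- Depth of the tree of trial `t` in the call `coreRPtree(c, Δ_n(c) / 2, δ, level c)`. -/
def trialDepth {D n : ℕ} (X : Fin n → E D) (ω : Seeds D) (c : Cell D) (t : ℕ) : ℕ∞ :=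
  basicDepth X c (dataDiam X c.carrier / 2) (trialSeeds ω c t)

/-- Depth of the tree returned by `coreRPtree(c, Δ_n(c) / 2, δ, level c)`: the smallest depth over
all the trials. -/
def coreDepth {D n : ℕ} (X : Fin n → E D) (δ : ℝ) (ω : Seeds D) (c : Cell D) : ℕ∞ :=
  ⨅ t ∈ {t : ℕ | t < numTrials n δ}, trialDepth X ω c t

/-- The (first) trial attaining the smallest depth. -/
def bestTrial {D n : ℕ} (X : Fin n → E D) (δ : ℝ) (ω : Seeds D) (c : Cell D) : ℕ :=
  sInf {t : ℕ | t < numTrials n δ ∧ trialDepth X ω c t = coreDepth X δ ω c}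

/-- Leaves of the tree returned by `coreRPtree(c, Δ_n(c) / 2, δ, level c)`. -/
def coreLeaves {D n : ℕ} (X : Fin n → E D) (δ : ℝ) (ω : Seeds D) (c : Cell D) : List (Cell D) :=
  basicPart X c (trialSeeds ω c (bestTrial X δ ω c)) (coreDepth X δ ω c).toNat

/-! ### `adaptiveRPtree` with the cross-validation option -/

/-- The partitions `𝐀⁰ = {𝒳}, 𝐀¹, 𝐀², …` grown by `adaptiveRPtree`. -/
def adaptivePart {D n : ℕ} (S : Set (E D)) (X : Fin n → E D) (δ : ℝ) (ω : Seeds D) :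
    ℕ → List (Cell D)
  | 0 => [⟨[], S⟩]
  | i + 1 => (adaptivePart S X δ ω i).flatMap (coreLeaves X δ ω)

/-- Stopping criterion of the cross-validation option, tested after `𝐀ⁱ`, `i ≥ 1`, is built. -/
def StopCond {D n : ℕ} (S : Set (E D)) (X : Fin n → E D) (δ : ℝ) (ω : Seeds D) (i : ℕ) : Prop :=
  1 ≤ i ∧ (avgDiam X (adaptivePart S X δ ω i) = 0 ∨
    Real.logb 2 ((n : ℝ) ^ 2) ≤ partLevel (adaptivePart S X δ ω i))

/-- `adaptiveRPtree` stops growing the tree at `𝐀ⁱ`. -/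
def StopsAt {D n : ℕ} (S : Set (E D)) (X : Fin n → E D) (δ : ℝ) (ω : Seeds D) (i : ℕ) : Prop :=
  StopCond S X δ ω i ∧ ∀ j < i, ¬ StopCond S X δ ω j

/-- `adaptiveRPtree` attains the diameter decrease rate `k` on `X`: every call of `coreRPtree`
that it makes (those on the cells of `𝐀ⁱ` for each `i` at which it has not stopped yet) halts
and returns a tree of depth at most `k`. -/
def AttainsRate {D n : ℕ} (S : Set (E D)) (X : Fin n → E D) (δ : ℝ) (ω : Seeds D) (k : ℝ) : Prop :=
  ∀ i, (∀ j ≤ i, ¬ StopCond S X δ ω j) →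
    ∀ c ∈ adaptivePart S X δ ω i, ∃ m : ℕ, coreDepth X δ ω c = m ∧ (m : ℝ) ≤ k

/-- The cell `𝐀(x)` of the partition `P` to which `x` belongs. -/
def cellOf {D : ℕ} (P : List (Cell D)) (x : E D) : Set (E D) :=
  {x' | ∃ c ∈ P, x ∈ c.carrier ∧ x' ∈ c.carrier}

/-- The piecewise constant regressor `f_{n,𝐀}` learned from the sample `(X, Y)`. -/
def regressor {D D' n : ℕ} (X : Fin n → E D) (Y : Fin n → E D') (y₀ : E D') (P : List (Cell D))
    (x : E D) : E D' :=
  if 0 < empMass X (cellOf P x) then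
    ((n : ℝ) * empMass X (cellOf P x))⁻¹ •
      ∑ i, (cellOf P x).indicator (fun _ => Y i) (X i)
  else y₀

/-- Empirical risk `R'_n(g)` over the test sample `(X', Y')`. -/
def empRisk {D D' n : ℕ} (X' : Fin n → E D) (Y' : Fin n → E D') (g : E D → E D') : ℝ :=
  (1 / (n : ℝ)) * ∑ i, ‖Y' i - g (X' i)‖ ^ 2

/-- The regressor `f_{n,𝐀ʲ}`, trained on the sample `z`. -/
def candidate {D D' n : ℕ} (S : Set (E D)) (y₀ : E D') (δ : ℝ) (z : Fin n → E D × E D')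
    (ω : Seeds D) (j : ℕ) : E D → E D' :=
  regressor (fun i => (z i).1) (fun i => (z i).2) y₀ (adaptivePart S (fun i => (z i).1) δ ω j)

/-- `g` is returned by `adaptiveRPtree` with the cross-validation option, on training sample `z`,
test sample `z'` and randomness `ω`: it minimises the empirical risk over the test sample among the
regressors on `𝐀⁰, …, 𝐀ⁱ`, where `𝐀ⁱ` is the last partition grown. -/
def IsReturned {D D' n : ℕ} (S : Set (E D)) (y₀ : E D') (δ : ℝ) (z z' : Fin n → E D × E D')
    (ω : Seeds D) (g : E D → E D') : Prop :=
  ∃ i, StopsAt S (fun l => (z l).1) δ ω i ∧ ∃ j ≤ i, g = candidate S y₀ δ z ω j ∧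
    ∀ j' ≤ i, empRisk (fun l => (z' l).1) (fun l => (z' l).2) g ≤
      empRisk (fun l => (z' l).1) (fun l => (z' l).2) (candidate S y₀ δ z ω j')

/-! ### Regression model -/

/-- `(X, Y) ∼ ρ` takes values in `S × T` and `f(x) = 𝔼[Y | X = x]`. -/
structure IsRegressionModel {D D' : ℕ} (ρ : Measure (E D × E D')) (S : Set (E D)) (T : Set (E D'))
    (f : E D → E D') : Prop where
  mem : ∀ᵐ p ∂ρ, p.1 ∈ S ∧ p.2 ∈ T
  condExp : (fun p : E D × E D' => f p.1) =ᵐ[ρ]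
    ρ[(Prod.snd : E D × E D' → E D') |
      MeasurableSpace.comap (Prod.fst : E D × E D' → E D) inferInstance]

/-- The law of the training sample (`n` i.i.d. pairs), the test sample (`n` further i.i.d. pairs)
and the randomness of the algorithm, all independent. -/
def experiment {D D' : ℕ} (ρ : Measure (E D × E D')) (n : ℕ) :
    Measure ((Fin n → E D × E D') × (Fin n → E D × E D') × Seeds D) :=
  (Measure.pi fun _ : Fin n => ρ).prod ((Measure.pi fun _ : Fin n => ρ).prod (seedsLaw D))

/-- `α(n) = (log² n) log log (n / δ) + log (1 / δ)`, logarithms in base `2`. -/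
def alpha (n : ℕ) (δ : ℝ) : ℝ :=
  Real.logb 2 n ^ 2 * Real.logb 2 (Real.logb 2 (n / δ)) + Real.logb 2 (1 / δ)

/-- The bound on the excess risk of `g` (the excess risk being `𝔼 ‖g(X) - f(X)‖²`). -/
def ExcessRiskLE {D D' : ℕ} (ρ : Measure (E D × E D')) (f g : E D → E D') (b : ℝ) : Prop :=
  Integrable (fun x => ‖g x - f x‖ ^ 2) ρ.fst ∧ ∫ x, ‖g x - f x‖ ^ 2 ∂ρ.fst ≤ b

/-- The right-hand side of the risk bound. -/
def riskBound (C lam ΔX ΔY δ k : ℝ) (n : ℕ) : ℝ :=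
  C * (lam * ΔX) ^ (2 * k / (2 + k)) * (ΔY ^ 2 * alpha n δ / n) ^ (2 / (2 + k)) +
    2 * ΔY ^ 2 *
      √((Real.log (Real.logb 2 ((n : ℝ) ^ 6)) + Real.log (3 / δ)) / (2 * n))

end RPTree

end

/-!
The theorem combines a bound on the depth of the trees with an analysis of a fixed regression
estimate on a data-dependent partition and of its selection by cross-validation. The failure
probability is split into `δ / 3` for the depths and `2 δ / 3` for the statistical part.

*Depth.* Cover the data of a cell of diameter `Δ` by `2 ^ (d J)` balls of radius `Δ / 2 ^ J`, with
`2 ^ J` of order `√d`. For two such balls that contain data points at distance more than `Δ / 2`,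
Gaussian anti-concentration keeps the projections of these points at distance of order `Δ / √D`,
chaining (`dirLaw_chaining`) keeps the projections of both balls much smaller, and the median of all
the projections is within order `Δ / √D` (`dirLaw_projMedian`); so the uniform noise puts the
threshold of a noisy split between the balls with constant probability (`seedLaw_sepSet_ge`). All
the cells are cut by the same hyperplane in a noisy split, hence after `O(d J) = O(d log d)` of them
no cell contains two distant points, except with probability one half, and the independent trials
bring this down to `δ / (6 n²)` (`seedsLaw_coreDepth_gt`). The union bound is over the at most
`2 n²` addresses of the nodes that may be called; whether and with which cell a node is called is
independent of the seeds of that node (`seedsLaw_rateFail_le`).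

*Variance and bias.* The cells depend on the sample, but a cell at depth `m` is determined by the
seeds and by at most `4 m` sample points, through a short list of instructions
(`exists_code_of_mem_adaptivePart`). For the set described by a fixed list, the sample points that
the list does not use are independent of the set, so that exponential supermartingales (that of
Pinelis for the sum of the noise vectors) apply, and a union bound over the lists costs `O(α(n))`
(`measure_not_allControlled_le`). The diameter of the data of a cell says nothing about the part of
the cell that is far from the data; but that part is also described by a short list, contains no
data and thus has a small mass (`setIntegral_cell_le`). After `j` rounds the excess risk is at most
of order `λ² Δ_X² 4 ^ (-j) + 2 ^ (j k) Δ_Y² α(n) / n`, and balancing the terms gives the rate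
(`exists_candidate_le`).

*Selection.* With `ℓ = λ Δ_X` and `β = Δ_Y² α(n) / n`, the case `β ≤ ℓ²` follows from Hoeffding's
inequality for each candidate. When `ℓ² < β`, the union bound needed for the variance is avoided:
the root candidate has excess risk at most `ℓ²` plus the squared deviation of the mean response,
and a candidate that beats the root on the test sample exceeds its risk by at most the additive
term of the bound less that squared deviation (`experiment_exists_beats_root`), the deviation
being controlled through an exponential moment. When the additive term is at least `Δ_Y²`,
there is nothing to prove. The three cases are joined in `exists_selection_event`.
-/

noncomputable section

namespace RPTree

/-! ### Medians and order statistics -/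

/-- A down-closed property holds for the entry number `p` of a sorted list if and only if more than
`p` entries have it. -/
theorem getD_iff_lt_countP {P : ℝ → Prop} [DecidablePred P] (hP : ∀ a b, a ≤ b → P b → P a)
    {l : List ℝ} (hl : l.Pairwise (· ≤ ·)) {p : ℕ} (hp : p < l.length) :
    P (l.getD p 0) ↔ p < l.countP (fun a => decide (P a)) := by
  induction l generalizing p with
  | nil => simp at hp
  | cons a l ih =>
    rw [List.pairwise_cons] at hl
    by_cases ha : P a
    · cases p with
      | zero => simp [ha]
      | succ p =>
        simp only [List.length_cons, Nat.add_lt_add_iff_right] at hp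
        simp only [List.getD_cons_succ, List.countP_cons, ha, decide_true, if_true,
          Nat.add_lt_add_iff_right]
        exact ih hl.2 hp
    · have h0 : l.countP (fun a => decide (P a)) = 0 := by
        rw [List.countP_eq_zero]
        intro b hb
        simpa using fun h => ha (hP a b (hl.1 b hb) h)
      have h1 : (a :: l).countP (fun a => decide (P a)) = 0 := by
        simp [h0, ha]
      rw [h1]
      simp only [Nat.not_lt_zero, iff_false]
      have hmem : (a :: l).getD p 0 ∈ a :: l := by
        rw [List.getD_eq_getElem _ _ hp]; exact List.getElem_mem hp
      rcases List.mem_cons.1 hmem with h | h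
      · rwa [h]
      · exact fun h' => ha (hP a _ (hl.1 _ h) h')

theorem sort_getD_iff {P : ℝ → Prop} [DecidablePred P] (hP : ∀ a b, a ≤ b → P b → P a)
    (s : Multiset ℝ) {p : ℕ} (hp : p < s.card) :
    P ((s.sort (· ≤ ·)).getD p 0) ↔ p < s.countP P := by
  rw [getD_iff_lt_countP hP (Multiset.pairwise_sort s _) (by simpa using hp)]
  conv_rhs => rw [← Multiset.sort_eq s (· ≤ ·), Multiset.coe_countP]

/-- If fewer than half of the entries exceed `t`, then the median is at most `t`. -/
theorem median_le {s : Multiset ℝ} {t : ℝ} (h : 2 * s.countP (fun a => t < a) < s.card) :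
    median s ≤ t := by
  have hc : s.card = s.countP (fun a => a ≤ t) + s.countP (fun a => t < a) := by
    rw [Multiset.card_eq_countP_add_countP (fun a => a ≤ t)]
    simp
  have key : ∀ p ≤ s.card / 2, (s.sort (· ≤ ·)).getD p 0 ≤ t := by
    intro p hp
    rw [sort_getD_iff (P := fun a => a ≤ t) (fun a b hab hb => hab.trans hb) s (by omega)]
    omega
  have h1 := key ((s.card - 1) / 2) (by omega)
  have h2 := key (s.card / 2) le_rfl
  simp only [median, Multiset.length_sort]
  linarith

/-- If fewer than half of the entries are below `t`, then the median is at least `t`. -/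
theorem le_median {s : Multiset ℝ} {t : ℝ} (h : 2 * s.countP (fun a => a < t) < s.card) :
    t ≤ median s := by
  have key : ∀ p < s.card, (s.card - 1) / 2 ≤ p → t ≤ (s.sort (· ≤ ·)).getD p 0 := by
    intro p hp hp'
    have := sort_getD_iff (P := fun a => a < t) (fun a b hab hb => hab.trans_lt hb) s hp
    by_contra! hlt
    have := this.1 hlt
    omega
  have h1 := key ((s.card - 1) / 2) (by omega) le_rfl
  have h2 := key (s.card / 2) (by omega) (by omega)
  simp only [median, Multiset.length_sort]
  linarith

theorem median_mem {s : Multiset ℝ} (hs : s ≠ 0) :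
    ∃ a ∈ s, ∃ b ∈ s, median s = (a + b) / 2 := by
  have hc : 0 < s.card := Multiset.card_pos.2 hs
  have key : ∀ p < s.card, (s.sort (· ≤ ·)).getD p 0 ∈ s := by
    intro p hp
    rw [← Multiset.mem_sort (r := (· ≤ ·)),
      List.getD_eq_getElem _ _ (by simpa using hp)]
    exact List.getElem_mem _
  exact ⟨_, key ((s.card - 1) / 2) (by omega), _, key (s.card / 2) (by omega),
    by simp only [median, Multiset.length_sort]⟩

@[simp] theorem median_zero : median 0 = 0 := by
  simp [median]

/-! ### Measurability of discrete-valued functions -/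

/-- All fibres of `f` are measurable; for a countable codomain this is measurability with respect
to the discrete `σ`-algebra. -/
def MeasFibers {Ω β : Type*} [MeasurableSpace Ω] (f : Ω → β) : Prop :=
  ∀ b, MeasurableSet {o | f o = b}

namespace MeasFibers

variable {Ω β γ : Type*} [MeasurableSpace Ω]

theorem preimage [Countable β] {f : Ω → β} (hf : MeasFibers f) (s : Set β) :
    MeasurableSet {o | f o ∈ s} := by
  have : {o | f o ∈ s} = ⋃ b ∈ s, {o | f o = b} := by ext; simp
  rw [this]
  exact MeasurableSet.biUnion (Set.to_countable s) fun _ _ => hf _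

theorem const (b : β) : MeasFibers (fun _ : Ω => b) := fun _ => MeasurableSet.const _

/-- Substitution of a random index of countable range into a family of random elements. -/
theorem bind [Countable β] {f : Ω → β} {g : β → Ω → γ} (hf : MeasFibers f)
    (hg : ∀ b, MeasFibers (g b)) : MeasFibers (fun o => g (f o) o) := by
  intro c
  have : {o | g (f o) o = c} = ⋃ b, {o | f o = b} ∩ {o | g b o = c} := by
    ext o; simp
  rw [this]
  exact MeasurableSet.iUnion fun b => (hf b).inter (hg b c)

theorem comp [Countable β] {f : Ω → β} (hf : MeasFibers f) (F : β → γ) :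
    MeasFibers (fun o => F (f o)) :=
  hf.bind (g := fun b _ => F b) fun _ => const _

theorem bind_measurable [Countable β] [MeasurableSpace γ] {f : Ω → β} {g : β → Ω → γ}
    (hf : MeasFibers f) (hg : ∀ b, Measurable (g b)) : Measurable (fun o => g (f o) o) := by
  intro s hs
  have : (fun o => g (f o) o) ⁻¹' s = ⋃ b, {o | f o = b} ∩ g b ⁻¹' s := by
    ext o; simp
  rw [this]
  exact MeasurableSet.iUnion fun b => (hf b).inter (hg b hs)

theorem bind_measurableSet [Countable β] {f : Ω → β} {P : β → Ω → Prop}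
    (hf : MeasFibers f) (hP : ∀ b, MeasurableSet {o | P b o}) : MeasurableSet {o | P (f o) o} := by
  have : {o | P (f o) o} = ⋃ b, {o | f o = b} ∩ {o | P b o} := by
    ext o; simp
  rw [this]
  exact MeasurableSet.iUnion fun b => (hf b).inter (hP b)

theorem map₂ {β' : Type*} [Countable β] [Countable β'] {f : Ω → β} {f' : Ω → β'}
    (hf : MeasFibers f) (hf' : MeasFibers f') (F : β → β' → γ) :
    MeasFibers (fun o => F (f o) (f' o)) :=
  hf.bind (g := fun b o => F b (f' o)) fun _ => hf'.comp _

theorem flatMap_const [Countable γ] {g : β → Ω → List γ} (hg : ∀ b, MeasFibers (g b))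
    (l : List β) : MeasFibers (fun o => l.flatMap (g · o)) := by
  induction l with
  | nil => exact const _
  | cons b l ih =>
    simp only [List.flatMap_cons]
    exact (hg b).map₂ ih (· ++ ·)

theorem flatMap [Countable β] [Countable γ] {f : Ω → List β} {g : β → Ω → List γ}
    (hf : MeasFibers f) (hg : ∀ b, MeasFibers (g b)) :
    MeasFibers (fun o => (f o).flatMap (g · o)) :=
  hf.bind (g := fun l o => l.flatMap fun b => g b o) fun l => flatMap_const hg l

theorem filter {ι : Type*} [Finite ι] (J : Finset ι) {P : ι → Ω → Prop}
    [∀ o, DecidablePred fun i => P i o]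
    (hP : ∀ i, MeasurableSet {o | P i o}) : MeasFibers (fun o => J.filter fun i => P i o) := by
  intro K
  have : {o | J.filter (fun i => P i o) = K} =
      ⋂ i, {o | (i ∈ J ∧ P i o) ↔ i ∈ K} := by
    ext o; simp [Finset.ext_iff]
  rw [this]
  refine MeasurableSet.iInter fun i => ?_
  exact ((MeasurableSet.const _).inter (hP i)).iff (MeasurableSet.const _)

theorem decide {P : Ω → Prop} [DecidablePred P] (hP : MeasurableSet {o | P o}) :
    MeasFibers (fun o => decide (P o)) := by
  intro b
  cases b
  · have : {o | Decidable.decide (P o) = false} = {o | P o}ᶜ := by ext; simp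
    rw [this]; exact hP.compl
  · have : {o | Decidable.decide (P o) = true} = {o | P o} := by ext; simp
    rw [this]; exact hP

theorem natSInf {P : ℕ → Ω → Prop} (hP : ∀ t, MeasurableSet {o | P t o}) :
    MeasFibers (fun o => sInf {t | P t o}) := by
  intro m
  have : {o | sInf {t | P t o} = m} =
      ({o | P m o} ∩ ⋂ t, ⋂ (_ : t < m), {o | ¬ P t o}) ∪ ({o | m = 0} ∩ ⋂ t, {o | ¬ P t o}) := by
    ext o
    simp only [Set.mem_ofPred_eq, Set.mem_union, Set.mem_inter_iff, Set.mem_iInter]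
    constructor
    · rintro rfl
      by_cases h : {t | P t o}.Nonempty
      · exact Or.inl ⟨Nat.sInf_mem h, fun t ht h' => Nat.notMem_of_lt_sInf (s := {t | P t o}) ht h'⟩
      · rw [Set.not_nonempty_iff_eq_empty] at h
        right
        refine ⟨by simp [h], fun t ht => ?_⟩
        have : t ∈ {t | P t o} := ht
        rw [h] at this; exact this
    · rintro (⟨h1, h2⟩ | ⟨rfl, h2⟩)
      · refine le_antisymm (Nat.sInf_le h1) ?_
        by_contra! hlt
        exact h2 _ hlt (Nat.sInf_mem (s := {t | P t o}) ⟨m, h1⟩)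
      · have : {t | P t o} = ∅ := by ext t; simp [h2 t]
        simp [this]
  rw [this]
  exact ((hP m).inter (MeasurableSet.iInter fun t => MeasurableSet.iInter
    fun _ => (hP t).compl)).union
      ((MeasurableSet.const _).inter (MeasurableSet.iInter fun t => (hP t).compl))

end MeasFibers

/-! ### Sample indices of the data in a set -/

open Classical in
/-- Indices of the sample points lying in `A`. -/
def idxSet {D n : ℕ} (X : Fin n → E D) (A : Set (E D)) : Finset (Fin n) :=
  Finset.univ.filter fun i => X i ∈ A

@[simp] theorem mem_idxSet {D n : ℕ} {X : Fin n → E D} {A : Set (E D)} {i : Fin n} :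
    i ∈ idxSet X A ↔ X i ∈ A := by simp [idxSet]

@[simp] theorem mem_pointsIn {D n : ℕ} {X : Fin n → E D} {A : Set (E D)} {z : E D} :
    z ∈ pointsIn X A ↔ (∃ i, X i = z) ∧ z ∈ A := by simp [pointsIn]

open Classical in
theorem pointsIn_eq_image {D n : ℕ} (X : Fin n → E D) (A : Set (E D)) :
    pointsIn X A = (idxSet X A).image X := by
  ext z
  simp only [mem_pointsIn, Finset.mem_image, mem_idxSet]
  constructor
  · rintro ⟨⟨i, rfl⟩, h⟩; exact ⟨i, h, rfl⟩
  · rintro ⟨i, h, rfl⟩; exact ⟨⟨i, rfl⟩, h⟩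

open Classical in
/-- Median of the projections of the distinct sample points with index in `J`. -/
def idxMedian {D n : ℕ} (X : Fin n → E D) (J : Finset (Fin n)) (v : E D) : ℝ :=
  median ((J.image X).val.map fun z => inner ℝ z v)

theorem projMedian_eq {D n : ℕ} (X : Fin n → E D) (A : Set (E D)) (v : E D) :
    projMedian X A v = idxMedian X (idxSet X A) v := by
  rw [projMedian, idxMedian, pointsIn_eq_image]

/-- Diameter of the sample points with index in `J`. -/
def idxDiam {D n : ℕ} (X : Fin n → E D) (J : Finset (Fin n)) : ℝ :=
  Metric.diam (X '' J)

theorem range_inter_eq {D n : ℕ} (X : Fin n → E D) (A : Set (E D)) :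
    Set.range X ∩ A = X '' (idxSet X A : Set (Fin n)) := by
  ext z
  simp only [Set.mem_inter_iff, Set.mem_range, Set.mem_image, Finset.mem_coe, mem_idxSet]
  constructor
  · rintro ⟨⟨i, rfl⟩, h⟩; exact ⟨i, h, rfl⟩
  · rintro ⟨i, h, rfl⟩; exact ⟨⟨i, rfl⟩, h⟩

theorem dataDiam_eq {D n : ℕ} (X : Fin n → E D) (A : Set (E D)) :
    dataDiam X A = idxDiam X (idxSet X A) := by
  rw [dataDiam, idxDiam, range_inter_eq]

theorem empMass_eq {D n : ℕ} (X : Fin n → E D) (A : Set (E D)) :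
    empMass X A = ((idxSet X A).card : ℝ) / n := by
  classical
  rw [empMass]
  congr 1
  simp [Set.indicator_apply, idxSet]

open Classical in
/-- Sample points may coincide: each of the distinct ones is counted through its least index. -/
theorem card_filter_image {D n : ℕ} (X : Fin n → E D) (J : Finset (Fin n)) (P : E D → Prop)
    [DecidablePred P] :
    ((J.image X).filter P).card =
      (J.filter fun i => P (X i) ∧ ∀ j ∈ J, j < i → X j ≠ X i).card := by
  symm
  refine Finset.card_bij (fun i _ => X i) ?_ ?_ ?_
  · intro i hi
    simp only [Finset.mem_filter] at hi
    simp only [Finset.mem_filter, Finset.mem_image]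
    exact ⟨⟨i, hi.1, rfl⟩, hi.2.1⟩
  · intro i hi j hj hij
    simp only [Finset.mem_filter] at hi hj
    rcases lt_trichotomy i j with h | h | h
    · exact absurd hij (hj.2.2 i hi.1 h)
    · exact h
    · exact absurd hij.symm (hi.2.2 j hj.1 h)
  · intro z hz
    simp only [Finset.mem_filter, Finset.mem_image] at hz
    obtain ⟨⟨i, hi, rfl⟩, hP⟩ := hz
    set K := J.filter fun j => X j = X i with hK
    have hne : K.Nonempty := ⟨i, by simp [hK, hi]⟩
    have hm : K.min' hne ∈ J ∧ X (K.min' hne) = X i :=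
      Finset.mem_filter.1 (Finset.min'_mem K hne)
    refine ⟨K.min' hne, ?_, hm.2⟩
    rw [Finset.mem_filter]
    refine ⟨hm.1, by rw [hm.2]; exact hP, fun j hj hlt heq => ?_⟩
    have : j ∈ K := by rw [hK, Finset.mem_filter]; exact ⟨hj, heq.trans hm.2⟩
    exact absurd (Finset.min'_le K j this) (not_le.2 hlt)

section Measurability

variable {Ω : Type*} [MeasurableSpace Ω] {D n : ℕ} {X : Ω → Fin n → E D} {v : Ω → E D}

open Classical in
theorem measFibers_card_filter_image (hX : Measurable X) (J : Finset (Fin n))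
    {P : Ω → E D → Prop} [∀ o, DecidablePred (P o)] (hP : ∀ i, MeasurableSet {o | P o (X o i)}) :
    MeasFibers (fun o => ((J.image (X o)).filter (P o)).card) := by
  simp only [card_filter_image]
  refine (MeasFibers.filter J (P := fun i o => P o (X o i) ∧ ∀ j ∈ J, j < i → X o j ≠ X o i)
    fun i => ?_).comp Finset.card
  refine (hP i).inter ?_
  have : {o | ∀ j ∈ J, j < i → X o j ≠ X o i} =
      ⋂ j, ⋂ (_ : j ∈ J), ⋂ (_ : j < i), {o | X o j = X o i}ᶜ := by
    ext o; simp
  change MeasurableSet {o | ∀ j ∈ J, j < i → X o j ≠ X o i}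
  rw [this]
  refine MeasurableSet.iInter fun j => MeasurableSet.iInter fun _ =>
    MeasurableSet.iInter fun _ => ?_
  exact (measurableSet_eq_fun ((measurable_pi_apply j).comp hX)
    ((measurable_pi_apply i).comp hX)).compl

theorem measurable_idxMedian (hX : Measurable X) (hv : Measurable v) (J : Finset (Fin n)) :
    Measurable (fun o => idxMedian (X o) J (v o)) := by
  classical
  have hXi : ∀ i, Measurable fun o => X o i := fun i => (measurable_pi_apply i).comp hX
  have hcard : MeasFibers fun o => (J.image (X o)).card := by
    have := measFibers_card_filter_image hX J (P := fun _ _ => True) (by simp)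
    simpa using this
  have hstat : ∀ p : ℕ, Measurable fun o =>
      ((((J.image (X o)).val.map fun z => (inner ℝ z (v o) : ℝ))).sort (· ≤ ·)).getD p 0 := by
    intro p
    refine measurable_of_Iic fun t => ?_
    have hset : ((fun o => ((((J.image (X o)).val.map
        fun z => (inner ℝ z (v o) : ℝ))).sort (· ≤ ·)).getD p 0) ⁻¹' Set.Iic t) =
        ({o | (J.image (X o)).card ∈ Set.Ioi p} ∩
          {o | ((J.image (X o)).filter fun z => inner ℝ z (v o) ≤ t).card ∈ Set.Ioi p}) ∪
        ({o | (J.image (X o)).card ∈ Set.Iic p} ∩ {_o | 0 ≤ t}) := by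
      ext o
      simp only [Set.mem_preimage, Set.mem_Iic, Set.mem_union, Set.mem_inter_iff, Set.mem_ofPred_eq,
        Set.mem_Ioi]
      have hc : ((J.image (X o)).val.map fun z => (inner ℝ z (v o) : ℝ)).card =
        (J.image (X o)).card := by rw [Multiset.card_map, Finset.card_val]
      by_cases hp : p < (J.image (X o)).card
      · rw [sort_getD_iff (P := fun a => a ≤ t) (fun a b hab hb => hab.trans hb) _
          (by rw [hc]; exact hp), Multiset.countP_map]
        simp only [hp, true_and, not_le.2 hp, false_and, or_false]
        rfl
      · have hp' := not_lt.1 hp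
        rw [List.getD_eq_default _ _ (by rw [Multiset.length_sort, hc]; exact hp')]
        simp [hp']
    rw [hset]
    refine ((hcard.preimage _).inter ?_).union ((hcard.preimage _).inter (MeasurableSet.const _))
    refine (measFibers_card_filter_image hX J (P := fun o z => inner ℝ z (v o) ≤ t)
      fun i => ?_).preimage _
    exact measurableSet_le ((hXi i).inner hv) measurable_const
  have h1 : Measurable fun o =>
      ((((J.image (X o)).val.map fun z => (inner ℝ z (v o) : ℝ))).sort (· ≤ ·)).getD
        (((J.image (X o)).card - 1) / 2) 0 :=
    hcard.bind_measurable (g := fun m o => ((((J.image (X o)).val.map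
      fun z => (inner ℝ z (v o) : ℝ))).sort (· ≤ ·)).getD ((m - 1) / 2) 0) fun m => hstat _
  have h2 : Measurable fun o =>
      ((((J.image (X o)).val.map fun z => (inner ℝ z (v o) : ℝ))).sort (· ≤ ·)).getD
        ((J.image (X o)).card / 2) 0 :=
    hcard.bind_measurable (g := fun m o => ((((J.image (X o)).val.map
      fun z => (inner ℝ z (v o) : ℝ))).sort (· ≤ ·)).getD (m / 2) 0) fun m => hstat _
  convert! (h1.add h2).div_const 2 using 2 with o
  simp only [idxMedian, median, Multiset.length_sort, Multiset.card_map, Finset.card_val,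
    Pi.add_apply]

theorem idxDiam_le_iff {X : Fin n → E D} {J : Finset (Fin n)} {r : ℝ} (hr : 0 ≤ r) :
    idxDiam X J ≤ r ↔ ∀ i ∈ J, ∀ j ∈ J, dist (X i) (X j) ≤ r := by
  constructor
  · intro h i hi j hj
    exact (Metric.dist_le_diam_of_mem (J.finite_toSet.image X).isBounded
      (Set.mem_image_of_mem X hi) (Set.mem_image_of_mem X hj)).trans h
  · intro h
    refine Metric.diam_le_of_forall_dist_le hr ?_
    rintro _ ⟨i, hi, rfl⟩ _ ⟨j, hj, rfl⟩
    exact h i hi j hj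

theorem measurable_idxDiam (hX : Measurable X) (J : Finset (Fin n)) :
    Measurable (fun o => idxDiam (X o) J) := by
  have hXi : ∀ i, Measurable fun o => X o i := fun i => (measurable_pi_apply i).comp hX
  refine measurable_of_Iic fun r => ?_
  by_cases hr : 0 ≤ r
  · have : (fun o => idxDiam (X o) J) ⁻¹' Set.Iic r =
        ⋂ i, ⋂ (_ : i ∈ J), ⋂ j, ⋂ (_ : j ∈ J), {o | dist (X o i) (X o j) ≤ r} := by
      ext o
      simp [idxDiam_le_iff hr]
    rw [this]
    refine MeasurableSet.iInter fun i => MeasurableSet.iInter fun _ =>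
      MeasurableSet.iInter fun j => MeasurableSet.iInter fun _ => ?_
    exact measurableSet_le ((hXi i).dist (hXi j)) measurable_const
  · have : (fun o => idxDiam (X o) J) ⁻¹' Set.Iic r = ∅ := by
      ext o
      simp only [Set.mem_preimage, Set.mem_Iic, Set.mem_empty_iff_false, iff_false, not_le]
      exact (not_le.1 hr).trans_le Metric.diam_nonneg
    rw [this]; exact MeasurableSet.empty

end Measurability

/-! ### Combinatorics of one run of the basic procedure -/

section Basic

variable {D n : ℕ} {X : Fin n → E D} {c : Cell D} {ξ : ℕ → E D × ℝ}

/-- Threshold at which the cell `a` is split at step `i` (counted from `0`) of a run on `c`. -/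
def threshold (X : Fin n → E D) (c : Cell D) (ξ : ℕ → E D × ℝ) (i : ℕ) (a : Cell D) : ℝ :=
  if Odd (c.level + (i + 1)) then
    projMedian X c.carrier (ξ i).1 + (ξ i).2 * (6 / √(D : ℝ)) * dataDiam X c.carrier
  else projMedian X a.carrier (ξ i).1

theorem basicPart_succ (i : ℕ) : basicPart X c ξ (i + 1) =
    (basicPart X c ξ i).flatMap fun a => split a (ξ i).1 (threshold X c ξ i a) := rfl

theorem mem_basicPart_succ {i : ℕ} {b : Cell D} : b ∈ basicPart X c ξ (i + 1) ↔
    ∃ a ∈ basicPart X c ξ i, b ∈ split a (ξ i).1 (threshold X c ξ i a) := by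
  rw [basicPart_succ, List.mem_flatMap]

theorem mem_split {a b : Cell D} {v : E D} {t : ℝ} : b ∈ split a v t ↔
    b = ⟨false :: a.addr, {x ∈ a.carrier | inner ℝ x v ≤ t}⟩ ∨
    b = ⟨true :: a.addr, a.carrier \ {x ∈ a.carrier | inner ℝ x v ≤ t}⟩ := by
  simp [split]

theorem carrier_subset_of_mem_split {a b : Cell D} {v : E D} {t : ℝ} (h : b ∈ split a v t) :
    b.carrier ⊆ a.carrier := by
  rcases mem_split.1 h with rfl | rfl
  · exact fun x hx => hx.1
  · exact Set.sdiff_subset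

theorem addr_of_mem_basicPart {i : ℕ} {a : Cell D} (h : a ∈ basicPart X c ξ i) :
    c.addr <:+ a.addr ∧ a.addr.length = c.addr.length + i := by
  induction i generalizing a with
  | zero => simp only [basicPart, List.mem_singleton] at h; subst h; simp
  | succ i ih =>
    obtain ⟨p, hp, ha⟩ := mem_basicPart_succ.1 h
    obtain ⟨h1, h2⟩ := ih hp
    rcases mem_split.1 ha with rfl | rfl
    · exact ⟨h1.trans (List.suffix_cons _ _), by simp [h2]; omega⟩
    · exact ⟨h1.trans (List.suffix_cons _ _), by simp [h2]; omega⟩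

theorem carrier_subset_of_mem_basicPart {i : ℕ} {a : Cell D} (h : a ∈ basicPart X c ξ i) :
    a.carrier ⊆ c.carrier := by
  induction i generalizing a with
  | zero => simp only [basicPart, List.mem_singleton] at h; subst h; exact subset_rfl
  | succ i ih =>
    obtain ⟨p, hp, ha⟩ := mem_basicPart_succ.1 h
    exact (carrier_subset_of_mem_split ha).trans (ih hp)

theorem basicPart_ext {i : ℕ} {a b : Cell D} (ha : a ∈ basicPart X c ξ i)
    (hb : b ∈ basicPart X c ξ i) (hab : a.addr = b.addr) : a = b := by
  induction i generalizing a b with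
  | zero =>
    simp only [basicPart, List.mem_singleton] at ha hb
    rw [ha, hb]
  | succ i ih =>
    obtain ⟨p, hp, ha⟩ := mem_basicPart_succ.1 ha
    obtain ⟨q, hq, hb⟩ := mem_basicPart_succ.1 hb
    rcases mem_split.1 ha with rfl | rfl <;> rcases mem_split.1 hb with rfl | rfl <;>
      simp only [List.cons.injEq, true_and, reduceCtorEq, false_and] at hab
    · rw [ih hp hq hab]
    · rw [ih hp hq hab]

theorem basicPart_eq_of_mem {i : ℕ} {a b : Cell D} {x : E D} (ha : a ∈ basicPart X c ξ i)
    (hb : b ∈ basicPart X c ξ i) (hxa : x ∈ a.carrier) (hxb : x ∈ b.carrier) : a = b := by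
  induction i generalizing a b with
  | zero =>
    simp only [basicPart, List.mem_singleton] at ha hb
    rw [ha, hb]
  | succ i ih =>
    obtain ⟨p, hp, ha⟩ := mem_basicPart_succ.1 ha
    obtain ⟨q, hq, hb⟩ := mem_basicPart_succ.1 hb
    obtain rfl := ih hp hq (carrier_subset_of_mem_split ha hxa) (carrier_subset_of_mem_split hb hxb)
    rcases mem_split.1 ha with rfl | rfl <;> rcases mem_split.1 hb with rfl | rfl
    · rfl
    · exact absurd hxa hxb.2
    · exact absurd hxb hxa.2
    · rfl

theorem length_basicPart (i : ℕ) : (basicPart X c ξ i).length = 2 ^ i := by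
  induction i with
  | zero => simp [basicPart]
  | succ i ih =>
    rw [basicPart_succ, List.length_flatMap]
    simp [split, ih, pow_succ]

theorem sum_map_flatMap {α β : Type*} (l : List α) (f : α → List β) (g : β → ℝ) :
    ((l.flatMap f).map g).sum = (l.map fun a => ((f a).map g).sum).sum := by
  induction l with
  | nil => simp
  | cons a l ih => simp [ih]

/-- A set function that is additive under hyperplane splits is additive over the partition grown
by the basic procedure. -/
theorem sum_basicPart {m : Set (E D) → ℝ}
    (hm : ∀ (A : Set (E D)) (v : E D) (t : ℝ),
      m {x ∈ A | inner ℝ x v ≤ t} + m (A \ {x ∈ A | inner ℝ x v ≤ t}) = m A) (i : ℕ) :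
    ((basicPart X c ξ i).map fun a => m a.carrier).sum = m c.carrier := by
  induction i with
  | zero => simp [basicPart]
  | succ i ih =>
    rw [basicPart_succ, sum_map_flatMap, ← ih]
    congr 1
    refine List.map_congr_left fun a _ => ?_
    simpa only [split, List.map_cons, List.map_nil, List.sum_cons, List.sum_nil, add_zero] using
      hm a.carrier _ _

/-- A noisy split uses the same hyperplane for all the cells: the points of a later cell are on
the same side of it. -/
theorem same_side {m : ℕ} {a : Cell D} (ha : a ∈ basicPart X c ξ m) {i : ℕ} (hi : i < m)
    (hodd : Odd (c.level + (i + 1))) {x y : E D} (hx : x ∈ a.carrier) (hy : y ∈ a.carrier) :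
    inner ℝ x (ξ i).1 ≤ threshold X c ξ i c ↔ inner ℝ y (ξ i).1 ≤ threshold X c ξ i c := by
  induction m generalizing a with
  | zero => omega
  | succ m ih =>
    obtain ⟨p, hp, ha⟩ := mem_basicPart_succ.1 ha
    rcases Nat.lt_succ_iff_lt_or_eq.1 hi with h | rfl
    · exact ih hp h (carrier_subset_of_mem_split ha hx) (carrier_subset_of_mem_split ha hy)
    · have ht : threshold X c ξ i p = threshold X c ξ i c := by simp [threshold, hodd]
      rw [ht] at ha
      rcases mem_split.1 ha with rfl | rfl
      · exact iff_of_true hx.2 hy.2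
      · exact iff_of_false (fun h => hx.2 ⟨hx.1, h⟩) (fun h => hy.2 ⟨hy.1, h⟩)

end Basic

/-! ### Data diameters -/

section Diam

variable {D n : ℕ} {X : Fin n → E D}

theorem dataDiam_nonneg (A : Set (E D)) : 0 ≤ dataDiam X A := Metric.diam_nonneg

theorem empMass_nonneg (A : Set (E D)) : 0 ≤ empMass X A := by rw [empMass_eq]; positivity

theorem dataDiam_mono {A B : Set (E D)} (h : A ⊆ B) : dataDiam X A ≤ dataDiam X B :=
  Metric.diam_mono (Set.inter_subset_inter_right _ h)
    (((Set.finite_range X).inter_of_left B).isBounded)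

theorem dist_le_dataDiam {A : Set (E D)} {i j : Fin n} (hi : X i ∈ A) (hj : X j ∈ A) :
    dist (X i) (X j) ≤ dataDiam X A :=
  Metric.dist_le_diam_of_mem ((Set.finite_range X).inter_of_left A).isBounded
    ⟨⟨i, rfl⟩, hi⟩ ⟨⟨j, rfl⟩, hj⟩

theorem dataDiam_eq_zero_of_empMass {A : Set (E D)} (h : empMass X A = 0) : dataDiam X A = 0 := by
  rcases Nat.eq_zero_or_pos n with rfl | hn
  · simp [dataDiam]
  · rw [empMass_eq, div_eq_zero_iff] at h
    have h0 : idxSet X A = ∅ := by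
      rcases h with h | h
      · exact_mod_cast Finset.card_eq_zero.1 (by exact_mod_cast h)
      · exact absurd h (by positivity)
    rw [dataDiam_eq, h0]; simp [idxDiam]

theorem empMass_split (A : Set (E D)) (v : E D) (t : ℝ) :
    empMass X {x ∈ A | inner ℝ x v ≤ t} + empMass X (A \ {x ∈ A | inner ℝ x v ≤ t}) =
      empMass X A := by
  classical
  simp only [empMass, ← add_div, ← Finset.sum_add_distrib]
  congr 1
  refine Finset.sum_congr rfl fun i _ => ?_
  by_cases h1 : X i ∈ A <;> by_cases h2 : inner ℝ (X i) v ≤ t <;> simp [Set.indicator_apply, h1, h2]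

/-- Mass-weighted sum of squared data diameters over a collection of cells. -/
def massDiam (X : Fin n → E D) (P : List (Cell D)) : ℝ :=
  (P.map fun c => empMass X c.carrier * dataDiam X c.carrier ^ 2).sum

theorem massDiam_nonneg (P : List (Cell D)) : 0 ≤ massDiam X P :=
  List.sum_nonneg fun x hx => by
    obtain ⟨c, _, rfl⟩ := List.mem_map.1 hx
    exact mul_nonneg (empMass_nonneg _) (sq_nonneg _)

theorem sum_empMass_nonneg (P : List (Cell D)) : 0 ≤ (P.map fun c => empMass X c.carrier).sum :=
  List.sum_nonneg fun x hx => by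
    obtain ⟨c, _, rfl⟩ := List.mem_map.1 hx
    exact empMass_nonneg _

theorem sum_map_le_mul_sum {α : Type*} (l : List α) {f g : α → ℝ} {K : ℝ}
    (h : ∀ a ∈ l, f a ≤ K * g a) : (l.map f).sum ≤ K * (l.map g).sum := by
  induction l with
  | nil => simp
  | cons a l ih =>
    simp only [List.map_cons, List.sum_cons, mul_add]
    exact add_le_add (h a (by simp)) (ih fun b hb => h b (by simp [hb]))

theorem massDiam_le_mul {P : List (Cell D)} {K : ℝ} (h : ∀ c ∈ P, dataDiam X c.carrier ^ 2 ≤ K) :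
    massDiam X P ≤ K * (P.map fun c => empMass X c.carrier).sum :=
  sum_map_le_mul_sum P fun c hc => by
    rw [mul_comm K]; exact mul_le_mul_of_nonneg_left (h c hc) (empMass_nonneg _)

theorem avgDiam_le_of_forall {P : List (Cell D)} {r : ℝ} (hr : 0 ≤ r)
    (h : ∀ c ∈ P, dataDiam X c.carrier ≤ r) : avgDiam X P ≤ r := by
  refine Real.sqrt_le_iff.2 ⟨hr, ?_⟩
  refine div_le_of_le_mul₀ (sum_empMass_nonneg P) (sq_nonneg r) ?_
  exact massDiam_le_mul fun c hc => pow_le_pow_left₀ (dataDiam_nonneg _) (h c hc) 2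

theorem massDiam_le_of_avgDiam {P : List (Cell D)} {r : ℝ} (h : avgDiam X P ≤ r) :
    massDiam X P ≤ r ^ 2 * (P.map fun c => empMass X c.carrier).sum := by
  rcases (sum_empMass_nonneg (X := X) P).eq_or_lt with h0 | h0
  · have : ∀ c ∈ P, empMass X c.carrier = 0 := by
      intro c hc
      have h1 := (List.all_zero_of_le_zero_le_of_sum_eq_zero
        (l := P.map fun c => empMass X c.carrier)
        (fun x hx => by
          obtain ⟨c, _, rfl⟩ := List.mem_map.1 hx
          exact empMass_nonneg _) h0.symm) (List.mem_map_of_mem hc)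
      exact h1
    rw [← h0, mul_zero]
    refine (massDiam_le_mul (K := 0) fun c hc => ?_).trans (by simp)
    rw [dataDiam_eq_zero_of_empMass (this c hc)]; simp
  · have := (Real.sqrt_le_iff.1 h).2
    rwa [div_le_iff₀ h0] at this

theorem avgDiam_singleton_eq (c : Cell D) : avgDiam X [c] = dataDiam X c.carrier := by
  by_cases h : empMass X c.carrier = 0
  · simp [avgDiam, h, dataDiam_eq_zero_of_empMass h]
  · simp only [avgDiam, List.map_cons, List.map_nil, List.sum_cons, List.sum_nil, add_zero]
    rw [mul_div_cancel_left₀ _ h, Real.sqrt_sq (dataDiam_nonneg _)]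

theorem exists_dataDiam_pos {P : List (Cell D)} (h : avgDiam X P ≠ 0) :
    ∃ c ∈ P, 0 < dataDiam X c.carrier := by
  by_contra! hc
  exact h (le_antisymm (avgDiam_le_of_forall le_rfl hc) (Real.sqrt_nonneg _))

theorem massDiam_eq_zero_of_avgDiam {P : List (Cell D)} (h : avgDiam X P = 0) :
    massDiam X P = 0 := by
  refine le_antisymm ?_ (massDiam_nonneg P)
  simpa using massDiam_le_of_avgDiam h.le

end Diam

/-! ### Depths of the trees -/

section Depth

variable {D n : ℕ} {X : Fin n → E D} {c : Cell D} {ω : Seeds D} {δ : ℝ}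

theorem basicDepth_le {Δ : ℝ} {ξ : ℕ → E D × ℝ} {m : ℕ} (h : avgDiam X (basicPart X c ξ m) ≤ Δ) :
    basicDepth X c Δ ξ ≤ m :=
  iInf₂_le (f := fun (i : ℕ) (_ : i ∈ {i : ℕ | avgDiam X (basicPart X c ξ i) ≤ Δ}) => (i : ℕ∞)) m h

theorem avgDiam_le_of_basicDepth_eq {Δ : ℝ} {ξ : ℕ → E D × ℝ} {m : ℕ}
    (h : basicDepth X c Δ ξ = m) : avgDiam X (basicPart X c ξ m) ≤ Δ := by
  by_contra hm
  have h1 : ((m : ℕ∞) : ℕ∞) < m + 1 := by exact_mod_cast Nat.lt_succ_self m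
  have h2 : basicDepth X c Δ ξ < m + 1 := by rw [h]; exact h1
  simp only [basicDepth, iInf_lt_iff] at h2
  obtain ⟨i, hi, hlt⟩ := h2
  have hle : (m : ℕ∞) ≤ i := by rw [← h]; exact basicDepth_le hi
  have : i = m := by
    have h3 : i < m + 1 := by exact_mod_cast hlt
    have h4 : m ≤ i := by exact_mod_cast hle
    omega
  exact hm (this ▸ hi)

theorem coreDepth_le_trialDepth {t : ℕ} (ht : t < numTrials n δ) :
    coreDepth X δ ω c ≤ trialDepth X ω c t :=
  iInf₂_le (f := fun (t : ℕ) (_ : t ∈ {t : ℕ | t < numTrials n δ}) => trialDepth X ω c t) t ht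

theorem exists_trialDepth_eq (hT : 0 < numTrials n δ) :
    ∃ t < numTrials n δ, trialDepth X ω c t = coreDepth X δ ω c := by
  obtain ⟨t, ht, hmin⟩ := Finset.exists_min_image (Finset.range (numTrials n δ))
    (fun t => trialDepth X ω c t) ⟨0, by simpa using hT⟩
  refine ⟨t, by simpa using ht, le_antisymm ?_ (coreDepth_le_trialDepth (by simpa using ht))⟩
  exact le_iInf₂ fun s hs => hmin s (by simpa using hs)

theorem bestTrial_spec (hT : 0 < numTrials n δ) : bestTrial X δ ω c < numTrials n δ ∧
    trialDepth X ω c (bestTrial X δ ω c) = coreDepth X δ ω c :=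
  Nat.sInf_mem (s := {t | t < numTrials n δ ∧ trialDepth X ω c t = coreDepth X δ ω c})
    (exists_trialDepth_eq hT)

theorem avgDiam_coreLeaves_le (hT : 0 < numTrials n δ) {m : ℕ} (h : coreDepth X δ ω c = m) :
    avgDiam X (coreLeaves X δ ω c) ≤ dataDiam X c.carrier / 2 := by
  have h1 := (bestTrial_spec (X := X) (c := c) (ω := ω) hT).2
  rw [h] at h1
  have h2 := avgDiam_le_of_basicDepth_eq h1
  rwa [coreLeaves, h, ENat.toNat_natCast]

theorem coreDepth_eq_zero (hT : 0 < numTrials n δ) (h : dataDiam X c.carrier = 0) :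
    coreDepth X δ ω c = 0 := by
  have h1 : trialDepth X ω c 0 ≤ (0 : ℕ) := by
    refine basicDepth_le ?_
    rw [basicPart, avgDiam_singleton_eq, h]; simp
  simpa using (coreDepth_le_trialDepth hT).trans h1

theorem one_le_coreDepth (hT : 0 < numTrials n δ) (h : 0 < dataDiam X c.carrier) :
    1 ≤ coreDepth X δ ω c := by
  rw [Order.one_le_iff_ne_zero]
  intro h0
  have := avgDiam_coreLeaves_le (X := X) (c := c) (ω := ω) (δ := δ) hT (m := 0) (by simpa using h0)
  rw [coreLeaves, h0] at this
  simp only [ENat.toNat_zero, basicPart, avgDiam_singleton_eq] at this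
  linarith

theorem coreLeaves_congr {ω' : Seeds D} (h : ∀ t i, ω (c.addr, t, i) = ω' (c.addr, t, i)) :
    coreLeaves X δ ω c = coreLeaves X δ ω' c := by
  have h1 : trialSeeds ω c = trialSeeds ω' c := by
    funext t i; exact h t i
  simp only [coreLeaves, bestTrial, coreDepth, trialDepth, h1]

theorem addr_of_mem_coreLeaves {a : Cell D} (h : a ∈ coreLeaves X δ ω c) :
    c.addr <:+ a.addr ∧ a.addr.length = c.addr.length + (coreDepth X δ ω c).toNat :=
  addr_of_mem_basicPart h

theorem eq_of_mem_coreLeaves_of_length {a : Cell D} (h : a ∈ coreLeaves X δ ω c)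
    (hl : a.addr.length = c.addr.length) : a = c := by
  have := (addr_of_mem_coreLeaves h).2
  have h0 : (coreDepth X δ ω c).toNat = 0 := by omega
  rw [coreLeaves, h0] at h
  simpa [basicPart] using h

end Depth

/-! ### Combinatorics of the adaptive tree -/

section Adaptive

variable {D n : ℕ} {S : Set (E D)} {X : Fin n → E D} {ω : Seeds D} {δ : ℝ}

theorem mem_adaptivePart_succ {i : ℕ} {b : Cell D} : b ∈ adaptivePart S X δ ω (i + 1) ↔
    ∃ a ∈ adaptivePart S X δ ω i, b ∈ coreLeaves X δ ω a := by
  rw [adaptivePart, List.mem_flatMap]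

theorem carrier_subset_of_mem_adaptivePart {i : ℕ} {a : Cell D}
    (h : a ∈ adaptivePart S X δ ω i) : a.carrier ⊆ S := by
  induction i generalizing a with
  | zero => simp only [adaptivePart, List.mem_singleton] at h; subst h; exact subset_rfl
  | succ i ih =>
    obtain ⟨p, hp, ha⟩ := mem_adaptivePart_succ.1 h
    exact (carrier_subset_of_mem_basicPart ha).trans (ih hp)

/-- Cells of one partition have incomparable addresses. -/
theorem adaptivePart_eq_of_suffix {i : ℕ} {a b : Cell D} (ha : a ∈ adaptivePart S X δ ω i)
    (hb : b ∈ adaptivePart S X δ ω i) (hab : a.addr <:+ b.addr) : a = b := by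
  induction i generalizing a b with
  | zero =>
    simp only [adaptivePart, List.mem_singleton] at ha hb
    rw [ha, hb]
  | succ i ih =>
    obtain ⟨p, hp, ha⟩ := mem_adaptivePart_succ.1 ha
    obtain ⟨q, hq, hb⟩ := mem_adaptivePart_succ.1 hb
    have ha' := addr_of_mem_coreLeaves ha
    have hb' := addr_of_mem_coreLeaves hb
    have hpq : p = q := by
      rcases List.suffix_or_suffix_of_suffix (ha'.1.trans hab) hb'.1 with h | h
      · exact ih hp hq h
      · exact (ih hq hp h).symm
    subst hpq
    exact basicPart_ext ha hb (hab.eq_of_length (by rw [ha'.2, hb'.2]))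

theorem adaptivePart_eq_of_mem {i : ℕ} {a b : Cell D} {x : E D}
    (ha : a ∈ adaptivePart S X δ ω i) (hb : b ∈ adaptivePart S X δ ω i) (hxa : x ∈ a.carrier)
    (hxb : x ∈ b.carrier) : a = b := by
  induction i generalizing a b with
  | zero =>
    simp only [adaptivePart, List.mem_singleton] at ha hb
    rw [ha, hb]
  | succ i ih =>
    obtain ⟨p, hp, ha⟩ := mem_adaptivePart_succ.1 ha
    obtain ⟨q, hq, hb⟩ := mem_adaptivePart_succ.1 hb
    obtain rfl := ih hp hq (carrier_subset_of_mem_basicPart ha hxa)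
      (carrier_subset_of_mem_basicPart hb hxb)
    exact basicPart_eq_of_mem ha hb hxa hxb

theorem exists_ancestor {i k : ℕ} {c : Cell D} (hc : c ∈ adaptivePart S X δ ω (i + k)) :
    ∃ p ∈ adaptivePart S X δ ω i, p.addr <:+ c.addr ∧ (p.addr = c.addr → p = c) := by
  induction k generalizing c with
  | zero => exact ⟨c, hc, List.suffix_rfl, fun _ => rfl⟩
  | succ k ih =>
    obtain ⟨q, hq, hcq⟩ := mem_adaptivePart_succ.1 hc
    obtain ⟨p, hp, hpq, heq⟩ := ih hq
    have hqc := addr_of_mem_coreLeaves hcq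
    refine ⟨p, hp, hpq.trans hqc.1, fun h => ?_⟩
    have h1 : q.addr.length = c.addr.length :=
      le_antisymm hqc.1.length_le (h ▸ hpq.length_le)
    obtain rfl := eq_of_mem_coreLeaves_of_length hcq h1.symm
    exact heq h

/-- A node of the tree is determined by its address. -/
theorem adaptivePart_unique {i j : ℕ} {a b : Cell D} (ha : a ∈ adaptivePart S X δ ω i)
    (hb : b ∈ adaptivePart S X δ ω j) (hab : a.addr = b.addr) : a = b := by
  wlog hij : i ≤ j generalizing i j a b
  · exact (this hb ha hab.symm (by omega)).symm
  obtain ⟨k, rfl⟩ := Nat.exists_eq_add_of_le hij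
  obtain ⟨p, hp, hpb, heq⟩ := exists_ancestor hb
  obtain rfl := adaptivePart_eq_of_suffix hp ha (hab ▸ hpb)
  exact heq hab

/-- Whether and with which region a node is called does not depend on the seeds attached to it. -/
theorem exists_mem_adaptivePart_congr {ω' : Seeds D} {a : List Bool}
    (h : ∀ b t i, b ≠ a → ω (b, t, i) = ω' (b, t, i)) {i : ℕ} {c : Cell D}
    (hc : c ∈ adaptivePart S X δ ω i) (hca : c.addr <:+ a) :
    ∃ j, c ∈ adaptivePart S X δ ω' j := by
  induction i generalizing c with
  | zero => exact ⟨0, hc⟩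
  | succ i ih =>
    obtain ⟨p, hp, hcp⟩ := mem_adaptivePart_succ.1 hc
    have hpc := addr_of_mem_coreLeaves hcp
    by_cases hpa : p.addr = a
    · have h1 : p.addr.length = c.addr.length :=
        le_antisymm hpc.1.length_le (hpa ▸ hca.length_le)
      obtain rfl := eq_of_mem_coreLeaves_of_length hcp h1.symm
      exact ih hp hca
    · obtain ⟨j, hj⟩ := ih hp (hpc.1.trans hca)
      refine ⟨j + 1, mem_adaptivePart_succ.2 ⟨p, hj, ?_⟩⟩
      rwa [← coreLeaves_congr fun t i => h _ t i hpa]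

theorem sum_adaptivePart {m : Set (E D) → ℝ}
    (hm : ∀ (A : Set (E D)) (v : E D) (t : ℝ),
      m {x ∈ A | inner ℝ x v ≤ t} + m (A \ {x ∈ A | inner ℝ x v ≤ t}) = m A) (i : ℕ) :
    ((adaptivePart S X δ ω i).map fun a => m a.carrier).sum = m S := by
  induction i with
  | zero => simp [adaptivePart]
  | succ i ih =>
    rw [adaptivePart, sum_map_flatMap, ← ih]
    congr 1
    exact List.map_congr_left fun a _ => sum_basicPart hm _

theorem cellOf_eq {i : ℕ} {c : Cell D} (hc : c ∈ adaptivePart S X δ ω i) {x : E D}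
    (hx : x ∈ c.carrier) : cellOf (adaptivePart S X δ ω i) x = c.carrier := by
  ext y
  constructor
  · rintro ⟨b, hb, hxb, hyb⟩
    rwa [adaptivePart_eq_of_mem hc hb hx hxb]
  · exact fun hy => ⟨c, hc, hx, hy⟩

/-- Every call on the cells of the first `i` partitions returns a tree of depth at most `k`. -/
def DepthLE (S : Set (E D)) (X : Fin n → E D) (δ : ℝ) (ω : Seeds D) (i : ℕ) (k : ℝ) : Prop :=
  ∀ j < i, ∀ c ∈ adaptivePart S X δ ω j, ∃ m : ℕ, coreDepth X δ ω c = m ∧ (m : ℝ) ≤ k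

theorem massDiam_flatMap (P : List (Cell D)) (f : Cell D → List (Cell D)) :
    massDiam X (P.flatMap f) = (P.map fun c => massDiam X (f c)).sum :=
  sum_map_flatMap _ _ _

theorem massDiam_adaptivePart_le (hT : 0 < numTrials n δ) {k : ℝ} {i : ℕ}
    (h : DepthLE S X δ ω i k) :
    massDiam X (adaptivePart S X δ ω i) ≤ (1 / 4) ^ i * (empMass X S * dataDiam X S ^ 2) := by
  induction i with
  | zero => simp [massDiam, adaptivePart]
  | succ i ih =>
    rw [adaptivePart, massDiam_flatMap, pow_succ']
    have h1 : ∀ c ∈ adaptivePart S X δ ω i, massDiam X (coreLeaves X δ ω c) ≤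
        1 / 4 * (empMass X c.carrier * dataDiam X c.carrier ^ 2) := by
      intro c hc
      obtain ⟨m, hm, _⟩ := h i (Nat.lt_succ_self i) c hc
      have := massDiam_le_of_avgDiam (avgDiam_coreLeaves_le hT hm)
      rw [coreLeaves, sum_basicPart empMass_split] at this
      rw [coreLeaves]
      linarith
    have h2 := sum_map_le_mul_sum _ h1
    have h3 := ih fun j hj => h j (hj.trans (Nat.lt_succ_self i))
    rw [massDiam] at h3
    linarith

theorem length_adaptivePart_le {k : ℝ} {i : ℕ} (h : DepthLE S X δ ω i k) :
    ((adaptivePart S X δ ω i).length : ℝ) ≤ ((2 : ℝ) ^ k) ^ i := by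
  induction i with
  | zero => simp [adaptivePart]
  | succ i ih =>
    have h3 := ih fun j hj => h j (hj.trans (Nat.lt_succ_self i))
    rw [adaptivePart, pow_succ']
    have h1 : ∀ c ∈ adaptivePart S X δ ω i, ((coreLeaves X δ ω c).length : ℝ) ≤
        (2 : ℝ) ^ k * 1 := by
      intro c hc
      obtain ⟨m, hm, hmk⟩ := h i (Nat.lt_succ_self i) c hc
      rw [coreLeaves, length_basicPart, hm, ENat.toNat_natCast, mul_one]
      push_cast
      rw [← Real.rpow_natCast]
      exact Real.rpow_le_rpow_of_exponent_le (by norm_num) hmk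
    have h2 := sum_map_le_mul_sum _ h1
    have h4 : (((adaptivePart S X δ ω i).flatMap (coreLeaves X δ ω)).length : ℝ) =
        ((adaptivePart S X δ ω i).map fun c => ((coreLeaves X δ ω c).length : ℝ)).sum := by
      rw [List.length_flatMap]
      induction adaptivePart S X δ ω i with
      | nil => simp
      | cons a l ih => simp [ih]
    rw [h4]
    refine h2.trans ?_
    have h5 : ((adaptivePart S X δ ω i).map fun _ => (1 : ℝ)).sum =
        (adaptivePart S X δ ω i).length := by simp
    rw [h5]
    gcongr

theorem level_le {k : ℝ} {i : ℕ} (h : DepthLE S X δ ω i k) {c : Cell D}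
    (hc : c ∈ adaptivePart S X δ ω i) : (c.level : ℝ) ≤ i * k := by
  induction i generalizing c with
  | zero => simp only [adaptivePart, List.mem_singleton] at hc; subst hc; simp [Cell.level]
  | succ i ih =>
    obtain ⟨p, hp, hcp⟩ := mem_adaptivePart_succ.1 hc
    have h3 := ih (fun j hj => h j (hj.trans (Nat.lt_succ_self i))) hp
    obtain ⟨m, hm, hmk⟩ := h i (Nat.lt_succ_self i) p hp
    have := (addr_of_mem_coreLeaves hcp).2
    rw [hm, ENat.toNat_natCast] at this
    simp only [Cell.level] at h3 ⊢
    rw [this]; push_cast; linarith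

theorem le_level (hT : 0 < numTrials n δ) {k : ℝ} {i : ℕ} (h : DepthLE S X δ ω i k) {c : Cell D}
    (hc : c ∈ adaptivePart S X δ ω i) (hd : 0 < dataDiam X c.carrier) : i ≤ c.level := by
  induction i generalizing c with
  | zero => simp
  | succ i ih =>
    obtain ⟨p, hp, hcp⟩ := mem_adaptivePart_succ.1 hc
    have hpd : 0 < dataDiam X p.carrier :=
      hd.trans_le (dataDiam_mono (carrier_subset_of_mem_basicPart hcp))
    have h3 := ih (fun j hj => h j (hj.trans (Nat.lt_succ_self i))) hp hpd
    obtain ⟨m, hm, hmk⟩ := h i (Nat.lt_succ_self i) p hp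
    have h1 := one_le_coreDepth (X := X) (ω := ω) hT hpd
    rw [hm] at h1
    have h1' : 1 ≤ m := by exact_mod_cast h1
    have := (addr_of_mem_coreLeaves hcp).2
    rw [hm, ENat.toNat_natCast] at this
    simp only [Cell.level] at h3 ⊢
    omega

theorem level_le_partLevel {P : List (Cell D)} {c : Cell D} (hc : c ∈ P) :
    c.level ≤ partLevel P := by
  induction P with
  | nil => simp at hc
  | cons a P ih =>
    simp only [partLevel, List.map_cons, List.foldr_cons] at ih ⊢
    rcases List.mem_cons.1 hc with rfl | h
    · exact le_max_left _ _
    · exact (ih h).trans (le_max_right _ _)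

theorem partLevel_le {P : List (Cell D)} {m : ℕ} (h : ∀ c ∈ P, c.level ≤ m) :
    partLevel P ≤ m := by
  induction P with
  | nil => simp [partLevel]
  | cons a P ih =>
    simp only [partLevel, List.map_cons, List.foldr_cons] at ih ⊢
    exact max_le (h a (by simp)) (ih fun c hc => h c (by simp [hc]))

theorem depthLE_of_attainsRate {k : ℝ} (h : AttainsRate S X δ ω k) {i : ℕ}
    (hi : ∀ j < i, ¬ StopCond S X δ ω j) : DepthLE S X δ ω i k :=
  fun j hj => h j fun l hl => hi l (hl.trans_lt hj)

/-- The algorithm stops after at most `⌈log n²⌉` rounds. -/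
theorem exists_stopsAt (hn : 2 ≤ n) (hT : 0 < numTrials n δ) {k : ℝ} (h : AttainsRate S X δ ω k) :
    ∃ i, StopsAt S X δ ω i := by
  classical
  have hex : ∃ i, StopCond S X δ ω i := by
    by_contra! hno
    have hL : 0 < Real.logb 2 ((n : ℝ) ^ 2) := by
      refine Real.logb_pos (by norm_num) ?_
      have : (2 : ℝ) ≤ n := by exact_mod_cast hn
      nlinarith
    set i := ⌈Real.logb 2 ((n : ℝ) ^ 2)⌉₊ with hi
    have hi1 : 1 ≤ i := Nat.one_le_iff_ne_zero.2 (by rw [hi]; exact (Nat.ceil_pos.2 hL).ne')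
    have hd := depthLE_of_attainsRate h (i := i) fun j _ => hno j
    have hs := hno i
    simp only [StopCond, not_and, not_or, not_le] at hs
    obtain ⟨h1, h2⟩ := hs hi1
    obtain ⟨c, hc, hcd⟩ := exists_dataDiam_pos h1
    have h3 := le_level hT hd hc hcd
    have h4 := level_le_partLevel hc
    have h5 : (i : ℝ) ≤ partLevel (adaptivePart S X δ ω i) := by exact_mod_cast h3.trans h4
    have h6 := Nat.le_ceil (Real.logb 2 ((n : ℝ) ^ 2))
    rw [← hi] at h6
    linarith
  exact ⟨Nat.find hex, Nat.find_spec hex, fun j hj => Nat.find_min hex hj⟩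

theorem stopsAt_le (hT : 0 < numTrials n δ) {k : ℝ}
    (h : AttainsRate S X δ ω k) {i : ℕ} (hi : StopsAt S X δ ω i) :
    i ≤ ⌈Real.logb 2 ((n : ℝ) ^ 2)⌉₊ ∨ i = 1 := by
  by_contra! hcon
  obtain ⟨hlt, hne⟩ := hcon
  have hi1 : 1 ≤ i := hi.1.1
  obtain ⟨j, rfl⟩ : ∃ j, i = j + 1 := ⟨i - 1, by omega⟩
  have hj1 : 1 ≤ j := by omega
  have hs := hi.2 j (Nat.lt_succ_self j)
  have hd := depthLE_of_attainsRate h (i := j) fun l hl => hi.2 l (hl.trans (Nat.lt_succ_self j))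
  simp only [StopCond, not_and, not_or, not_le] at hs
  obtain ⟨h1, h2⟩ := hs hj1
  obtain ⟨c, hc, hcd⟩ := exists_dataDiam_pos h1
  have h3 := le_level hT hd hc hcd
  have h4 := level_le_partLevel hc
  have h5 : (j : ℝ) ≤ partLevel (adaptivePart S X δ ω j) := by exact_mod_cast h3.trans h4
  have h6 : ⌈Real.logb 2 ((n : ℝ) ^ 2)⌉₊ ≤ j := by omega
  have h7 := Nat.le_ceil (Real.logb 2 ((n : ℝ) ^ 2))
  have h8 : ((⌈Real.logb 2 ((n : ℝ) ^ 2)⌉₊ : ℕ) : ℝ) ≤ j := by exact_mod_cast h6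
  linarith

/-- If every called node of level below `log n²` has a tree of depth at most `k`, then the rate `k`
is attained. -/
theorem attainsRate_of_forall (hn : 2 ≤ n) {k : ℝ}
    (h : ∀ i, ∀ c ∈ adaptivePart S X δ ω i, (c.level : ℝ) < Real.logb 2 ((n : ℝ) ^ 2) →
      ∃ m : ℕ, coreDepth X δ ω c = m ∧ (m : ℝ) ≤ k) : AttainsRate S X δ ω k := by
  intro i hi c hc
  refine h i c hc ?_
  rcases Nat.eq_zero_or_pos i with rfl | hpos
  · simp only [adaptivePart, List.mem_singleton] at hc
    subst hc
    simp only [Cell.level, List.length_nil, Nat.cast_zero]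
    refine Real.logb_pos (by norm_num) ?_
    have : (2 : ℝ) ≤ n := by exact_mod_cast hn
    nlinarith
  · have := hi i le_rfl
    simp only [StopCond, not_and, not_or, not_le] at this
    refine lt_of_le_of_lt ?_ (this hpos).2
    exact_mod_cast level_le_partLevel hc

end Adaptive

/-! ### Index trees and measurability of the algorithm -/

/-- The trace of a cell on the data: its address, the indices of the sample points that it contains,
and whether it contains a further point. All decisions of the algorithm depend on the cells through
their traces only, and there are countably many of them. -/
abbrev Trace (n : ℕ) : Type := List Bool × Finset (Fin n) × Bool

section Trace

variable {D n : ℕ}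

open Classical in
/-- Trace of the cell `c` on the sample `X` and the point `x`. -/
def trace (X : Fin n → E D) (x : E D) (c : Cell D) : Trace n :=
  (c.addr, idxSet X c.carrier, decide (x ∈ c.carrier))

open Classical in
/-- `split` on the level of traces. -/
def trSplit (X : Fin n → E D) (x : E D) (s : Trace n) (v : E D) (t : ℝ) : List (Trace n) :=
  [(false :: s.1, s.2.1.filter fun i => inner ℝ (X i) v ≤ t, s.2.2 && decide (inner ℝ x v ≤ t)),
   (true :: s.1, s.2.1.filter fun i => ¬ inner ℝ (X i) v ≤ t, s.2.2 && !decide (inner ℝ x v ≤ t))]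

/-- `threshold` on the level of traces. -/
def trThreshold (X : Fin n → E D) (s₀ : Trace n) (p : E D × ℝ) (i : ℕ) (s : Trace n) : ℝ :=
  if Odd (s₀.1.length + (i + 1)) then
    idxMedian X s₀.2.1 p.1 + p.2 * (6 / √(D : ℝ)) * idxDiam X s₀.2.1
  else idxMedian X s.2.1 p.1

/-- `basicPart` on the level of traces. -/
def trBasic (X : Fin n → E D) (x : E D) (s₀ : Trace n) (ξ : ℕ → E D × ℝ) : ℕ → List (Trace n)
  | 0 => [s₀]
  | i + 1 => (trBasic X x s₀ ξ i).flatMap fun s =>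
      trSplit X x s (ξ i).1 (trThreshold X s₀ (ξ i) i s)

/-- `avgDiam` on the level of traces. -/
def trAvg (X : Fin n → E D) (P : List (Trace n)) : ℝ :=
  √((P.map fun s => (s.2.1.card : ℝ) / n * idxDiam X s.2.1 ^ 2).sum /
    (P.map fun s => (s.2.1.card : ℝ) / n).sum)

/-- `trialDepth` on the level of traces. -/
def trTrialDepth (X : Fin n → E D) (x : E D) (ω : Seeds D) (s : Trace n) (t : ℕ) : ℕ∞ :=
  ⨅ i ∈ {i : ℕ | trAvg X (trBasic X x s (fun j => ω (s.1, t, j)) i) ≤ idxDiam X s.2.1 / 2}, (i : ℕ∞)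

/-- `coreDepth` on the level of traces. -/
def trCoreDepth (X : Fin n → E D) (x : E D) (δ : ℝ) (ω : Seeds D) (s : Trace n) : ℕ∞ :=
  ⨅ t ∈ {t : ℕ | t < numTrials n δ}, trTrialDepth X x ω s t

/-- `bestTrial` on the level of traces. -/
def trBest (X : Fin n → E D) (x : E D) (δ : ℝ) (ω : Seeds D) (s : Trace n) : ℕ :=
  sInf {t : ℕ | t < numTrials n δ ∧ trTrialDepth X x ω s t = trCoreDepth X x δ ω s}

/-- `coreLeaves` on the level of traces. -/
def trLeaves (X : Fin n → E D) (x : E D) (δ : ℝ) (ω : Seeds D) (s : Trace n) : List (Trace n) :=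
  trBasic X x s (fun j => ω (s.1, trBest X x δ ω s, j)) (trCoreDepth X x δ ω s).toNat

open Classical in
/-- `adaptivePart` on the level of traces. -/
def trAdaptive (S : Set (E D)) (X : Fin n → E D) (x : E D) (δ : ℝ) (ω : Seeds D) :
    ℕ → List (Trace n)
  | 0 => [([], idxSet X S, decide (x ∈ S))]
  | i + 1 => (trAdaptive S X x δ ω i).flatMap (trLeaves X x δ ω)

variable (X : Fin n → E D) (x : E D)

theorem map_trace_split (c : Cell D) (v : E D) (t : ℝ) :
    (split c v t).map (trace X x) = trSplit X x (trace X x c) v t := by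
  classical
  simp only [split, trSplit, trace, List.map_cons, List.map_nil, List.cons.injEq, Prod.mk.injEq,
    true_and, and_true]
  refine ⟨⟨?_, ?_⟩, ?_, ?_⟩
  · ext i; simp
  · simp
  · ext i; simp only [mem_idxSet, Finset.mem_filter, Set.mem_sdiff, Set.mem_ofPred_eq]; tauto
  · by_cases h1 : x ∈ c.carrier <;> by_cases h2 : inner ℝ x v ≤ t <;>
      simp [h1, h2, lt_of_not_ge]

theorem map_trace_basicPart (c : Cell D) (ξ : ℕ → E D × ℝ) (i : ℕ) :
    (basicPart X c ξ i).map (trace X x) = trBasic X x (trace X x c) ξ i := by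
  induction i with
  | zero => rfl
  | succ i ih =>
    rw [basicPart_succ, trBasic, List.map_flatMap, ← ih, List.flatMap_map]
    congr 1
    funext a
    rw [map_trace_split]
    congr 1
    simp only [threshold, trThreshold, projMedian_eq, dataDiam_eq, trace, Cell.level]
    rfl

theorem trAvg_map_trace (P : List (Cell D)) : trAvg X (P.map (trace X x)) = avgDiam X P := by
  simp only [trAvg, avgDiam, List.map_map, empMass_eq, dataDiam_eq]
  rfl

variable (ω : Seeds D) (δ : ℝ)

theorem trTrialDepth_trace (c : Cell D) (t : ℕ) :
    trTrialDepth X x ω (trace X x c) t = trialDepth X ω c t := by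
  simp only [trTrialDepth, trialDepth, basicDepth, ← map_trace_basicPart, trAvg_map_trace,
    dataDiam_eq]
  rfl

theorem trCoreDepth_trace (c : Cell D) :
    trCoreDepth X x δ ω (trace X x c) = coreDepth X δ ω c := by
  simp only [trCoreDepth, trTrialDepth_trace, coreDepth]

theorem trLeaves_trace (c : Cell D) :
    trLeaves X x δ ω (trace X x c) = (coreLeaves X δ ω c).map (trace X x) := by
  simp only [trLeaves, trBest, trTrialDepth_trace, trCoreDepth_trace, coreLeaves,
    map_trace_basicPart]
  rfl

theorem map_trace_adaptivePart (S : Set (E D)) (i : ℕ) :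
    (adaptivePart S X δ ω i).map (trace X x) = trAdaptive S X x δ ω i := by
  induction i with
  | zero => rfl
  | succ i ih =>
    rw [adaptivePart, trAdaptive, List.map_flatMap, ← ih, List.flatMap_map]
    congr 1
    funext c
    rw [trLeaves_trace]

end Trace

theorem MeasFibers.of_le {Ω : Type*} [MeasurableSpace Ω] {f : Ω → ℕ∞}
    (hf : ∀ a, MeasurableSet {o | a ≤ f o}) : MeasFibers f := by
  intro m
  have : {o | f o = m} = {o | m ≤ f o} ∩ ⋂ a, ⋂ (_ : m < a), {o | a ≤ f o}ᶜ := by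
    ext o
    simp only [Set.mem_inter_iff, Set.mem_iInter, Set.mem_compl_iff, Set.mem_ofPred_eq]
    constructor
    · rintro rfl; exact ⟨le_rfl, fun a ha => not_le.2 ha⟩
    · rintro ⟨h1, h2⟩
      by_contra hne
      exact h2 _ (lt_of_le_of_ne h1 (Ne.symm hne)) le_rfl
  rw [this]
  exact (hf m).inter (MeasurableSet.iInter fun a => MeasurableSet.iInter fun _ => (hf a).compl)

section Measurability

variable {Ω : Type*} [MeasurableSpace Ω] {D n : ℕ} {X : Ω → Fin n → E D} {x : Ω → E D}
  {w : Ω → Seeds D} {δ : ℝ} {S : Set (E D)}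

theorem measurable_sample (hX : Measurable X) (i : Fin n) : Measurable fun o => X o i :=
  (measurable_pi_apply i).comp hX

theorem measurable_trThreshold (hX : Measurable X) {p : Ω → E D × ℝ} (hp : Measurable p)
    (s₀ s : Trace n) (i : ℕ) : Measurable fun o => trThreshold (X o) s₀ (p o) i s := by
  unfold trThreshold
  split_ifs
  · exact (measurable_idxMedian hX hp.fst _).add
      ((hp.snd.mul_const _).mul (measurable_idxDiam hX _))
  · exact measurable_idxMedian hX hp.fst _

theorem measFibers_trSplit (hX : Measurable X) (hx : Measurable x) {v : Ω → E D} {t : Ω → ℝ}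
    (hv : Measurable v) (ht : Measurable t) (s : Trace n) :
    MeasFibers fun o => trSplit (X o) (x o) s (v o) (t o) := by
  classical
  have h1 : ∀ i, MeasurableSet {o | inner ℝ (X o i) (v o) ≤ t o} := fun i =>
    measurableSet_le ((measurable_sample hX i).inner hv) ht
  have h2 : MeasurableSet {o | inner ℝ (x o) (v o) ≤ t o} := measurableSet_le (hx.inner hv) ht
  have h3 : MeasFibers fun o => s.2.1.filter fun i => inner ℝ (X o i) (v o) ≤ t o :=
    MeasFibers.filter _ (P := fun i o => inner ℝ (X o i) (v o) ≤ t o) h1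
  have h4 : MeasFibers fun o => s.2.1.filter fun i => ¬ inner ℝ (X o i) (v o) ≤ t o :=
    MeasFibers.filter _ (P := fun i o => ¬ inner ℝ (X o i) (v o) ≤ t o) fun i => (h1 i).compl
  have h5 : MeasFibers fun o => decide (inner ℝ (x o) (v o) ≤ t o) := MeasFibers.decide h2
  have := (h3.map₂ h4 Prod.mk).map₂ h5 fun q b =>
    [(false :: s.1, q.1, s.2.2 && b), (true :: s.1, q.2, s.2.2 && !b)]
  unfold trSplit
  exact this

theorem measFibers_trBasic (hX : Measurable X) (hx : Measurable x) {ξ : Ω → ℕ → E D × ℝ}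
    (hξ : ∀ i, Measurable fun o => ξ o i) (s₀ : Trace n) (i : ℕ) :
    MeasFibers fun o => trBasic (X o) (x o) s₀ (ξ o) i := by
  induction i with
  | zero => exact MeasFibers.const _
  | succ i ih =>
    exact ih.flatMap (g := fun s o => trSplit (X o) (x o) s (ξ o i).1
      (trThreshold (X o) s₀ (ξ o i) i s)) fun s =>
        measFibers_trSplit hX hx (hξ i).fst (measurable_trThreshold hX (hξ i) _ _ _) s

theorem measurable_trAvg (hX : Measurable X) (P : List (Trace n)) :
    Measurable fun o => trAvg (X o) P := by
  unfold trAvg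
  refine Measurable.sqrt (Measurable.div_const ?_ _)
  induction P with
  | nil => simp
  | cons s P ih =>
    simp only [List.map_cons, List.sum_cons]
    exact (((measurable_idxDiam hX _).pow_const 2).const_mul _).add ih

theorem measurable_seed (hw : Measurable w) (k : List Bool × ℕ × ℕ) :
    Measurable fun o => w o k := (measurable_pi_apply k).comp hw

theorem measFibers_trTrialDepth (hX : Measurable X) (hx : Measurable x) (hw : Measurable w)
    (s : Trace n) (t : ℕ) : MeasFibers fun o => trTrialDepth (X o) (x o) (w o) s t := by
  refine MeasFibers.of_le fun a => ?_
  have : {o | a ≤ trTrialDepth (X o) (x o) (w o) s t} = ⋂ i : ℕ, ⋂ (_ : ¬ a ≤ i),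
      {o | trAvg (X o) (trBasic (X o) (x o) s (fun j => w o (s.1, t, j)) i) ≤
        idxDiam (X o) s.2.1 / 2}ᶜ := by
    ext o
    simp only [trTrialDepth, le_iInf_iff, Set.mem_ofPred_eq, Set.mem_iInter, Set.mem_compl_iff]
    exact forall_congr' fun i => not_imp_not.symm
  rw [this]
  refine MeasurableSet.iInter fun i => MeasurableSet.iInter fun _ => MeasurableSet.compl ?_
  exact (measFibers_trBasic hX hx (ξ := fun o j => w o (s.1, t, j))
    (fun j => measurable_seed hw _) s i).bind_measurableSet
    (P := fun P o => trAvg (X o) P ≤ idxDiam (X o) s.2.1 / 2)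
    fun P => measurableSet_le (measurable_trAvg hX P) ((measurable_idxDiam hX _).div_const 2)

theorem measFibers_trCoreDepth (hX : Measurable X) (hx : Measurable x) (hw : Measurable w)
    (s : Trace n) : MeasFibers fun o => trCoreDepth (X o) (x o) δ (w o) s := by
  refine MeasFibers.of_le fun a => ?_
  have : {o | a ≤ trCoreDepth (X o) (x o) δ (w o) s} = ⋂ t : ℕ, ⋂ (_ : t < numTrials n δ),
      {o | a ≤ trTrialDepth (X o) (x o) (w o) s t} := by
    ext o
    simp [trCoreDepth]
  rw [this]
  exact MeasurableSet.iInter fun t => MeasurableSet.iInter fun _ =>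
    (measFibers_trTrialDepth hX hx hw s t).preimage (Set.Ici a)

theorem measFibers_trLeaves (hX : Measurable X) (hx : Measurable x) (hw : Measurable w)
    (s : Trace n) : MeasFibers fun o => trLeaves (X o) (x o) δ (w o) s := by
  have hbest : MeasFibers fun o => trBest (X o) (x o) δ (w o) s := by
    refine MeasFibers.natSInf (P := fun t o => t < numTrials n δ ∧
      trTrialDepth (X o) (x o) (w o) s t = trCoreDepth (X o) (x o) δ (w o) s) fun t => ?_
    refine (MeasurableSet.const _).inter ?_
    exact ((measFibers_trTrialDepth hX hx hw s t).map₂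
      (measFibers_trCoreDepth (δ := δ) hX hx hw s) Prod.mk).preimage {q | q.1 = q.2}
  exact (hbest.map₂ (measFibers_trCoreDepth (δ := δ) hX hx hw s) Prod.mk).bind
    (g := fun q o => trBasic (X o) (x o) s (fun j => w o (s.1, q.1, j)) q.2.toNat)
    fun q => measFibers_trBasic hX hx (ξ := fun o j => w o (s.1, q.1, j))
      (fun j => measurable_seed hw _) s _

theorem measFibers_trAdaptive (hS : MeasurableSet S) (hX : Measurable X) (hx : Measurable x)
    (hw : Measurable w) (i : ℕ) : MeasFibers fun o => trAdaptive S (X o) (x o) δ (w o) i := by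
  classical
  induction i with
  | zero =>
    have h1 : MeasFibers fun o => idxSet (X o) S :=
      MeasFibers.filter _ (P := fun i o => X o i ∈ S) fun i => measurable_sample hX i hS
    have h2 : MeasFibers fun o => decide (x o ∈ S) :=
      MeasFibers.decide (P := fun o => x o ∈ S) (hx hS)
    exact h1.map₂ h2 fun J b => [([], J, b)]
  | succ i ih => exact ih.flatMap (measFibers_trLeaves hX hx hw)

/-- The sample points sharing a cell with the point `x`, as a function of the traces. -/
def trNeighbors (P : List (Trace n)) : Finset (Fin n) :=
  (P.filter fun s => s.2.2).foldr (fun s J => s.2.1 ∪ J) ∅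

theorem idxSet_cellOf (X : Fin n → E D) (x : E D) (P : List (Cell D)) :
    idxSet X (cellOf P x) = trNeighbors (P.map (trace X x)) := by
  classical
  induction P with
  | nil => ext i; simp [trNeighbors, cellOf]
  | cons c P ih =>
    have h : cellOf (c :: P) x = {x' | x ∈ c.carrier ∧ x' ∈ c.carrier} ∪ cellOf P x := by
      ext x'; simp [cellOf]
    ext i
    rw [Finset.ext_iff] at ih
    have ih := ih i
    simp only [mem_idxSet] at ih
    rw [h, mem_idxSet, Set.mem_union, ih]
    by_cases hx : x ∈ c.carrier
    · simp [trNeighbors, trace, hx]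
    · simp [trNeighbors, trace, hx]

/-- The regressor in terms of the set `J` of neighbours of the point. -/
theorem regressor_eq {D' : ℕ} (X : Fin n → E D) (Y : Fin n → E D') (y₀ : E D') (P : List (Cell D))
    (x : E D) : regressor X Y y₀ P x = if (idxSet X (cellOf P x)).Nonempty then
      ((idxSet X (cellOf P x)).card : ℝ)⁻¹ • ∑ i ∈ idxSet X (cellOf P x), Y i else y₀ := by
  classical
  have h1 : 0 < empMass X (cellOf P x) ↔ (idxSet X (cellOf P x)).Nonempty := by
    rw [empMass_eq]
    constructor
    · intro h
      by_contra h0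
      rw [Finset.not_nonempty_iff_eq_empty] at h0
      simp [h0] at h
    · rintro ⟨i, hi⟩
      have hn : 0 < n := i.pos
      have := Finset.card_pos.2 ⟨i, hi⟩
      positivity
  rw [regressor]
  by_cases h : (idxSet X (cellOf P x)).Nonempty
  · have hn : (n : ℝ) ≠ 0 := by
      obtain ⟨i, _⟩ := h
      exact_mod_cast i.pos.ne'
    rw [if_pos (h1.2 h), if_pos h, empMass_eq, mul_div_cancel₀ _ hn]
    congr 1
    rw [idxSet, Finset.sum_filter]
    simp [Set.indicator_apply]
  · rw [if_neg (fun h' => h (h1.1 h')), if_neg h]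

theorem measurable_candidate {D' : ℕ} (hS : MeasurableSet S) (y₀ : E D')
    {z : Ω → Fin n → E D × E D'} (hz : Measurable z) (hx : Measurable x) (hw : Measurable w)
    (j : ℕ) : Measurable fun o => candidate S y₀ δ (z o) (w o) j (x o) := by
  have hzi : ∀ i, Measurable fun o => z o i := fun i => (measurable_pi_apply i).comp hz
  have hX : Measurable fun o i => (z o i).1 := measurable_pi_lambda _ fun i => (hzi i).fst
  simp only [candidate, regressor_eq, idxSet_cellOf, map_trace_adaptivePart]
  have hJ : MeasFibers fun o => trNeighbors (trAdaptive S (fun i => (z o i).1) (x o) δ (w o) j) :=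
    (measFibers_trAdaptive hS hX hx hw j).comp _
  refine hJ.bind_measurable (g := fun J o => if J.Nonempty then
    (J.card : ℝ)⁻¹ • ∑ i ∈ J, (z o i).2 else y₀) fun J => ?_
  split_ifs
  · exact (Finset.measurable_fun_sum J fun i _ => (hzi i).snd).const_smul (J.card : ℝ)⁻¹
  · exact measurable_const

/-- The candidates take values in any convex set containing the responses. -/
theorem candidate_mem {D' : ℕ} {y₀ : E D'} {z : Fin n → E D × E D'} {ω : Seeds D} {K : Set (E D')}
    (hK : Convex ℝ K) (hy : y₀ ∈ K) (hz : ∀ i, (z i).2 ∈ K) (j : ℕ) (x : E D) :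
    candidate S y₀ δ z ω j x ∈ K := by
  rw [candidate, regressor_eq]
  split_ifs with h
  · rw [Finset.smul_sum]
    refine hK.sum_mem (fun i _ => by positivity) ?_ fun i _ => hz i
    have : ((idxSet (fun i => (z i).1) (cellOf (adaptivePart S (fun i => (z i).1) δ ω j) x)).card : ℝ)
        ≠ 0 := by exact_mod_cast (Finset.card_pos.2 h).ne'
    simp [this]
  · exact hy

end Measurability

/-! ### Gaussian projections -/

/-- Law `N(0, I_D / D)` of the random direction. -/
def dirLaw (D : ℕ) : Measure (E D) :=
  multivariateGaussian (0 : E D) ((D : ℝ)⁻¹ • (1 : Matrix (Fin D) (Fin D) ℝ))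

instance (D : ℕ) : IsProbabilityMeasure (dirLaw D) := by unfold dirLaw; infer_instance

theorem dirLaw_map_inner {D : ℕ} (y : E D) :
    (dirLaw D).map (fun v => (inner ℝ y v : ℝ)) =
      gaussianReal 0 (‖y‖ ^ 2 / D).toNNReal := by
  have hS : ((D : ℝ)⁻¹ • (1 : Matrix (Fin D) (Fin D) ℝ)).PosSemidef :=
    Matrix.PosSemidef.one.smul (by positivity)
  have : IsProbabilityMeasure ((dirLaw D).map (fun v => (inner ℝ y v : ℝ))) :=
    Measure.isProbabilityMeasure_map (by fun_prop)
  refine Measure.ext_of_charFun ?_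
  funext t
  have h1 : charFun ((dirLaw D).map (fun v => (inner ℝ y v : ℝ))) t =
      charFun (dirLaw D) (t • y) := by
    rw [charFun_apply, charFun_apply, integral_map (by fun_prop) (by fun_prop)]
    congr 1
    funext v
    simp [inner_smul_right, real_inner_comm, mul_comm]
  rw [h1, dirLaw, charFun_multivariateGaussian hS, charFun_gaussianReal]
  congr 1
  have h2 : (‖y‖ ^ 2 : ℝ) = y.ofLp ⬝ᵥ y.ofLp := by
    rw [EuclideanSpace.norm_sq_eq]; simp [dotProduct, pow_two]
  simp only [inner_zero_right]
  rw [Real.coe_toNNReal _ (by positivity)]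
  simp [Matrix.smul_mulVec, h2]
  ring

theorem dirLaw_hasSubgaussianMGF {D : ℕ} (y : E D) :
    HasSubgaussianMGF (fun v => (inner ℝ y v : ℝ)) (‖y‖ ^ 2 / D).toNNReal (dirLaw D) where
  integrable_exp_mul t := by
    have h := integrable_exp_mul_gaussianReal (μ := 0) (v := (‖y‖ ^ 2 / D).toNNReal) t
    rw [← dirLaw_map_inner, integrable_map_measure (by fun_prop) (by fun_prop)] at h
    exact h
  mgf_le t := by
    rw [mgf_gaussianReal (dirLaw_map_inner y)]
    simp

/-- Gaussian tail of the projection on a vector of length at most `ρ`. -/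
theorem dirLaw_abs_inner_ge {D : ℕ} (hD : 0 < D) {y : E D} {ρ s : ℝ} (hρ : 0 < ρ) (hy : ‖y‖ ≤ ρ)
    (hs : 0 < s) : dirLaw D {v | s * ρ / √(D : ℝ) ≤ |(inner ℝ y v : ℝ)|} ≤
      ENNReal.ofReal (2 * Real.exp (-s ^ 2 / 2)) := by
  have hD' : (0 : ℝ) < D := by exact_mod_cast hD
  have key : ∀ y : E D, ‖y‖ ≤ ρ → dirLaw D {v | s * ρ / √(D : ℝ) ≤ (inner ℝ y v : ℝ)} ≤
      ENNReal.ofReal (Real.exp (-s ^ 2 / 2)) := by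
    intro y hy
    rcases eq_or_ne y 0 with rfl | h0
    · have h9 : {v : E D | s * ρ / √(D : ℝ) ≤ (inner ℝ (0 : E D) v : ℝ)} = ∅ := by
        ext v
        simp only [inner_zero_left, Set.mem_ofPred_eq, Set.mem_empty_iff_false, iff_false, not_le]
        positivity
      rw [h9]; simp
    · rw [← ofReal_measureReal]
      refine ENNReal.ofReal_le_ofReal ?_
      refine ((dirLaw_hasSubgaussianMGF y).measure_ge_le (by positivity)).trans ?_
      rw [Real.coe_toNNReal _ (by positivity)]
      have hy0 : 0 < ‖y‖ := norm_pos_iff.2 h0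
      refine Real.exp_le_exp.2 ?_
      rw [div_pow, Real.sq_sqrt hD'.le, mul_pow, neg_div, neg_div, neg_le_neg_iff]
      rw [div_le_div_iff₀ (by norm_num) (by positivity)]
      have : ‖y‖ ^ 2 ≤ ρ ^ 2 := pow_le_pow_left₀ hy0.le hy 2
      field_simp
      nlinarith [sq_nonneg s]
  have hsub : {v | s * ρ / √(D : ℝ) ≤ |(inner ℝ y v : ℝ)|} ⊆
      {v | s * ρ / √(D : ℝ) ≤ (inner ℝ y v : ℝ)} ∪ {v | s * ρ / √(D : ℝ) ≤ (inner ℝ (-y) v : ℝ)} := by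
    intro v hv
    simp only [Set.mem_ofPred_eq, Set.mem_union, inner_neg_left] at hv ⊢
    exact le_abs.1 hv
  refine (measure_mono hsub).trans ((measure_union_le _ _).trans ?_)
  rw [two_mul, ENNReal.ofReal_add (by positivity) (by positivity)]
  exact add_le_add (key y hy) (key (-y) (by rwa [norm_neg]))

/-- Anti-concentration of the projection on a vector of length at least `ρ`. -/
theorem dirLaw_abs_inner_lt {D : ℕ} (hD : 0 < D) {y : E D} {ρ s : ℝ} (hρ : 0 < ρ) (hy : ρ ≤ ‖y‖) :
    dirLaw D {v | |(inner ℝ y v : ℝ)| < s * ρ / √(D : ℝ)} ≤ ENNReal.ofReal s := by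
  have hD' : (0 : ℝ) < D := by exact_mod_cast hD
  set V : NNReal := (‖y‖ ^ 2 / D).toNNReal with hV
  have hVr : (V : ℝ) = ‖y‖ ^ 2 / D := Real.coe_toNNReal _ (by positivity)
  have hy0 : 0 < ‖y‖ := hρ.trans_le hy
  have hV0 : V ≠ 0 := by
    intro h
    have : (V : ℝ) = 0 := by rw [h]; simp
    rw [hVr] at this
    have : 0 < ‖y‖ ^ 2 / D := by positivity
    linarith
  have h1 : dirLaw D {v | |(inner ℝ y v : ℝ)| < s * ρ / √(D : ℝ)} =
      gaussianReal 0 V (Set.Ioo (-(s * ρ / √(D : ℝ))) (s * ρ / √(D : ℝ))) := by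
    rw [← dirLaw_map_inner, Measure.map_apply (by fun_prop) measurableSet_Ioo]
    congr 1
    ext v
    simp [abs_lt]
  rw [h1, gaussianReal_apply 0 hV0]
  have hpdf : ∀ x, gaussianPDF 0 V x ≤ ENNReal.ofReal (√(D : ℝ) / (2 * ρ)) := by
    intro x
    refine ENNReal.ofReal_le_ofReal ?_
    rw [gaussianPDFReal]
    have h2 : Real.exp (-(x - 0) ^ 2 / (2 * V)) ≤ 1 := by
      rw [Real.exp_le_one_iff]
      exact div_nonpos_of_nonpos_of_nonneg (by nlinarith [sq_nonneg (x - 0)]) (by positivity)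
    have h3 : 2 * ρ / √(D : ℝ) ≤ √(2 * Real.pi * V) := by
      refine Real.le_sqrt_of_sq_le ?_
      rw [div_pow, Real.sq_sqrt hD'.le, hVr, mul_pow, ← mul_div_assoc]
      refine div_le_div_of_nonneg_right ?_ hD'.le
      have := Real.pi_gt_three
      have h5 : ρ ^ 2 ≤ ‖y‖ ^ 2 := pow_le_pow_left₀ hρ.le hy 2
      nlinarith [sq_nonneg ρ]
    have h4 : (√(2 * Real.pi * V))⁻¹ ≤ √(D : ℝ) / (2 * ρ) := by
      have hpos : 0 < 2 * ρ / √(D : ℝ) := by positivity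
      rw [← inv_div (2 * ρ) (√(D : ℝ))]
      exact inv_anti₀ hpos h3
    calc _ ≤ (√(2 * Real.pi * V))⁻¹ * 1 := mul_le_mul_of_nonneg_left h2 (by positivity)
      _ ≤ _ := by rwa [mul_one]
  calc ∫⁻ x in Set.Ioo (-(s * ρ / √(D : ℝ))) (s * ρ / √(D : ℝ)), gaussianPDF 0 V x
      ≤ ∫⁻ x in Set.Ioo (-(s * ρ / √(D : ℝ))) (s * ρ / √(D : ℝ)),
          ENNReal.ofReal (√(D : ℝ) / (2 * ρ)) := lintegral_mono fun x => hpdf x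
    _ = ENNReal.ofReal (√(D : ℝ) / (2 * ρ)) *
          ENNReal.ofReal (s * ρ / √(D : ℝ) - -(s * ρ / √(D : ℝ))) := by
        rw [lintegral_const]; simp
    _ = ENNReal.ofReal s := by
        rw [← ENNReal.ofReal_mul (by positivity)]
        congr 1
        have : √(D : ℝ) ≠ 0 := by positivity
        field_simp
        ring

/-! ### Covers and chaining -/

/-- The part of `S` in any ball is covered by at most `2 ^ d` balls of half the radius. -/
def Doubling {D : ℕ} (S : Set (E D)) (d : ℝ) : Prop :=
  ∀ (z : E D) (r : ℝ), 0 < r → ∃ T : Finset (E D), (T.card : ℝ) ≤ (2 : ℝ) ^ d ∧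
    Metric.closedBall z r ∩ S ⊆ ⋃ y ∈ T, Metric.closedBall y (r / 2)

theorem Doubling.exists_cover {D : ℕ} {S : Set (E D)} {d : ℝ} (h : Doubling S d) (z : E D) {r : ℝ}
    (hr : 0 < r) (j : ℕ) : ∃ T : Finset (E D), (T.card : ℝ) ≤ ((2 : ℝ) ^ d) ^ j ∧
      Metric.closedBall z r ∩ S ⊆ ⋃ y ∈ T, Metric.closedBall y (r / 2 ^ j) := by
  classical
  induction j with
  | zero => exact ⟨{z}, by simp, by simp⟩
  | succ j ih =>
    obtain ⟨T, hT, hcov⟩ := ih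
    choose U hU hUc using fun y : E D => h y (r / 2 ^ j) (by positivity)
    refine ⟨T.biUnion U, ?_, ?_⟩
    · calc ((T.biUnion U).card : ℝ) ≤ ∑ y ∈ T, ((U y).card : ℝ) := by
            exact_mod_cast Finset.card_biUnion_le
        _ ≤ ∑ _y ∈ T, (2 : ℝ) ^ d := Finset.sum_le_sum fun y _ => hU y
        _ = T.card * (2 : ℝ) ^ d := by simp
        _ ≤ ((2 : ℝ) ^ d) ^ j * (2 : ℝ) ^ d := by gcongr
        _ = _ := (pow_succ _ _).symm
    · intro x hx
      obtain ⟨y, hy, hxy⟩ := Set.mem_iUnion₂.1 (hcov hx)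
      obtain ⟨u, hu, hxu⟩ := Set.mem_iUnion₂.1 (hUc y ⟨hxy, hx.2⟩)
      refine Set.mem_iUnion₂.2 ⟨u, Finset.mem_biUnion.2 ⟨y, hy, hu⟩, ?_⟩
      rwa [pow_succ, ← div_div]

theorem two_rpow_mul_exp_le {d : ℝ} (hd : 1 ≤ d) (j : ℕ) :
    ((2 : ℝ) ^ d) ^ j * ((2 : ℝ) ^ d) ^ (j + 1) * (2 * Real.exp (-(4 * √d * (3 / 2) ^ j) ^ 2 / 2)) ≤
      1 / 8 * (1 / 2) ^ (j + 1) := by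
  have h2 : (2 : ℝ) ^ d ≤ Real.exp d := by
    rw [Real.rpow_def_of_pos (by norm_num)]
    refine Real.exp_le_exp.2 ?_
    have := Real.log_two_lt_d9
    nlinarith
  have h3 : (4 * √d * (3 / 2) ^ j) ^ 2 / 2 ≥ 8 * d * (j + 1) := by
    have h4 : (j : ℝ) + 1 ≤ ((3 / 2 : ℝ) ^ j) ^ 2 := by
      have := one_add_mul_le_pow (a := (5 / 4 : ℝ)) (by norm_num) j
      rw [← pow_mul, mul_comm j 2, pow_mul]
      norm_num at this ⊢
      have hj : (0 : ℝ) ≤ j := by positivity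
      linarith
    rw [mul_pow, mul_pow, Real.sq_sqrt (by linarith)]
    nlinarith
  have h5 : ((2 : ℝ) ^ d) ^ j * ((2 : ℝ) ^ d) ^ (j + 1) ≤ Real.exp (2 * d * (j + 1)) := by
    calc _ = ((2 : ℝ) ^ d) ^ (2 * j + 1) := by rw [← pow_add]; congr 1; ring
      _ ≤ (Real.exp d) ^ (2 * j + 1) := pow_le_pow_left₀ (by positivity) h2 _
      _ = Real.exp ((2 * j + 1) * d) := by rw [← Real.exp_nat_mul]; push_cast; ring_nf
      _ ≤ _ := by refine Real.exp_le_exp.2 ?_; nlinarith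
  have h6 : Real.exp (-(4 * √d * (3 / 2) ^ j) ^ 2 / 2) ≤ Real.exp (-(8 * d * (j + 1))) := by
    refine Real.exp_le_exp.2 ?_
    rw [neg_div]; linarith
  have h7 : Real.exp (2 * d * (j + 1)) * Real.exp (-(8 * d * (j + 1))) ≤
      (Real.exp (-6)) ^ (j + 1) := by
    rw [← Real.exp_add, ← Real.exp_nat_mul]
    refine Real.exp_le_exp.2 ?_
    push_cast
    have hj : (0 : ℝ) ≤ j := by positivity
    nlinarith
  have h8 : Real.exp (-6) ≤ 1 / 32 := by
    rw [Real.exp_neg, ← one_div]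
    refine one_div_le_one_div_of_le (by norm_num) ?_
    have h9 : Real.exp 6 = Real.exp 1 ^ 6 := by rw [← Real.exp_nat_mul]; norm_num
    rw [h9]
    calc (32 : ℝ) ≤ 2 ^ 6 := by norm_num
      _ ≤ _ := pow_le_pow_left₀ (by norm_num) (by linarith [Real.exp_one_gt_d9]) 6
  calc _ ≤ Real.exp (2 * d * (j + 1)) * (2 * Real.exp (-(8 * d * (j + 1)))) := by gcongr
    _ = 2 * (Real.exp (2 * d * (j + 1)) * Real.exp (-(8 * d * (j + 1)))) := by ring
    _ ≤ 2 * (Real.exp (-6)) ^ (j + 1) := by gcongr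
    _ ≤ 2 * (1 / 32) ^ (j + 1) := by gcongr
    _ = 2 * ((1 / 16) ^ (j + 1) * (1 / 2) ^ (j + 1)) := by rw [← mul_pow]; norm_num
    _ ≤ 2 * ((1 / 16) ^ 1 * (1 / 2) ^ (j + 1)) := by
        gcongr 2 * (?_ * _)
        exact pow_le_pow_of_le_one (by norm_num) (by norm_num) (by omega)
    _ = _ := by ring

/-- Chaining: the projection of the part of a doubling set in a ball of radius `ρ` has radius of
order `√d ρ / √D` except with small probability. -/
theorem dirLaw_chaining {D : ℕ} (hD : 0 < D) {S : Set (E D)} {d : ℝ} (hd : 1 ≤ d)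
    (hS : Doubling S d) (x : E D) {ρ : ℝ} (hρ : 0 < ρ) :
    dirLaw D {v | ∃ z ∈ Metric.closedBall x ρ ∩ S,
      32 * √d * ρ / √(D : ℝ) < |(inner ℝ (z - x) v : ℝ)|} ≤ ENNReal.ofReal (1 / 8) := by
  classical
  have hD' : (0 : ℝ) < D := by exact_mod_cast hD
  -- nets of radius `ρ / 2 ^ j`, starting from the centre of the ball
  choose T' hT' hTc' using fun j => hS.exists_cover x hρ j
  obtain ⟨T, hT0, hT, hTc⟩ : ∃ T : ℕ → Finset (E D), T 0 = {x} ∧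
      (∀ j, ((T j).card : ℝ) ≤ ((2 : ℝ) ^ d) ^ j) ∧
      ∀ j, Metric.closedBall x ρ ∩ S ⊆ ⋃ y ∈ T j, Metric.closedBall y (ρ / 2 ^ j) := by
    refine ⟨fun j => if j = 0 then {x} else T' j, by simp, fun j => ?_, fun j => ?_⟩
    · by_cases hj : j = 0
      · simp [hj]
      · simpa [hj] using hT' j
    · by_cases hj : j = 0
      · simp [hj]
      · simpa [hj] using hTc' j
  set bad : ℕ → E D → E D → Set (E D) := fun j y y' =>
    if ‖y' - y‖ ≤ 2 * (ρ / 2 ^ j) then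
      {v | 4 * √d * (3 / 2) ^ j * (2 * (ρ / 2 ^ j)) / √(D : ℝ) ≤ |(inner ℝ (y' - y) v : ℝ)|}
    else ∅ with hbad
  have hbadle : ∀ j y y', dirLaw D (bad j y y') ≤
      ENNReal.ofReal (2 * Real.exp (-(4 * √d * (3 / 2) ^ j) ^ 2 / 2)) := by
    intro j y y'
    simp only [hbad]
    split_ifs with h
    · exact dirLaw_abs_inner_ge hD (by positivity) h (by positivity)
    · simp
  have hsub : {v | ∃ z ∈ Metric.closedBall x ρ ∩ S,
      32 * √d * ρ / √(D : ℝ) < |(inner ℝ (z - x) v : ℝ)|} ⊆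
      ⋃ j, ⋃ y ∈ T j, ⋃ y' ∈ T (j + 1), bad j y y' := by
    rintro v ⟨z, hz, hlt⟩
    by_contra hv
    simp only [Set.mem_iUnion, not_exists] at hv
    have hex : ∀ j, ∃ y ∈ T j, dist z y ≤ ρ / 2 ^ j := fun j => by
      obtain ⟨y, hy, h⟩ := Set.mem_iUnion₂.1 (hTc j hz)
      exact ⟨y, hy, h⟩
    choose y hyT hyd using hex
    have hy0 : y 0 = x := by have := hyT 0; rw [hT0] at this; simpa using this
    have hstep : ∀ j, |(inner ℝ (y (j + 1) - y j) v : ℝ)| ≤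
        8 * √d * ρ / √(D : ℝ) * (3 / 4) ^ j := by
      intro j
      have hnorm : ‖y (j + 1) - y j‖ ≤ 2 * (ρ / 2 ^ j) := by
        rw [← dist_eq_norm]
        have h1 := dist_triangle_left (y (j + 1)) (y j) z
        have h2 := hyd (j + 1)
        have h3 := hyd j
        have h4 : ρ / 2 ^ (j + 1) ≤ ρ / 2 ^ j :=
          div_le_div_of_nonneg_left hρ.le (by positivity)
            (pow_le_pow_right₀ (by norm_num) (Nat.le_succ j))
        linarith
      have h1 := hv j (y j) (hyT j) (y (j + 1)) (hyT (j + 1))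
      simp only [hbad, if_pos hnorm, Set.mem_ofPred_eq, not_le] at h1
      refine h1.le.trans (le_of_eq ?_)
      have : (3 / 4 : ℝ) ^ j = (3 / 2) ^ j / 2 ^ j := by rw [← div_pow]; norm_num
      rw [this]
      ring
    have hsum : ∀ m, |(inner ℝ (y m - x) v : ℝ)| ≤
        8 * √d * ρ / √(D : ℝ) * ∑ j ∈ Finset.range m, (3 / 4 : ℝ) ^ j := by
      intro m
      induction m with
      | zero => simp [hy0]
      | succ m ih =>
        have h1 : y (m + 1) - x = (y m - x) + (y (m + 1) - y m) := by abel
        rw [h1, inner_add_left, Finset.sum_range_succ, mul_add]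
        exact (abs_add_le _ _).trans (add_le_add ih (hstep m))
    have hgeo : ∀ m : ℕ, ∑ j ∈ Finset.range m, (3 / 4 : ℝ) ^ j ≤ 4 := by
      intro m
      have := geom_sum_eq (x := (3 / 4 : ℝ)) (by norm_num) m
      rw [this]
      have h0 : (0 : ℝ) ≤ (3 / 4) ^ m := by positivity
      rw [div_le_iff_of_neg (by norm_num)]
      linarith
    have hfin : ∀ m, |(inner ℝ (z - x) v : ℝ)| ≤
        32 * √d * ρ / √(D : ℝ) + ρ * ‖v‖ * (1 / 2) ^ m := by
      intro m
      have h1 : z - x = (y m - x) + (z - y m) := by abel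
      rw [h1, inner_add_left]
      refine (abs_add_le _ _).trans (add_le_add ?_ ?_)
      · refine (hsum m).trans ?_
        calc _ ≤ 8 * √d * ρ / √(D : ℝ) * 4 := by gcongr; exact hgeo m
          _ = _ := by ring
      · refine (abs_real_inner_le_norm _ _).trans ?_
        have h2 := hyd m
        rw [dist_eq_norm] at h2
        calc ‖z - y m‖ * ‖v‖ ≤ ρ / 2 ^ m * ‖v‖ := by gcongr
          _ = _ := by rw [one_div, inv_pow]; ring
    have hlim : Filter.Tendsto (fun m : ℕ => 32 * √d * ρ / √(D : ℝ) + ρ * ‖v‖ * (1 / 2) ^ m)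
        Filter.atTop (nhds (32 * √d * ρ / √(D : ℝ) + ρ * ‖v‖ * 0)) :=
      tendsto_const_nhds.add ((tendsto_pow_atTop_nhds_zero_of_lt_one (by norm_num)
        (by norm_num)).const_mul _)
    have := ge_of_tendsto' hlim hfin
    linarith
  refine (measure_mono hsub).trans ((measure_iUnion_le _).trans ?_)
  have hj : ∀ j, dirLaw D (⋃ y ∈ T j, ⋃ y' ∈ T (j + 1), bad j y y') ≤
      ENNReal.ofReal (1 / 8 * (1 / 2) ^ (j + 1)) := by
    intro j
    obtain ⟨ε, hε⟩ : ∃ ε, ε = 2 * Real.exp (-(4 * √d * (3 / 2) ^ j) ^ 2 / 2) := ⟨_, rfl⟩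
    have hε0 : 0 ≤ ε := by rw [hε]; positivity
    calc _ ≤ ∑ y ∈ T j, ∑ y' ∈ T (j + 1), dirLaw D (bad j y y') :=
          (measure_biUnion_finset_le _ _).trans
            (Finset.sum_le_sum fun y _ => measure_biUnion_finset_le _ _)
      _ ≤ ∑ y ∈ T j, ∑ y' ∈ T (j + 1), ENNReal.ofReal ε :=
          Finset.sum_le_sum fun y _ => Finset.sum_le_sum fun y' _ => hε ▸ hbadle j y y'
      _ = ENNReal.ofReal ((T j).card * (T (j + 1)).card * ε) := by
          rw [ENNReal.ofReal_mul (by positivity), ENNReal.ofReal_mul (by positivity)]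
          simp [mul_assoc]
      _ ≤ _ := by
          refine ENNReal.ofReal_le_ofReal ?_
          refine le_trans ?_ (two_rpow_mul_exp_le hd j)
          rw [← hε]
          gcongr
          · exact hT j
          · exact hT (j + 1)
  refine (ENNReal.tsum_le_tsum hj).trans ?_
  rw [← ENNReal.ofReal_tsum_of_nonneg (fun j => by positivity)]
  · refine ENNReal.ofReal_le_ofReal ?_
    rw [tsum_mul_left]
    simp_rw [pow_succ]
    rw [tsum_mul_right, tsum_geometric_two]
    norm_num
  · simp_rw [pow_succ]
    exact (summable_geometric_two.mul_right _).mul_left _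

/-! ### Separation of distant parts of the data by a noisy split -/

/-- Law of the uniform noise. -/
def noiseLaw : Measure ℝ := volume[|Set.Icc (-1 : ℝ) 1]

instance : IsProbabilityMeasure noiseLaw :=
  cond_isProbabilityMeasure_of_finite (by simp) (by simp)

theorem seedLaw_eq (D : ℕ) : seedLaw D = (dirLaw D).prod noiseLaw := rfl

theorem noiseLaw_Ico {a b : ℝ} (ha : -1 ≤ a) (hb : b ≤ 1) :
    noiseLaw (Set.Ico a b) = ENNReal.ofReal ((b - a) / 2) := by
  have hsub : Set.Ico a b ⊆ Set.Icc (-1) 1 := fun x hx => ⟨ha.trans hx.1, hx.2.le.trans hb⟩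
  rw [noiseLaw, cond_apply measurableSet_Icc, Set.inter_eq_right.2 hsub]
  simp only [Real.volume_Icc, Real.volume_Ico]
  rw [← ENNReal.ofReal_inv_of_pos (by norm_num), ← ENNReal.ofReal_mul (by norm_num)]
  congr 1
  ring

section Separation

variable {D n : ℕ} (X : Fin n → E D) (c : Cell D)

/-- Threshold of a noisy split in a run on the cell `c`, as a function of the seed. -/
def noisyThreshold (p : E D × ℝ) : ℝ :=
  projMedian X c.carrier p.1 + p.2 * (6 / √(D : ℝ)) * dataDiam X c.carrier

/-- Seeds for which the noisy split of `c` puts all the data of `c` in `B` on one side of the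
hyperplane and all the data of `c` in `B'` on the other one. -/
def sepSet (B B' : Set (E D)) : Set (E D × ℝ) :=
  {p | (∀ i, X i ∈ c.carrier → X i ∈ B → inner ℝ (X i) p.1 ≤ noisyThreshold X c p) ∧
      (∀ i, X i ∈ c.carrier → X i ∈ B' → noisyThreshold X c p < inner ℝ (X i) p.1) ∨
    (∀ i, X i ∈ c.carrier → X i ∈ B' → inner ℝ (X i) p.1 ≤ noisyThreshold X c p) ∧
      (∀ i, X i ∈ c.carrier → X i ∈ B → noisyThreshold X c p < inner ℝ (X i) p.1)}

theorem measurable_projMedian (A : Set (E D)) : Measurable fun v => projMedian X A v := by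
  simp only [projMedian_eq]
  exact measurable_idxMedian measurable_const measurable_id _

theorem measurable_noisyThreshold : Measurable (noisyThreshold X c) :=
  ((measurable_projMedian X _).comp measurable_fst).add
    ((measurable_snd.mul_const _).mul_const _)

theorem measurableSet_sepSet (B B' : Set (E D)) : MeasurableSet (sepSet X c B B') := by
  have h1 : ∀ B : Set (E D), MeasurableSet {p : E D × ℝ | ∀ i, X i ∈ c.carrier → X i ∈ B →
      inner ℝ (X i) p.1 ≤ noisyThreshold X c p} := by
    intro B
    simp only [Set.ofPred_forall]
    refine MeasurableSet.iInter fun i => MeasurableSet.iInter fun _ => MeasurableSet.iInter fun _ =>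
      measurableSet_le (measurable_const.inner measurable_fst) (measurable_noisyThreshold X c)
  have h2 : ∀ B : Set (E D), MeasurableSet {p : E D × ℝ | ∀ i, X i ∈ c.carrier → X i ∈ B →
      noisyThreshold X c p < inner ℝ (X i) p.1} := by
    intro B
    simp only [Set.ofPred_forall]
    refine MeasurableSet.iInter fun i => MeasurableSet.iInter fun _ => MeasurableSet.iInter fun _ =>
      measurableSet_lt (measurable_noisyThreshold X c) (measurable_const.inner measurable_fst)
  exact ((h1 B).inter (h2 B')).union ((h1 B').inter (h2 B))

/-- The median of the projections is close to the projection of a given data point. -/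
theorem dirLaw_projMedian (hD : 0 < D) {A : Set (E D)} {k : Fin n} (hk : X k ∈ A)
    (hΔ : 0 < dataDiam X A) :
    dirLaw D {v | 4 * dataDiam X A / √(D : ℝ) < |projMedian X A v - inner ℝ (X k) v|} ≤
      ENNReal.ofReal (1 / 8) := by
  classical
  set Δ := dataDiam X A with hΔdef
  set Q := pointsIn X A with hQ
  have hQpos : 0 < Q.card := Finset.card_pos.2 ⟨X k, by simp [hQ, hk]⟩
  set F : E D → Set (E D) := fun z => {v | 4 * Δ / √(D : ℝ) ≤ |(inner ℝ (z - X k) v : ℝ)|} with hF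
  have hFm : ∀ z, MeasurableSet (F z) := fun z =>
    measurableSet_le measurable_const (measurable_const.inner measurable_id).abs
  have hFle : ∀ z ∈ Q, dirLaw D (F z) ≤ ENNReal.ofReal (1 / 16) := by
    intro z hz
    rw [hQ, mem_pointsIn] at hz
    obtain ⟨⟨i, rfl⟩, hi⟩ := hz
    have h1 : ‖X i - X k‖ ≤ Δ := by rw [← dist_eq_norm]; exact dist_le_dataDiam hi hk
    refine (dirLaw_abs_inner_ge hD hΔ h1 (by norm_num : (0 : ℝ) < 4)).trans ?_
    refine ENNReal.ofReal_le_ofReal ?_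
    have h2 : Real.exp (-4 ^ 2 / 2) ≤ 1 / 32 := by
      rw [show (-4 ^ 2 / 2 : ℝ) = -8 by norm_num, Real.exp_neg, ← one_div]
      refine one_div_le_one_div_of_le (by norm_num) ?_
      have h9 : Real.exp 8 = Real.exp 1 ^ 8 := by rw [← Real.exp_nat_mul]; norm_num
      rw [h9]
      calc (32 : ℝ) ≤ 2 ^ 8 := by norm_num
        _ ≤ _ := pow_le_pow_left₀ (by norm_num) (by linarith [Real.exp_one_gt_d9]) 8
    linarith
  -- if the median is far off, then at least half of the projections are
  have hsub : {v | 4 * Δ / √(D : ℝ) < |projMedian X A v - inner ℝ (X k) v|} ⊆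
      {v | (Q.card : ENNReal) ≤ ∑ z ∈ Q, (F z).indicator (fun _ => (2 : ENNReal)) v} := by
    intro v hv
    simp only [Set.mem_ofPred_eq] at hv ⊢
    have hcard : (∑ z ∈ Q, (F z).indicator (fun _ => (2 : ENNReal)) v) =
        ((2 * (Q.filter fun z => v ∈ F z).card : ℕ) : ENNReal) := by
      simp only [Set.indicator_apply, ← Finset.sum_filter, Finset.sum_const, nsmul_eq_mul]
      push_cast; ring
    rw [hcard]
    refine Nat.cast_le.2 ?_
    by_contra! hlt
    have hcount : ∀ P : ℝ → Prop, ∀ _ : DecidablePred P,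
        (∀ z ∈ Q, P (inner ℝ z v) → v ∈ F z) →
        2 * (Q.val.map fun z => (inner ℝ z v : ℝ)).countP P <
          (Q.val.map fun z => (inner ℝ z v : ℝ)).card := by
      intro P _ hP
      rw [Multiset.countP_map, Multiset.card_map, Finset.card_val]
      refine lt_of_le_of_lt (Nat.mul_le_mul_left 2 ?_) hlt
      refine Finset.card_le_card (s := Q.filter fun z => P (inner ℝ z v)) ?_
      intro z hz
      rw [Finset.mem_filter] at hz ⊢
      exact ⟨hz.1, hP z hz.1 hz.2⟩
    have h1 : projMedian X A v ≤ inner ℝ (X k) v + 4 * Δ / √(D : ℝ) := by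
      refine median_le (hcount _ _ fun z _ hz => ?_)
      simp only [hF, Set.mem_ofPred_eq, inner_sub_left]
      exact le_abs.2 (Or.inl (by linarith))
    have h2 : inner ℝ (X k) v - 4 * Δ / √(D : ℝ) ≤ projMedian X A v := by
      refine le_median (hcount _ _ fun z _ hz => ?_)
      simp only [hF, Set.mem_ofPred_eq, inner_sub_left]
      exact le_abs.2 (Or.inr (by linarith))
    rcases lt_abs.1 hv with h | h <;> linarith
  refine (measure_mono hsub).trans ?_
  have hQ0 : (Q.card : ENNReal) ≠ 0 := by exact_mod_cast hQpos.ne'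
  refine (meas_ge_le_lintegral_div ?_ hQ0 (ENNReal.natCast_ne_top _)).trans ?_
  · exact (Finset.measurable_fun_sum Q fun z _ => measurable_const.indicator (hFm z)).aemeasurable
  · rw [lintegral_finsetSum _ fun z _ => measurable_const.indicator (hFm z)]
    refine ENNReal.div_le_of_le_mul ?_
    calc ∑ z ∈ Q, ∫⁻ v, (F z).indicator (fun _ => (2 : ENNReal)) v ∂dirLaw D
        = ∑ z ∈ Q, 2 * dirLaw D (F z) :=
          Finset.sum_congr rfl fun z _ => by rw [lintegral_indicator_const (hFm z)]
      _ ≤ ∑ z ∈ Q, 2 * ENNReal.ofReal (1 / 16) :=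
          Finset.sum_le_sum fun z hz => mul_le_mul_right (hFle z hz) 2
      _ = Q.card * ENNReal.ofReal (1 / 8) := by
          rw [Finset.sum_const, nsmul_eq_mul]
          congr 1
          rw [show (2 : ENNReal) = ENNReal.ofReal 2 by simp, ← ENNReal.ofReal_mul (by norm_num)]
          norm_num
      _ = ENNReal.ofReal (1 / 8) * Q.card := mul_comm _ _

variable {X c}

/-- A noisy split separates two small balls that contain distant data points with probability at
least `1 / 512`. With `q = Δ / √D`, for more than a third of the directions the balls project to
intervals of length at most `q / 16` at distance at least `q / 16` from each other, and within the
range `6 q` of the noise around the median. -/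
theorem seedLaw_sepSet_ge (hD : 0 < D) {S : Set (E D)} {d : ℝ} (hd : 1 ≤ d) (hS : Doubling S d)
    (hX : c.carrier ⊆ S) {r : ℝ} (hr : 0 < r)
    (hrΔ : 2048 * √d * r ≤ dataDiam X c.carrier) {y y' : E D} {k k' : Fin n}
    (hk : X k ∈ c.carrier) (hky : X k ∈ Metric.closedBall y r)
    (hky' : X k' ∈ Metric.closedBall y' r)
    (hkk : dataDiam X c.carrier / 2 < dist (X k) (X k')) :
    ENNReal.ofReal (1 / 512) ≤
      seedLaw D (sepSet X c (Metric.closedBall y r) (Metric.closedBall y' r)) := by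
  classical
  have hD' : (0 : ℝ) < D := by exact_mod_cast hD
  set Δ := dataDiam X c.carrier with hΔdef
  have hsd : 0 < √d := Real.sqrt_pos.2 (by linarith)
  have hΔ : 0 < Δ := lt_of_lt_of_le (by positivity) hrΔ
  set q := Δ / √(D : ℝ) with hq
  have hq0 : 0 < q := by positivity
  have hchain : 32 * √d * (2 * r) / √(D : ℝ) ≤ q / 32 := by
    rw [hq, div_div, div_le_div_iff₀ (by positivity) (by positivity)]
    nlinarith [Real.sqrt_pos.2 hD']
  -- the four exceptional sets of directions
  have bad1 := dirLaw_chaining hD hd hS (X k) (ρ := 2 * r) (by positivity)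
  have bad2 := dirLaw_chaining hD hd hS (X k') (ρ := 2 * r) (by positivity)
  have bad3 := dirLaw_projMedian X hD hk hΔ
  have bad4 := dirLaw_abs_inner_lt hD (y := X k - X k') (ρ := Δ / 2) (s := 1 / 4) (by positivity)
    (by rw [← dist_eq_norm]; exact hkk.le)
  set V : Set (E D) := {v |
    (∀ i, X i ∈ c.carrier → X i ∈ Metric.closedBall y r → |(inner ℝ (X i - X k) v : ℝ)| ≤ q / 32) ∧
    (∀ i, X i ∈ c.carrier → X i ∈ Metric.closedBall y' r →
      |(inner ℝ (X i - X k') v : ℝ)| ≤ q / 32) ∧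
    |projMedian X c.carrier v - inner ℝ (X k) v| ≤ 4 * q ∧
    q / 8 ≤ |(inner ℝ (X k - X k') v : ℝ)|} with hV
  have hVm : MeasurableSet V := by
    have h1 : ∀ (B : Set (E D)) (k : Fin n), MeasurableSet {v : E D | ∀ i, X i ∈ c.carrier →
        X i ∈ B → |(inner ℝ (X i - X k) v : ℝ)| ≤ q / 32} := by
      intro B k
      simp only [Set.ofPred_forall]
      exact MeasurableSet.iInter fun i => MeasurableSet.iInter fun _ => MeasurableSet.iInter
        fun _ => measurableSet_le (measurable_const.inner measurable_id).abs measurable_const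
    refine (h1 _ k).inter ((h1 _ k').inter (MeasurableSet.inter ?_ ?_))
    · have h2 : Measurable fun v : E D => projMedian X c.carrier v - inner ℝ (X k) v :=
        (measurable_projMedian X _).sub (measurable_const.inner measurable_id)
      exact measurableSet_le h2.abs measurable_const
    · have h2 : Measurable fun v : E D => (inner ℝ (X k - X k') v : ℝ) :=
        measurable_const.inner measurable_id
      exact measurableSet_le measurable_const h2.abs
  have hVc : dirLaw D Vᶜ ≤ ENNReal.ofReal (5 / 8) := by
    have hsub : Vᶜ ⊆ (({v | ∃ z ∈ Metric.closedBall (X k) (2 * r) ∩ S,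
          32 * √d * (2 * r) / √(D : ℝ) < |(inner ℝ (z - X k) v : ℝ)|} ∪
        {v | ∃ z ∈ Metric.closedBall (X k') (2 * r) ∩ S,
          32 * √d * (2 * r) / √(D : ℝ) < |(inner ℝ (z - X k') v : ℝ)|}) ∪
        {v | 4 * Δ / √(D : ℝ) < |projMedian X c.carrier v - inner ℝ (X k) v|}) ∪
        {v | |(inner ℝ (X k - X k') v : ℝ)| < 1 / 4 * (Δ / 2) / √(D : ℝ)} := by
      intro v hv
      by_contra hcon
      simp only [Set.mem_union, not_or, Set.mem_ofPred_eq, not_exists, not_and, not_lt] at hcon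
      obtain ⟨⟨⟨h1, h2⟩, h3⟩, h4⟩ := hcon
      refine hv ⟨fun i hi hb => (h1 _ ⟨?_, hX hi⟩).trans hchain,
        fun i hi hb => (h2 _ ⟨?_, hX hi⟩).trans hchain, ?_, ?_⟩
      · rw [Metric.mem_closedBall] at hb hky ⊢
        linarith [dist_triangle_right (X i) (X k) y]
      · rw [Metric.mem_closedBall] at hb hky' ⊢
        linarith [dist_triangle_right (X i) (X k') y']
      · rw [hq, ← mul_div_assoc]; exact h3
      · refine le_trans (le_of_eq ?_) h4
        rw [hq]; ring
    refine (measure_mono hsub).trans ((measure_union_le _ _).trans ?_)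
    refine (add_le_add ((measure_union_le _ _).trans (add_le_add ((measure_union_le _ _).trans
      (add_le_add bad1 bad2)) bad3)) bad4).trans ?_
    rw [← ENNReal.ofReal_add (by norm_num) (by norm_num),
      ← ENNReal.ofReal_add (by norm_num) (by norm_num),
      ← ENNReal.ofReal_add (by norm_num) (by norm_num)]
    exact ENNReal.ofReal_le_ofReal (by norm_num)
  have hVge : ENNReal.ofReal (3 / 8) ≤ dirLaw D V := by
    have h1 : (1 : ENNReal) ≤ dirLaw D V + ENNReal.ofReal (5 / 8) := by
      rw [← prob_add_prob_compl (μ := dirLaw D) hVm]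
      gcongr
    have h2 : ENNReal.ofReal (3 / 8) + ENNReal.ofReal (5 / 8) = 1 := by
      rw [← ENNReal.ofReal_add (by norm_num) (by norm_num)]; norm_num
    rw [← h2] at h1
    exact (ENNReal.add_le_add_iff_right ENNReal.ofReal_ne_top).1 h1
  -- for a good direction, an interval of noise values separates
  have hsec : ∀ v ∈ V, ENNReal.ofReal (1 / 192) ≤ noiseLaw (Prod.mk v ⁻¹'
      sepSet X c (Metric.closedBall y r) (Metric.closedBall y' r)) := by
    rintro v ⟨h1, h2, h3, h4⟩
    set m := projMedian X c.carrier v with hm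
    have hthr : ∀ u, noisyThreshold X c (v, u) = m + u * (6 * q) := by
      intro u
      simp only [noisyThreshold, ← hm, ← hΔdef, hq]
      ring
    have key : ∀ s₀ : ℝ, |s₀ - m| ≤ 5 * q → (∀ u, m + u * (6 * q) ∈ Set.Ico s₀ (s₀ + q / 16) →
        (v, u) ∈ sepSet X c (Metric.closedBall y r) (Metric.closedBall y' r)) →
        ENNReal.ofReal (1 / 192) ≤ noiseLaw (Prod.mk v ⁻¹'
          sepSet X c (Metric.closedBall y r) (Metric.closedBall y' r)) := by
      intro s₀ hs hsep
      have hs' := abs_le.1 hs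
      have hsub : Set.Ico ((s₀ - m) / (6 * q)) ((s₀ - m) / (6 * q) + 1 / 96) ⊆ Prod.mk v ⁻¹'
          sepSet X c (Metric.closedBall y r) (Metric.closedBall y' r) := by
        rintro u ⟨hu1, hu2⟩
        refine hsep u ⟨?_, ?_⟩
        · rw [div_le_iff₀ (by positivity)] at hu1; linarith
        · rw [← sub_lt_iff_lt_add, lt_div_iff₀ (by positivity)] at hu2; linarith
      refine le_trans (le_of_eq ?_) (measure_mono hsub)
      rw [noiseLaw_Ico]
      · congr 1; ring
      · rw [le_div_iff₀ (by positivity)]; linarith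
      · rw [← le_sub_iff_add_le, div_le_iff₀ (by positivity)]; linarith
    have h3' := abs_le.1 h3
    rw [inner_sub_left] at h4
    rcases le_abs.1 h4 with h5 | h5
    · -- the point `X k'` projects below `X k`
      refine key (inner ℝ (X k) v - q / 32 - q / 16) (abs_le.2 ⟨by linarith, by linarith⟩) ?_
      rintro u ⟨hu1, hu2⟩
      refine Or.inr ⟨fun i hi hb => ?_, fun i hi hb => ?_⟩
      · have := abs_le.1 (h2 i hi hb)
        rw [inner_sub_left] at this
        rw [hthr]; simp only; linarith
      · have := abs_le.1 (h1 i hi hb)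
        rw [inner_sub_left] at this
        rw [hthr]; simp only; linarith
    · refine key (inner ℝ (X k) v + q / 32) (abs_le.2 ⟨by linarith, by linarith⟩) ?_
      rintro u ⟨hu1, hu2⟩
      refine Or.inl ⟨fun i hi hb => ?_, fun i hi hb => ?_⟩
      · have := abs_le.1 (h1 i hi hb)
        rw [inner_sub_left] at this
        rw [hthr]; simp only; linarith
      · have := abs_le.1 (h2 i hi hb)
        rw [inner_sub_left] at this
        rw [hthr]; simp only; linarith
  rw [seedLaw_eq, Measure.prod_apply (measurableSet_sepSet X c _ _)]
  calc ENNReal.ofReal (1 / 512) = ENNReal.ofReal (1 / 192) * ENNReal.ofReal (3 / 8) := by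
        rw [← ENNReal.ofReal_mul (by norm_num)]; norm_num
    _ ≤ ENNReal.ofReal (1 / 192) * dirLaw D V := by gcongr
    _ = ∫⁻ v in V, ENNReal.ofReal (1 / 192) ∂dirLaw D := by rw [lintegral_const]; simp
    _ ≤ ∫⁻ v in V, noiseLaw (Prod.mk v ⁻¹'
          sepSet X c (Metric.closedBall y r) (Metric.closedBall y' r)) ∂dirLaw D :=
        setLIntegral_mono' hVm hsec
    _ ≤ _ := setLIntegral_le_lintegral _ _

end Separation

/-! ### Depth of the trees grown by the basic procedure -/

/-- The exponent `J` such that the covering balls have radius `Δ / 2 ^ J` in a cell of diameter `Δ`;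
it is chosen so that `2 ^ 11 * √d ≤ 2 ^ J`. -/
def coverScale (d : ℝ) : ℕ := ⌈11 + Real.logb 2 d / 2⌉₊

/-- Number of noisy splits after which all distant pairs of covering balls are separated with
probability at least one half: there are at most `2 ^ (2 d J)` pairs, and each split separates a
given pair with probability at least `1 / 512`. -/
def noisyRounds (d : ℝ) : ℕ := ⌈512 * (2 * d * coverScale d + 1)⌉₊

theorem sqrt_mul_le_two_pow_coverScale {d : ℝ} (hd : 1 ≤ d) :
    2048 * √d ≤ (2 : ℝ) ^ coverScale d := by
  have h1 : (2 : ℝ) ^ (11 + Real.logb 2 d / 2) ≤ (2 : ℝ) ^ coverScale d := by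
    rw [← Real.rpow_natCast]
    exact Real.rpow_le_rpow_of_exponent_le (by norm_num) (Nat.le_ceil _)
  refine le_trans (le_of_eq ?_) h1
  rw [Real.rpow_add (by norm_num), div_eq_mul_inv, Real.rpow_mul (by norm_num),
    Real.rpow_logb (by norm_num) (by norm_num) (by linarith), ← one_div, ← Real.sqrt_eq_rpow]
  norm_num

theorem noisyRounds_le {d : ℝ} (hd : 3 / 2 ≤ d) :
    2 * (noisyRounds d : ℝ) ≤ 60000 * d * Real.logb 2 d := by
  have hl : 1 / 2 ≤ Real.logb 2 d := by
    rw [Real.le_logb_iff_rpow_le (by norm_num) (by linarith), ← Real.sqrt_eq_rpow]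
    rw [Real.sqrt_le_left (by linarith)]
    nlinarith
  have hJ : (coverScale d : ℝ) ≤ 25 * Real.logb 2 d := by
    have := (Nat.ceil_lt_add_one (by linarith : 0 ≤ 11 + Real.logb 2 d / 2)).le
    rw [coverScale]
    linarith
  have hJ0 : (0 : ℝ) ≤ coverScale d := by positivity
  have h2 : 0 ≤ 512 * (2 * d * coverScale d + 1) := by nlinarith
  have h3 := (Nat.ceil_lt_add_one h2).le
  rw [noisyRounds]
  have h4 : d * coverScale d ≤ d * (25 * Real.logb 2 d) :=
    mul_le_mul_of_nonneg_left hJ (by linarith)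
  have h5 : 3 / 4 ≤ d * Real.logb 2 d := by nlinarith
  nlinarith

theorem two_rpow_mul_pow_noisyRounds_le {d : ℝ} (hd : 1 ≤ d) :
    ((2 : ℝ) ^ d) ^ coverScale d * ((2 : ℝ) ^ d) ^ coverScale d * (511 / 512) ^ noisyRounds d ≤
      1 / 2 := by
  set J := coverScale d with hJ
  set i₀ := noisyRounds d with hi
  have h0 : (0 : ℝ) ≤ J := by positivity
  have hle : 512 * (2 * d * J + 1) ≤ i₀ := Nat.le_ceil _
  have h1 : (511 / 512 : ℝ) ^ i₀ ≤ Real.exp (-(2 * d * J + 1)) := by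
    have h2 : (511 / 512 : ℝ) ≤ Real.exp (-(1 / 512)) := by
      have := Real.add_one_le_exp (-(1 / 512) : ℝ); linarith
    calc (511 / 512 : ℝ) ^ i₀ ≤ Real.exp (-(1 / 512)) ^ i₀ := pow_le_pow_left₀ (by norm_num) h2 _
      _ = Real.exp (i₀ * (-(1 / 512))) := by rw [← Real.exp_nat_mul]
      _ ≤ _ := Real.exp_le_exp.2 (by linarith)
  have h3 : ((2 : ℝ) ^ d) ^ J * ((2 : ℝ) ^ d) ^ J = Real.exp (Real.log 2 * (2 * d * J)) := by
    rw [← pow_add, ← Real.rpow_natCast, ← Real.rpow_mul (by norm_num),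
      Real.rpow_def_of_pos (by norm_num)]
    congr 1; push_cast; ring
  have h4 : Real.exp (-1) ≤ 1 / 2 := by
    rw [Real.exp_neg, ← one_div]
    exact one_div_le_one_div_of_le (by norm_num) (by linarith [Real.exp_one_gt_d9])
  calc _ ≤ Real.exp (Real.log 2 * (2 * d * J)) * Real.exp (-(2 * d * J + 1)) := by
        rw [h3]; gcongr
    _ ≤ Real.exp (-1) := by
        rw [← Real.exp_add]
        refine Real.exp_le_exp.2 ?_
        have := Real.log_two_lt_d9
        have : 0 ≤ 2 * d * J := by positivity
        nlinarith
    _ ≤ _ := h4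

theorem half_pow_numTrials_le {n : ℕ} (hn : 0 < n) {δ : ℝ} (hδ : 0 < δ) :
    (1 / 2 : ℝ) ^ numTrials n δ ≤ δ / (6 * n ^ 2) := by
  have hn' : (0 : ℝ) < n := by exact_mod_cast hn
  have h1 : 6 * (n : ℝ) ^ 2 / δ ≤ (2 : ℝ) ^ numTrials n δ := by
    rw [← Real.rpow_natCast 2 (numTrials n δ),
      ← Real.logb_le_iff_le_rpow (by norm_num) (by positivity)]
    exact Nat.le_ceil _
  rw [one_div, inv_pow, ← inv_div, inv_le_inv₀ (by positivity) (by positivity)]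
  exact h1

section Core

variable {D n : ℕ} {X : Fin n → E D} {c : Cell D} {S : Set (E D)} {d δ : ℝ}

/-- If a run is longer than `2 i₀`, then some pair of covering balls containing distant data points
has not been separated by any of the noisy splits of the run. -/
theorem exists_not_separated {ω : Seeds D} {t i₀ : ℕ} {r : ℝ} {T : Finset (E D)}
    (hT : ∀ i, X i ∈ c.carrier → ∃ y ∈ T, X i ∈ Metric.closedBall y r)
    (h : ((2 * i₀ : ℕ) : ℕ∞) < trialDepth X ω c t) :
    ∃ p ∈ T ×ˢ T, (∃ k k', X k ∈ c.carrier ∧ X k ∈ Metric.closedBall p.1 r ∧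
        X k' ∈ Metric.closedBall p.2 r ∧ dataDiam X c.carrier / 2 < dist (X k) (X k')) ∧
      ∀ j < i₀, ω (c.addr, t, 2 * j + c.level % 2) ∉
        sepSet X c (Metric.closedBall p.1 r) (Metric.closedBall p.2 r) := by
  have h1 : ¬ avgDiam X (basicPart X c (trialSeeds ω c t) (2 * i₀)) ≤ dataDiam X c.carrier / 2 :=
    fun hle => absurd (basicDepth_le hle) (not_le.2 h)
  have h2 : ∃ a ∈ basicPart X c (trialSeeds ω c t) (2 * i₀),
      dataDiam X c.carrier / 2 < dataDiam X a.carrier := by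
    by_contra! hcon
    exact h1 (avgDiam_le_of_forall (by linarith [dataDiam_nonneg (X := X) c.carrier]) hcon)
  obtain ⟨a, ha, hlt⟩ := h2
  have h3 : ∃ k k', X k ∈ a.carrier ∧ X k' ∈ a.carrier ∧
      dataDiam X c.carrier / 2 < dist (X k) (X k') := by
    by_contra! hcon
    refine absurd hlt (not_lt.2 ?_)
    refine Metric.diam_le_of_forall_dist_le (by linarith [dataDiam_nonneg (X := X) c.carrier]) ?_
    rintro _ ⟨⟨k, rfl⟩, hk⟩ _ ⟨⟨k', rfl⟩, hk'⟩
    exact hcon k k' hk hk'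
  obtain ⟨k, k', hk, hk', hkk⟩ := h3
  have hac := carrier_subset_of_mem_basicPart ha
  obtain ⟨y, hy, hky⟩ := hT k (hac hk)
  obtain ⟨y', hy', hky'⟩ := hT k' (hac hk')
  refine ⟨(y, y'), Finset.mem_product.2 ⟨hy, hy'⟩, ⟨k, k', hac hk, hky, hky', hkk⟩, ?_⟩
  intro j hj hsep
  have hlev : c.level % 2 < 2 := Nat.mod_lt _ (by norm_num)
  have hodd : Odd (c.level + (2 * j + c.level % 2 + 1)) := by
    rw [Nat.odd_iff]; omega
  have hside := same_side ha (i := 2 * j + c.level % 2) (by omega) hodd hk hk'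
  have hthr : threshold X c (trialSeeds ω c t) (2 * j + c.level % 2) c =
      noisyThreshold X c (ω (c.addr, t, 2 * j + c.level % 2)) := by
    simp only [threshold, if_pos hodd, noisyThreshold, trialSeeds]
  rw [hthr] at hside
  rcases hsep with ⟨h4, h5⟩ | ⟨h4, h5⟩
  · exact absurd (hside.1 (h4 k (hac hk) hky)) (not_le.2 (h5 k' (hac hk') hky'))
  · exact absurd (hside.2 (h4 k' (hac hk') hky')) (not_le.2 (h5 k (hac hk) hky))

instance (D : ℕ) : IsProbabilityMeasure (seedsLaw D) := by unfold seedsLaw; infer_instance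

/-- A call on a fixed cell returns a tree of depth more than `2 i₀` with probability at most
`δ / (6 n²)`: each of the independent trials fails with probability at most one half. -/
theorem seedsLaw_coreDepth_gt (hd : 1 ≤ d) (hS : Doubling S d) (hc : c.carrier ⊆ S)
    (hn : 0 < n) (hδ : 0 < δ) (hT : 0 < numTrials n δ) :
    seedsLaw D {ω | ¬ coreDepth X δ ω c ≤ ((2 * noisyRounds d : ℕ) : ℕ∞)} ≤
      ENNReal.ofReal (δ / (6 * n ^ 2)) := by
  classical
  rcases (dataDiam_nonneg (X := X) c.carrier).eq_or_lt with h0 | hΔ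
  · have : {ω | ¬ coreDepth X δ ω c ≤ ((2 * noisyRounds d : ℕ) : ℕ∞)} = ∅ := by
      ext ω
      simp [coreDepth_eq_zero hT h0.symm]
    rw [this]; simp
  have hD : 0 < D := by
    rcases Nat.eq_zero_or_pos D with rfl | h
    · exfalso
      rw [dataDiam, Metric.diam_subsingleton Set.subsingleton_of_subsingleton] at hΔ
      exact lt_irrefl _ hΔ
    · exact h
  obtain ⟨k₀, hk₀⟩ : ∃ k, X k ∈ c.carrier := by
    by_contra! hcon
    have : Set.range X ∩ c.carrier = ∅ := by
      ext z; simp only [Set.mem_inter_iff, Set.mem_range, Set.mem_empty_iff_false, iff_false]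
      rintro ⟨⟨k, rfl⟩, hk⟩; exact hcon k hk
    rw [dataDiam, this] at hΔ
    simp at hΔ
  set Δ := dataDiam X c.carrier with hΔdef
  set J := coverScale d with hJ
  set i₀ := noisyRounds d with hi₀
  set r := Δ / 2 ^ J with hr
  set N := numTrials n δ with hN
  obtain ⟨T, hTcard, hTc⟩ := hS.exists_cover (X k₀) hΔ J
  have hcov : ∀ i, X i ∈ c.carrier → ∃ y ∈ T, X i ∈ Metric.closedBall y r := by
    intro i hi
    obtain ⟨y, hy, h⟩ := Set.mem_iUnion₂.1 (hTc ⟨dist_le_dataDiam hi hk₀, hc hi⟩)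
    exact ⟨y, hy, h⟩
  set P : Finset (E D × E D) := (T ×ˢ T).filter fun p => ∃ k k', X k ∈ c.carrier ∧
    X k ∈ Metric.closedBall p.1 r ∧ X k' ∈ Metric.closedBall p.2 r ∧
    Δ / 2 < dist (X k) (X k') with hP
  set sep : E D × E D → Set (E D × ℝ) := fun p =>
    sepSet X c (Metric.closedBall p.1 r) (Metric.closedBall p.2 r) with hsep
  have hsepm : ∀ p, MeasurableSet (sep p) := fun p => measurableSet_sepSet X c _ _
  have hsepc : ∀ p : P, seedLaw D (sep p)ᶜ ≤ ENNReal.ofReal (511 / 512) := by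
    rintro ⟨p, hp⟩
    rw [hP, Finset.mem_filter] at hp
    obtain ⟨k, k', hk, hky, hky', hkk⟩ := hp.2
    have h1 := seedLaw_sepSet_ge hD hd hS hc (r := r) (by positivity) (by
      rw [hr, mul_div_assoc', div_le_iff₀ (by positivity), mul_comm, ← hΔdef]
      exact mul_le_mul_of_nonneg_left (sqrt_mul_le_two_pow_coverScale hd) hΔ.le) hk hky hky' hkk
    rw [prob_compl_eq_one_sub (hsepm p)]
    have h2 : (1 : ENNReal) = ENNReal.ofReal (511 / 512) + ENNReal.ofReal (1 / 512) := by
      rw [← ENNReal.ofReal_add (by norm_num) (by norm_num)]; norm_num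
    rw [tsub_le_iff_right, h2]
    gcongr
  -- the seeds used by the noisy splits of all the trials
  set key : Fin N × Fin i₀ → List Bool × ℕ × ℕ := fun q =>
    (c.addr, (q.1 : ℕ), 2 * (q.2 : ℕ) + c.level % 2) with hkey
  have hkeyinj : Function.Injective key := by
    rintro ⟨t, j⟩ ⟨t', j'⟩ h
    simp only [hkey, Prod.mk.injEq, true_and] at h
    refine Prod.ext (Fin.ext h.1) (Fin.ext ?_)
    have := h.2
    dsimp only at *
    omega
  set U : (Fin N → P) → (List Bool × ℕ × ℕ) → Set (E D × ℝ) := fun g k =>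
    if h : k.2.1 < N then (sep (g ⟨k.2.1, h⟩))ᶜ else Set.univ with hU
  have hUkey : ∀ g q, U g (key q) = (sep (g q.1))ᶜ := by
    intro g q
    simp [hU, hkey]
  have hsub : {ω | ¬ coreDepth X δ ω c ≤ ((2 * i₀ : ℕ) : ℕ∞)} ⊆
      ⋃ g : Fin N → P, Set.pi (Finset.univ.image key : Finset _) (U g) := by
    intro ω hω
    simp only [Set.mem_ofPred_eq, not_le] at hω
    have h1 : ∀ t : Fin N, ∃ p : P, ∀ j < i₀,
        ω (c.addr, (t : ℕ), 2 * j + c.level % 2) ∉ sep p := by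
      intro t
      obtain ⟨p, hp, hfar, hj⟩ := exists_not_separated hcov
        (hω.trans_le (coreDepth_le_trialDepth (ω := ω) (c := c) (X := X) t.2))
      exact ⟨⟨p, Finset.mem_filter.2 ⟨hp, hfar⟩⟩, hj⟩
    choose g hg using h1
    refine Set.mem_iUnion.2 ⟨g, fun k hk => ?_⟩
    simp only [Finset.coe_image, Finset.coe_univ, Set.image_univ, Set.mem_range] at hk
    obtain ⟨q, rfl⟩ := hk
    rw [hUkey]
    exact hg q.1 q.2 q.2.2
  have hmeas : ∀ g : Fin N → P, seedsLaw D (Set.pi (Finset.univ.image key : Finset _) (U g)) ≤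
      ENNReal.ofReal (((511 / 512) ^ i₀) ^ N) := by
    intro g
    rw [seedsLaw, Measure.infinitePi_pi, Finset.prod_image fun a _ b _ h => hkeyinj h]
    · calc ∏ q, seedLaw D (U g (key q)) ≤ ∏ _q : Fin N × Fin i₀, ENNReal.ofReal (511 / 512) :=
            Finset.prod_le_prod' fun q _ => by rw [hUkey]; exact hsepc _
        _ = _ := by
            rw [Finset.prod_const, Finset.card_univ, Fintype.card_prod, Fintype.card_fin,
              Fintype.card_fin, ← ENNReal.ofReal_pow (by norm_num), ← pow_mul, mul_comm N]
    · intro k hk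
      obtain ⟨q, _, rfl⟩ := Finset.mem_image.1 hk
      rw [hUkey]
      exact (hsepm _).compl
  have hPcard : (Fintype.card P : ℝ) ≤ ((2 : ℝ) ^ d) ^ J * ((2 : ℝ) ^ d) ^ J := by
    rw [Fintype.card_coe]
    calc (P.card : ℝ) ≤ ((T ×ˢ T).card : ℝ) := by exact_mod_cast Finset.card_filter_le _ _
      _ = T.card * T.card := by rw [Finset.card_product]; push_cast; ring
      _ ≤ _ := by gcongr
  calc _ ≤ ∑ g : Fin N → P, seedsLaw D (Set.pi (Finset.univ.image key : Finset _) (U g)) :=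
        (measure_mono hsub).trans (measure_iUnion_fintype_le _ _)
    _ ≤ ∑ _g : Fin N → P, ENNReal.ofReal (((511 / 512) ^ i₀) ^ N) :=
        Finset.sum_le_sum fun g _ => hmeas g
    _ = ENNReal.ofReal ((Fintype.card P * (511 / 512) ^ i₀) ^ N) := by
        rw [Finset.sum_const, Finset.card_univ, Fintype.card_fun, Fintype.card_fin, mul_pow,
          ENNReal.ofReal_mul (by positivity), nsmul_eq_mul]
        congr 1
        rw [← Nat.cast_pow, ENNReal.ofReal_natCast]
    _ ≤ _ := by
        refine ENNReal.ofReal_le_ofReal (le_trans ?_ (half_pow_numTrials_le hn hδ))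
        refine pow_le_pow_left₀ (by positivity) (le_trans ?_ (two_rpow_mul_pow_noisyRounds_le hd)) _
        gcongr

end Core

/-! ### Independence of the calls -/

/-- A measurable set that depends on the coordinates in `I` only is measurable with respect to the
`σ`-algebra that they generate. -/
theorem measurableSet_iSup_comap_eval {ι β : Type*} [MeasurableSpace β] [Nonempty β]
    {A : Set (ι → β)} (hA : MeasurableSet A) {I : Set ι}
    (hinv : ∀ ω ω' : ι → β, (∀ k ∈ I, ω k = ω' k) → ω ∈ A → ω' ∈ A) :
    MeasurableSet[⨆ k ∈ I, MeasurableSpace.comap (fun ω : ι → β => ω k) inferInstance] A := by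
  classical
  obtain ⟨e⟩ := ‹Nonempty β›
  set φ : (ι → β) → ι → β := fun ω k => if k ∈ I then ω k else e with hφ
  have hφA : φ ⁻¹' A = A := by
    ext ω
    refine ⟨fun h => hinv _ _ (fun k hk => ?_) h, fun h => hinv _ _ (fun k hk => ?_) h⟩ <;>
      simp [hφ, hk]
  rw [← hφA]
  have hm : @Measurable _ _ (⨆ k ∈ I, MeasurableSpace.comap (fun ω : ι → β => ω k) inferInstance)
      _ φ := by
    refine @measurable_pi_lambda _ _ _ (_) _ _ fun k => ?_
    by_cases hk : k ∈ I
    · simp only [hφ, if_pos hk]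
      exact Measurable.of_comap_le (le_iSup₂ (f := fun k (_ : k ∈ I) =>
        MeasurableSpace.comap (fun ω : ι → β => ω k) inferInstance) k hk)
    · simp only [hφ, if_neg hk]
      exact @measurable_const _ _ _ (_) _
  exact hm hA

theorem seedsLaw_inter_eq {D : ℕ} {A B : Set (Seeds D)} (hA : MeasurableSet A)
    (hB : MeasurableSet B) (I : Set (List Bool × ℕ × ℕ))
    (hAinv : ∀ ω ω' : Seeds D, (∀ k ∈ I, ω k = ω' k) → ω ∈ A → ω' ∈ A)
    (hBinv : ∀ ω ω' : Seeds D, (∀ k ∈ Iᶜ, ω k = ω' k) → ω ∈ B → ω' ∈ B) :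
    seedsLaw D (A ∩ B) = seedsLaw D A * seedsLaw D B := by
  have h1 : iIndepFun (fun k (ω : Seeds D) => ω k) (seedsLaw D) :=
    iIndepFun_infinitePi (P := fun _ : List Bool × ℕ × ℕ => seedLaw D)
      (X := fun _ => id) fun _ => measurable_id
  have h2 := indep_iSup_of_disjoint (fun k => (measurable_pi_apply k).comap_le) h1
    (S := I) (T := Iᶜ) disjoint_compl_right
  exact (Indep_iff _ _ _).1 h2 A B (measurableSet_iSup_comap_eval hA hAinv)
    (measurableSet_iSup_comap_eval hB hBinv)

/-! ### The rate is attained -/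

section Rate

variable {D n : ℕ} {X : Fin n → E D} {S : Set (E D)} {d δ : ℝ}

theorem exists_finset_addresses (L : ℕ) :
    ∃ A : Finset (List Bool), A.card ≤ 2 ^ L ∧ ∀ a : List Bool, a.length < L → a ∈ A := by
  classical
  refine ⟨(Finset.range L).biUnion fun m => Finset.univ.image fun g : Fin m → Bool => List.ofFn g,
    ?_, fun a ha => ?_⟩
  · refine Finset.card_biUnion_le.trans ?_
    calc _ ≤ ∑ m ∈ Finset.range L, 2 ^ m := Finset.sum_le_sum fun m _ => by
            refine Finset.card_image_le.trans ?_
            simp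
      _ ≤ 2 ^ L := by
          rw [Nat.geomSum_eq (by norm_num)]
          simp
  · refine Finset.mem_biUnion.2 ⟨a.length, Finset.mem_range.2 ha, Finset.mem_image.2
      ⟨fun i => a.get i, Finset.mem_univ _, ?_⟩⟩
    exact List.ofFn_get a

theorem two_pow_ceil_le (hn : 2 ≤ n) :
    (2 : ℝ) ^ ⌈Real.logb 2 ((n : ℝ) ^ 2)⌉₊ ≤ 2 * n ^ 2 := by
  have hn' : (2 : ℝ) ≤ n := by exact_mod_cast hn
  have h1 : 0 ≤ Real.logb 2 ((n : ℝ) ^ 2) := Real.logb_nonneg (by norm_num) (by nlinarith)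
  have h2 := (Nat.ceil_lt_add_one h1).le
  calc (2 : ℝ) ^ ⌈Real.logb 2 ((n : ℝ) ^ 2)⌉₊ ≤ (2 : ℝ) ^ (Real.logb 2 ((n : ℝ) ^ 2) + 1) := by
        rw [← Real.rpow_natCast]
        exact Real.rpow_le_rpow_of_exponent_le (by norm_num) h2
    _ = _ := by
        rw [Real.rpow_add (by norm_num), Real.rpow_logb (by norm_num) (by norm_num) (by positivity)]
        simp [mul_comm]

/-- The event that some called node of level below `log n²` returns too deep a tree. -/
def rateFail (S : Set (E D)) (δ d : ℝ) (X : Fin n → E D) (ω : Seeds D) : Prop :=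
  ∃ i, ∃ c ∈ adaptivePart S X δ ω i, (c.level : ℝ) < Real.logb 2 ((n : ℝ) ^ 2) ∧
    ¬ coreDepth X δ ω c ≤ ((2 * noisyRounds d : ℕ) : ℕ∞)

/-- Union bound over the addresses `a` and, for each of them, over the traces `s` on the data of the
cell called there. The event `R a s` that the call is made depends on the seeds of other nodes, the
event `F a s` that it fails on the seeds of `a`, and the events `R a s` are disjoint in `s`. -/
theorem seedsLaw_rateFail_le (hSm : MeasurableSet S) (hd : 1 ≤ d) (hS : Doubling S d) (hn : 2 ≤ n)
    (hδ : 0 < δ) (hT : 0 < numTrials n δ) :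
    seedsLaw D {ω | rateFail S δ d X ω} ≤ ENNReal.ofReal (δ / 3) := by
  classical
  obtain ⟨A, hA, hAmem⟩ := exists_finset_addresses ⌈Real.logb 2 ((n : ℝ) ^ 2)⌉₊
  have hn' : (0 : ℝ) < n := by positivity
  set K : ℕ∞ := ((2 * noisyRounds d : ℕ) : ℕ∞) with hK
  -- node `a` is called, with trace `s` on the data
  set R : List Bool → Finset (Fin n) × Bool → Set (Seeds D) := fun a s =>
    {ω | ∃ i, ∃ c ∈ adaptivePart S X δ ω i, trace X 0 c = (a, s)} with hR
  set F : List Bool → Finset (Fin n) × Bool → Set (Seeds D) := fun a s =>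
    {ω | ¬ trCoreDepth X 0 δ ω (a, s) ≤ K} with hF
  have hRm : ∀ a s, MeasurableSet (R a s) := by
    intro a s
    have : R a s = ⋃ i, {ω | (a, s) ∈ trAdaptive S X 0 δ ω i} := by
      ext ω
      simp only [hR, Set.mem_ofPred_eq, Set.mem_iUnion, ← map_trace_adaptivePart, List.mem_map]
    rw [this]
    exact MeasurableSet.iUnion fun i => (measFibers_trAdaptive hSm measurable_const
      measurable_const measurable_id i).preimage {l | (a, s) ∈ l}
  have hFm : ∀ a s, MeasurableSet (F a s) := fun a s =>
    (measFibers_trCoreDepth measurable_const measurable_const measurable_id (a, s)).preimage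
      {m | ¬ m ≤ K}
  have hFle : ∀ a s, (R a s).Nonempty → seedsLaw D (F a s) ≤ ENNReal.ofReal (δ / (6 * n ^ 2)) := by
    rintro a s ⟨ω₀, i, c, hc, hs⟩
    have h1 : F a s = {ω | ¬ coreDepth X δ ω c ≤ K} := by
      simp only [hF, ← hs, trCoreDepth_trace]
    rw [h1]
    exact seedsLaw_coreDepth_gt hd hS (carrier_subset_of_mem_adaptivePart hc) (by omega) hδ hT
  have hprod : ∀ a s, seedsLaw D (R a s ∩ F a s) ≤
      seedsLaw D (R a s) * ENNReal.ofReal (δ / (6 * n ^ 2)) := by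
    intro a s
    rcases (R a s).eq_empty_or_nonempty with h0 | hne
    · simp [h0]
    · rw [seedsLaw_inter_eq (hRm a s) (hFm a s) {k | k.1 ≠ a}]
      · gcongr; exact hFle a s hne
      · rintro ω ω' h ⟨i, c, hc, hs⟩
        have haddr : c.addr = a := congrArg Prod.fst hs
        obtain ⟨j, hj⟩ := exists_mem_adaptivePart_congr (ω' := ω') (a := a)
          (fun b t i hb => h (b, t, i) hb) hc (by rw [haddr])
        exact ⟨j, c, hj, hs⟩
      · intro ω ω' h hω
        have h1 : ∀ t i, ω (a, t, i) = ω' (a, t, i) := fun t i => h _ (by simp)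
        simp only [hF, Set.mem_ofPred_eq, trCoreDepth, trTrialDepth, h1] at hω ⊢
        exact hω
  have hdisj : ∀ a, ∑ s, seedsLaw D (R a s) ≤ 1 := by
    intro a
    rw [← measure_biUnion_finset (f := R a) (s := Finset.univ) _ fun s _ => hRm a s]
    · exact prob_le_one
    · intro s _ s' _ hne
      refine Set.disjoint_left.2 ?_
      rintro ω ⟨i, c, hc, hs⟩ ⟨j, c', hc', hs'⟩
      have : c = c' := adaptivePart_unique hc hc' (by
        rw [show c.addr = a from congrArg Prod.fst hs, show c'.addr = a from congrArg Prod.fst hs'])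
      subst this
      rw [hs] at hs'
      exact hne (congrArg Prod.snd hs')
  have hsub : {ω | rateFail S δ d X ω} ⊆ ⋃ a ∈ A, ⋃ s, R a s ∩ F a s := by
    rintro ω ⟨i, c, hc, hlev, hfail⟩
    refine Set.mem_iUnion₂.2 ⟨c.addr, hAmem _ (Nat.lt_ceil.2 hlev), Set.mem_iUnion.2
      ⟨(trace X 0 c).2, ⟨i, c, hc, rfl⟩, ?_⟩⟩
    have : (c.addr, (trace X 0 c).2) = trace X 0 c := rfl
    simp only [hF, Set.mem_ofPred_eq, this, trCoreDepth_trace]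
    exact hfail
  calc _ ≤ ∑ a ∈ A, ∑ s, seedsLaw D (R a s ∩ F a s) :=
        (measure_mono hsub).trans ((measure_biUnion_finset_le _ _).trans
          (Finset.sum_le_sum fun a _ => measure_iUnion_fintype_le _ _))
    _ ≤ ∑ a ∈ A, ∑ s, seedsLaw D (R a s) * ENNReal.ofReal (δ / (6 * n ^ 2)) :=
        Finset.sum_le_sum fun a _ => Finset.sum_le_sum fun s _ => hprod a s
    _ ≤ ∑ _a ∈ A, ENNReal.ofReal (δ / (6 * n ^ 2)) := Finset.sum_le_sum fun a _ => by
        rw [← Finset.sum_mul]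
        exact (mul_le_mul_left (hdisj a) _).trans (by rw [one_mul])
    _ = ENNReal.ofReal (A.card * (δ / (6 * n ^ 2))) := by
        rw [Finset.sum_const, nsmul_eq_mul, ENNReal.ofReal_mul (by positivity),
          ENNReal.ofReal_natCast]
    _ ≤ _ := by
        refine ENNReal.ofReal_le_ofReal ?_
        have h1 : (A.card : ℝ) ≤ 2 * n ^ 2 := le_trans (by exact_mod_cast hA) (two_pow_ceil_le hn)
        calc (A.card : ℝ) * (δ / (6 * n ^ 2)) ≤ (2 * n ^ 2) * (δ / (6 * n ^ 2)) := by gcongr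
          _ = δ / 3 := by field_simp; norm_num

theorem measurableSet_rateFail {Ω : Type*} [MeasurableSpace Ω] {X : Ω → Fin n → E D}
    {w : Ω → Seeds D} (hSm : MeasurableSet S) (hX : Measurable X) (hw : Measurable w) :
    MeasurableSet {o | rateFail S δ d (X o) (w o)} := by
  have : {o | rateFail S δ d (X o) (w o)} = ⋃ i, {o | ∃ s ∈ trAdaptive S (X o) 0 δ (w o) i,
      (s.1.length : ℝ) < Real.logb 2 ((n : ℝ) ^ 2) ∧
      ¬ trCoreDepth (X o) 0 δ (w o) s ≤ ((2 * noisyRounds d : ℕ) : ℕ∞)} := by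
    ext o
    simp only [rateFail, Set.mem_ofPred_eq, Set.mem_iUnion, ← map_trace_adaptivePart, List.mem_map,
      exists_exists_and_eq_and, trCoreDepth_trace]
    rfl
  rw [this]
  refine MeasurableSet.iUnion fun i => ?_
  refine (measFibers_trAdaptive hSm hX measurable_const hw i).bind_measurableSet
    (P := fun l o => ∃ s ∈ l, (s.1.length : ℝ) < Real.logb 2 ((n : ℝ) ^ 2) ∧
      ¬ trCoreDepth (X o) 0 δ (w o) s ≤ ((2 * noisyRounds d : ℕ) : ℕ∞)) fun l => ?_
  have : {o | ∃ s ∈ l, (s.1.length : ℝ) < Real.logb 2 ((n : ℝ) ^ 2) ∧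
      ¬ trCoreDepth (X o) 0 δ (w o) s ≤ ((2 * noisyRounds d : ℕ) : ℕ∞)} =
      ⋃ s ∈ {s | s ∈ l}, {o | (s.1.length : ℝ) < Real.logb 2 ((n : ℝ) ^ 2)} ∩
        {o | ¬ trCoreDepth (X o) 0 δ (w o) s ≤ ((2 * noisyRounds d : ℕ) : ℕ∞)} := by
    ext o
    simp only [Set.mem_iUnion, Set.mem_inter_iff, Set.mem_ofPred_eq, exists_prop]
  rw [this]
  refine MeasurableSet.biUnion (Set.to_countable _) fun s _ => (MeasurableSet.const _).inter ?_
  exact (measFibers_trCoreDepth hX measurable_const hw s).preimage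
    {m | ¬ m ≤ ((2 * noisyRounds d : ℕ) : ℕ∞)}

theorem attainsRate_of_not_rateFail (hn : 2 ≤ n) {ω : Seeds D} (h : ¬ rateFail S δ d X ω) {k : ℝ}
    (hk : 2 * (noisyRounds d : ℝ) ≤ k) : AttainsRate S X δ ω k := by
  refine attainsRate_of_forall hn fun i c hc hlev => ?_
  simp only [rateFail, not_exists, not_and, not_not] at h
  have h1 := h i c hc hlev
  obtain ⟨m, hm⟩ := ENat.ne_top_iff_exists.1 (ne_top_of_le_ne_top (ENat.natCast_ne_top _) h1)
  refine ⟨m, hm.symm, ?_⟩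
  rw [← hm] at h1
  have h2 : m ≤ 2 * noisyRounds d := by exact_mod_cast h1
  have h3 : (m : ℝ) ≤ ((2 * noisyRounds d : ℕ) : ℝ) := by exact_mod_cast h2
  push_cast at h3
  linarith

theorem numTrials_pos (hn : 2 ≤ n) (hδ : 0 < δ) (hδ1 : δ < 1) : 0 < numTrials n δ := by
  have hn' : (2 : ℝ) ≤ n := by exact_mod_cast hn
  refine Nat.ceil_pos.2 (Real.logb_pos (by norm_num) ?_)
  rw [lt_div_iff₀ hδ]
  nlinarith

/-- A set of doubling dimension larger than `1` has dimension at least `log 3`, the covering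
numbers being integers. -/
theorem three_halves_le_of_hasAssouadDim (h : HasAssouadDim S d) (hd : 1 < d) : 3 / 2 ≤ d := by
  by_contra! hlt
  have h1 : (1 : ℝ) ∈ {s : ℝ | 0 ≤ s ∧ ∀ (z : E D) (r : ℝ), 0 < r →
      ∃ T : Finset (E D), (T.card : ℝ) ≤ (2 : ℝ) ^ s ∧
      Metric.closedBall z r ∩ S ⊆ ⋃ y ∈ T, Metric.closedBall y (r / 2)} := by
    refine ⟨by norm_num, fun z r hr => ?_⟩
    obtain ⟨T, hT, hTc⟩ := h.1.2 z r hr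
    refine ⟨T, ?_, hTc⟩
    have h2 : (T.card : ℝ) < 3 := by
      refine hT.trans_lt ?_
      calc (2 : ℝ) ^ d < (2 : ℝ) ^ (3 / 2 : ℝ) := Real.rpow_lt_rpow_of_exponent_lt (by norm_num) hlt
        _ = √8 := by
            rw [Real.sqrt_eq_rpow, show (8 : ℝ) = 2 ^ (3 : ℝ) by norm_num,
              ← Real.rpow_mul (by norm_num)]
            norm_num
        _ < 3 := by rw [Real.sqrt_lt' (by norm_num)]; norm_num
    have h3 : T.card < 3 := by exact_mod_cast h2
    rw [Real.rpow_one]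
    exact_mod_cast Nat.lt_succ_iff.1 h3
  linarith [h.2 h1]

end Rate

/-! ### A supermartingale for sums of vectors -/

theorem hasSum_cosh_sqrt {u : ℝ} (hu : 0 ≤ u) :
    HasSum (fun k : ℕ => u ^ k / (2 * k).factorial) (Real.cosh √u) := by
  have h := Real.hasSum_cosh √u
  refine h.congr_fun ?_ |> fun h => h
  intro k
  rw [pow_mul, Real.sq_sqrt hu]

/-- The function `u ↦ cosh √u` is convex, being a power series with nonnegative coefficients. -/
theorem convexOn_cosh_sqrt : ConvexOn ℝ (Set.Ici 0) fun u : ℝ => Real.cosh √u := by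
  refine ⟨convex_Ici 0, fun u hu v hv a b ha hb hab => ?_⟩
  have hw : 0 ≤ a • u + b • v := by
    have : (0 : ℝ) ≤ u := hu
    have : (0 : ℝ) ≤ v := hv
    simp only [smul_eq_mul]; positivity
  refine hasSum_le (fun k => ?_) (hasSum_cosh_sqrt hw)
    (((hasSum_cosh_sqrt hu).const_smul a).add ((hasSum_cosh_sqrt hv).const_smul b))
  have h := (convexOn_pow (𝕜 := ℝ) k).2 hu hv ha hb hab
  calc (a • u + b • v) ^ k / (2 * k).factorial
      ≤ (a • u ^ k + b • v ^ k) / (2 * k).factorial := by gcongr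
    _ = _ := by simp only [smul_eq_mul]; ring

theorem exp_sub_le_exp_sq {y : ℝ} (hy : 0 ≤ y) : Real.exp y - y ≤ Real.exp (y ^ 2) := by
  rcases le_total y 1 with h | h
  · have h1 := Real.abs_exp_sub_one_sub_id_le (x := y) (by rwa [abs_of_nonneg hy])
    have h2 := Real.add_one_le_exp (y ^ 2)
    linarith [le_abs_self (Real.exp y - 1 - y)]
  · have : Real.exp y ≤ Real.exp (y ^ 2) := Real.exp_le_exp.2 (by nlinarith)
    linarith

/-- One-step inequality of Pinelis: up to a term linear in `ξ`, adding `ξ` to `x` multiplies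
`cosh ‖x‖` by at most `exp (‖ξ‖ ^ 2)`. -/
theorem cosh_norm_add_le {H : Type*} [NormedAddCommGroup H] [InnerProductSpace ℝ H] (x ξ : H) :
    Real.cosh ‖x + ξ‖ ≤
      Real.cosh ‖x‖ * Real.exp (‖ξ‖ ^ 2) + inner ℝ x ξ * (Real.sinh ‖x‖ / ‖x‖) := by
  rcases eq_or_ne x 0 with rfl | hx
  · have h := Real.cosh_le_exp_half_sq ‖ξ‖
    have h2 : Real.exp (‖ξ‖ ^ 2 / 2) ≤ Real.exp (‖ξ‖ ^ 2) :=
      Real.exp_le_exp.2 (by nlinarith [sq_nonneg ‖ξ‖])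
    simpa using h.trans h2
  rcases eq_or_ne ξ 0 with rfl | hξ
  · simp
  have ha : 0 < ‖x‖ := norm_pos_iff.2 hx
  have hb : 0 < ‖ξ‖ := norm_pos_iff.2 hξ
  set a := ‖x‖ with hadef
  set b := ‖ξ‖ with hbdef
  obtain ⟨s, hs⟩ : ∃ s, inner ℝ x ξ = s * (a * b) :=
    ⟨inner ℝ x ξ / (a * b), by field_simp⟩
  have hs1 : |s| ≤ 1 := by
    have h := abs_real_inner_le_norm x ξ
    rw [hs, abs_mul, abs_of_pos (mul_pos ha hb)] at h
    exact le_of_mul_le_mul_right (by rw [one_mul]; exact h) (mul_pos ha hb)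
  obtain ⟨hsl, hsr⟩ := abs_le.1 hs1
  -- `‖x + ξ‖ ^ 2` is a convex combination of `(a + b) ^ 2` and `(a - b) ^ 2`
  have hnorm : ‖x + ξ‖ = √(((1 + s) / 2) • (a + b) ^ 2 + ((1 - s) / 2) • (a - b) ^ 2) := by
    rw [eq_comm, Real.sqrt_eq_iff_eq_sq _ (norm_nonneg _), norm_add_sq_real, hs]
    · simp only [smul_eq_mul]; ring
    · simp only [smul_eq_mul]
      have : 0 ≤ 1 + s := by linarith
      have : 0 ≤ 1 - s := by linarith
      positivity
  have hconv := convexOn_cosh_sqrt.2 (Set.mem_Ici.2 (sq_nonneg (a + b)))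
    (Set.mem_Ici.2 (sq_nonneg (a - b))) (by linarith : (0 : ℝ) ≤ (1 + s) / 2)
    (by linarith : (0 : ℝ) ≤ (1 - s) / 2) (by ring)
  simp only [Real.sqrt_sq_eq_abs, Real.cosh_abs, Real.cosh_add, Real.cosh_sub] at hconv
  rw [← hnorm] at hconv
  refine hconv.trans ?_
  have hsinh : Real.sinh a ≤ Real.cosh a := (Real.sinh_lt_cosh a).le
  have hsinh0 : 0 ≤ Real.sinh a := Real.sinh_nonneg_iff.2 ha.le
  have hb1 : b ≤ Real.sinh b := Real.self_le_sinh_iff.2 hb.le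
  have hexp : Real.cosh b + Real.sinh b - b ≤ Real.exp (b ^ 2) := by
    rw [Real.cosh_add_sinh]; exact exp_sub_le_exp_sq hb.le
  have h1 : inner ℝ x ξ * (Real.sinh a / a) = s * (Real.sinh a * b) := by
    rw [hs]; field_simp
  rw [h1]
  have h2 : s * (Real.sinh a * (Real.sinh b - b)) ≤ Real.cosh a * (Real.sinh b - b) := by
    have h3 : 0 ≤ Real.sinh a * (Real.sinh b - b) := mul_nonneg hsinh0 (by linarith)
    have h4 : Real.sinh a * (Real.sinh b - b) ≤ Real.cosh a * (Real.sinh b - b) :=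
      mul_le_mul_of_nonneg_right hsinh (by linarith)
    nlinarith
  have h5 : Real.cosh a * (Real.cosh b + Real.sinh b - b) ≤ Real.cosh a * Real.exp (b ^ 2) :=
    mul_le_mul_of_nonneg_left hexp (Real.cosh_pos a).le
  simp only [smul_eq_mul]
  nlinarith

theorem update_set_eq {Ω : Type*} {n : ℕ} {A : (Fin n → Ω) → Set Ω} {I : Finset (Fin n)}
    (hAI : ∀ z z', (∀ i ∈ I, z i = z' i) → A z = A z') {i : Fin n}
    (hi : i ∉ I) (z : Fin n → Ω) (p : Ω) : A (Function.update z i p) = A z :=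
  hAI _ _ fun _ hj => Function.update_of_ne (ne_of_mem_of_not_mem hj hi) _ _

section Compression

variable {Ω : Type*} [MeasurableSpace Ω] {ρ : Measure Ω} [IsProbabilityMeasure ρ] {n : ℕ}

/-- Supermartingale bound on a product space, when the coordinates outside of `I` are revealed one
at a time. -/
theorem lintegral_pi_le_one {G : Finset (Fin n) → (Fin n → Ω) → ENNReal} {I : Finset (Fin n)}
    (hG : ∀ R, Measurable (G R)) (h0 : ∀ z, G ∅ z ≤ 1)
    (hstep : ∀ R i, i ∉ R → i ∉ I → ∀ z,
      ∫⁻ p, G (insert i R) (Function.update z i p) ∂ρ ≤ ∫⁻ p, G R (Function.update z i p) ∂ρ)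
    (R : Finset (Fin n)) (hR : Disjoint R I) : ∫⁻ z, G R z ∂(Measure.pi fun _ => ρ) ≤ 1 := by
  classical
  induction R using Finset.induction_on with
  | empty =>
    calc _ ≤ ∫⁻ _, 1 ∂(Measure.pi fun _ : Fin n => ρ) := lintegral_mono h0
      _ = 1 := by simp
  | insert i R hi ih =>
    rw [Finset.disjoint_insert_left] at hR
    refine le_trans (lintegral_le_of_lmarginal_le {i} (hG _) (hG _) fun z => ?_) (ih hR.2)
    rw [lmarginal_singleton, lmarginal_singleton]
    exact hstep R i hi hR.1 z

variable {A : (Fin n → Ω) → Set Ω} {I : Finset (Fin n)}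

open Classical in
/-- Few of the sample points outside of `I` fall into a set that depends on the points in `I` only
if the set has a small mass. -/
theorem measure_mass_gt (hA : MeasurableSet {q : (Fin n → Ω) × Ω | q.2 ∈ A q.1})
    (hAI : ∀ z z', (∀ i ∈ I, z i = z' i) → A z = A z') (R : Finset (Fin n)) (hR : Disjoint R I)
    (L : ℝ) :
    (Measure.pi fun _ => ρ) {z | L + ((R.filter fun i => z i ∈ A z).card : ℝ) ≤
      R.card * ρ.real (A z) / 2} ≤ ENNReal.ofReal (Real.exp (-L)) := by
  have hAz : ∀ z, MeasurableSet (A z) := fun z => hA.preimage measurable_prodMk_left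
  have hmA : Measurable fun z => ρ.real (A z) := (measurable_measure_prodMk_left hA).ennreal_toReal
  set ind : Fin n → (Fin n → Ω) → ℝ := fun i z => if z i ∈ A z then 1 else 0 with hind
  have hindm : ∀ i, Measurable (ind i) := fun i =>
    Measurable.ite (hA.preimage (measurable_id.prodMk (measurable_pi_apply i))) measurable_const
      measurable_const
  set G : Finset (Fin n) → (Fin n → Ω) → ENNReal := fun R z =>
    ENNReal.ofReal (Real.exp (-(∑ i ∈ R, ind i z) + R.card * ρ.real (A z) / 2)) with hG
  have hGm : ∀ R, Measurable (G R) := fun R =>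
    ((Finset.measurable_sum _ fun i _ => hindm i).neg.add
      ((hmA.const_mul _).div_const _)).exp.ennreal_ofReal
  have key := lintegral_pi_le_one (ρ := ρ) (I := I) hGm (fun z => by simp [hG])
    (fun R i hi hiI z => by
    have hA' := fun p => update_set_eq hAI hiI z p
    have hind' : ∀ p, ∀ j ∈ R, ind j (Function.update z i p) = ind j z := by
      intro p j hj
      have : j ≠ i := fun h => hi (h ▸ hj)
      simp only [hind, hA', Function.update_of_ne this]
    have hindi : ∀ p, ind i (Function.update z i p) = if p ∈ A z then 1 else 0 := by
      intro p
      simp only [hind, hA', Function.update_self]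
    have e1 : ∀ p, G R (Function.update z i p) = G R z := by
      intro p
      simp only [hG, hA', Finset.sum_congr rfl (hind' p)]
    have e2 : ∀ p, G (insert i R) (Function.update z i p) = G R z *
        (ENNReal.ofReal (Real.exp (ρ.real (A z) / 2)) *
          ENNReal.ofReal (Real.exp (-(if p ∈ A z then 1 else 0)))) := by
      intro p
      simp only [hG]
      rw [← ENNReal.ofReal_mul (Real.exp_pos _).le, ← ENNReal.ofReal_mul (Real.exp_pos _).le,
        ← Real.exp_add, ← Real.exp_add, Finset.sum_insert hi, Finset.card_insert_of_notMem hi,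
        hindi, hA', Finset.sum_congr rfl (hind' p)]
      congr 2
      push_cast; ring
    simp only [e1, e2]
    have hm : Measurable fun p => ENNReal.ofReal (Real.exp (-(if p ∈ A z then (1 : ℝ) else 0))) :=
      (Measurable.ite (hAz z) measurable_const measurable_const).neg.exp.ennreal_ofReal
    rw [lintegral_const_mul _ (hm.const_mul _), lintegral_const_mul _ hm, lintegral_const,
      measure_univ, mul_one]
    refine mul_le_of_le_one_right' ?_
    have hle : ∫⁻ p, ENNReal.ofReal (Real.exp (-(if p ∈ A z then (1 : ℝ) else 0))) ∂ρ ≤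
        ENNReal.ofReal (1 - ρ.real (A z) / 2) := by
      have h1 : Real.exp (-1) ≤ 1 / 2 := by
        rw [Real.exp_neg, ← one_div]
        exact one_div_le_one_div_of_le (by norm_num) (by linarith [Real.exp_one_gt_d9])
      calc _ ≤ ∫⁻ p, ((A z).indicator (fun _ => ENNReal.ofReal (1 / 2)) p +
              (A z)ᶜ.indicator (fun _ => 1) p) ∂ρ := by
            refine lintegral_mono fun p => ?_
            by_cases hp : p ∈ A z
            · simpa [hp] using ENNReal.ofReal_le_ofReal h1
            · simp [hp]
        _ = ENNReal.ofReal (1 / 2) * ρ (A z) + ρ (A z)ᶜ := by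
            rw [lintegral_add_left (measurable_const.indicator (hAz z)),
              lintegral_indicator_const (hAz z), lintegral_indicator_const (hAz z).compl, one_mul]
        _ = _ := by
            rw [← ofReal_measureReal (s := A z), ← ofReal_measureReal (s := (A z)ᶜ),
              ← ENNReal.ofReal_mul (by norm_num), ← ENNReal.ofReal_add (by positivity)
              (by positivity), probReal_compl_eq_one_sub (hAz z)]
            congr 1; ring
    calc _ ≤ ENNReal.ofReal (Real.exp (ρ.real (A z) / 2)) *
          ENNReal.ofReal (1 - ρ.real (A z) / 2) := by gcongr
      _ = ENNReal.ofReal (Real.exp (ρ.real (A z) / 2) * (1 - ρ.real (A z) / 2)) := by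
          rw [ENNReal.ofReal_mul (Real.exp_pos _).le]
      _ ≤ ENNReal.ofReal 1 := by
          refine ENNReal.ofReal_le_ofReal ?_
          calc _ ≤ Real.exp (ρ.real (A z) / 2) * Real.exp (-(ρ.real (A z) / 2)) := by
                gcongr; exact Real.one_sub_le_exp_neg _
            _ = 1 := by rw [← Real.exp_add]; simp
      _ = 1 := by simp) R hR
  have hcard : ∀ z, ∑ i ∈ R, ind i z = ((R.filter fun i => z i ∈ A z).card : ℝ) := by
    intro z
    rw [Finset.card_filter]; push_cast; rfl
  calc _ ≤ ∫⁻ z, ENNReal.ofReal (Real.exp (-L)) * G R z ∂(Measure.pi fun _ => ρ) := by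
        refine meas_le_lintegral₀ ((hGm R).const_mul _).aemeasurable fun z hz => ?_
        simp only [hG]
        rw [← ENNReal.ofReal_mul (Real.exp_pos _).le, ← Real.exp_add, ENNReal.one_le_ofReal,
          Real.one_le_exp_iff, hcard]
        have : L + ((R.filter fun i => z i ∈ A z).card : ℝ) ≤ R.card * ρ.real (A z) / 2 := hz
        linarith
    _ = ENNReal.ofReal (Real.exp (-L)) * ∫⁻ z, G R z ∂(Measure.pi fun _ => ρ) :=
        lintegral_const_mul _ (hGm R)
    _ ≤ _ := mul_le_of_le_one_right' key

open Classical in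
/-- Deviation of the sum of centred vectors over the sample points outside of `I` that fall into a
set depending on the points in `I` only. -/
theorem measure_norm_sum_gt {H : Type*} [NormedAddCommGroup H] [InnerProductSpace ℝ H]
    [CompleteSpace H] [MeasurableSpace H] [BorelSpace H] [SecondCountableTopology H]
    {ξ : Ω → H} (hξ : Measurable ξ) {B : ℝ} (hξB : ∀ᵐ p ∂ρ, ‖ξ p‖ ≤ B)
    (hA : MeasurableSet {q : (Fin n → Ω) × Ω | q.2 ∈ A q.1})
    (hAI : ∀ z z', (∀ i ∈ I, z i = z' i) → A z = A z') (hzero : ∀ z, ∫ p in A z, ξ p ∂ρ = 0)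
    (R : Finset (Fin n)) (hR : Disjoint R I) (L t : ℝ) (ht : 0 ≤ t) :
    (Measure.pi fun _ => ρ) {z | L + (t * B) ^ 2 * ((R.filter fun i => z i ∈ A z).card : ℝ) ≤
      t * ‖∑ i ∈ R.filter fun i => z i ∈ A z, ξ (z i)‖} ≤ ENNReal.ofReal (2 * Real.exp (-L)) := by
  have hAz : ∀ z, MeasurableSet (A z) := fun z => hA.preimage measurable_prodMk_left
  have hmem : ∀ i : Fin n, MeasurableSet {z : Fin n → Ω | z i ∈ A z} := fun i =>
    hA.preimage (measurable_id.prodMk (measurable_pi_apply i))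
  set ind : Fin n → (Fin n → Ω) → ℝ := fun i z => if z i ∈ A z then 1 else 0 with hind
  set vec : Fin n → (Fin n → Ω) → H := fun i z => if z i ∈ A z then ξ (z i) else 0 with hvec
  have hindm : ∀ i, Measurable (ind i) := fun i =>
    Measurable.ite (hmem i) measurable_const measurable_const
  have hvecm : ∀ i, Measurable (vec i) := fun i =>
    Measurable.ite (hmem i) (hξ.comp (measurable_pi_apply i)) measurable_const
  set G : Finset (Fin n) → (Fin n → Ω) → ENNReal := fun R z =>
    ENNReal.ofReal (Real.cosh ‖t • ∑ i ∈ R, vec i z‖ * Real.exp (-((t * B) ^ 2 * ∑ i ∈ R, ind i z)))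
    with hG
  have hGm : ∀ R, Measurable (G R) := fun R =>
    ((Real.continuous_cosh.measurable.comp
      ((Finset.measurable_sum _ fun i _ => hvecm i).const_smul t).norm).mul
      ((Finset.measurable_sum _ fun i _ => hindm i).const_mul _).neg.exp).ennreal_ofReal
  have key := lintegral_pi_le_one (ρ := ρ) (I := I) hGm (fun z => by simp [hG])
    (fun R i hi hiI z => by
    have hA' := fun p => update_set_eq hAI hiI z p
    have hne : ∀ j ∈ R, j ≠ i := fun j hj h => hi (h ▸ hj)
    have hind' : ∀ p, ∀ j ∈ R, ind j (Function.update z i p) = ind j z := by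
      intro p j hj
      simp only [hind, hA', Function.update_of_ne (hne j hj)]
    have hvec' : ∀ p, ∀ j ∈ R, vec j (Function.update z i p) = vec j z := by
      intro p j hj
      simp only [hvec, hA', Function.update_of_ne (hne j hj)]
    have hindi : ∀ p, ind i (Function.update z i p) = if p ∈ A z then 1 else 0 := by
      intro p
      simp only [hind, hA', Function.update_self]
    have hveci : ∀ p, vec i (Function.update z i p) = (A z).indicator ξ p := by
      intro p
      simp only [hvec, hA', Function.update_self, Set.indicator_apply]
    set x : H := t • ∑ j ∈ R, vec j z with hx
    set N : ℝ := ∑ j ∈ R, ind j z with hN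
    have e1 : ∀ p, G R (Function.update z i p) =
        ENNReal.ofReal (Real.cosh ‖x‖ * Real.exp (-((t * B) ^ 2 * N))) := by
      intro p
      simp only [hG, Finset.sum_congr rfl (hind' p), Finset.sum_congr rfl (hvec' p), hx, hN]
    have e2 : ∀ p, G (insert i R) (Function.update z i p) =
        ENNReal.ofReal (Real.cosh ‖x + t • (A z).indicator ξ p‖ *
          Real.exp (-((t * B) ^ 2 * (N + if p ∈ A z then 1 else 0)))) := by
      intro p
      simp only [hG]
      rw [Finset.sum_insert hi, Finset.sum_insert hi, hindi, hveci,
        Finset.sum_congr rfl (hind' p), Finset.sum_congr rfl (hvec' p), add_comm, smul_add,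
        add_comm (t • ∑ j ∈ R, vec j z), add_comm (ite _ _ _)]
    simp only [e1, e2]
    set a : ℝ := Real.exp (-((t * B) ^ 2 * N)) * Real.exp (-(t * B) ^ 2) *
      (Real.sinh ‖x‖ / ‖x‖) with ha
    set h : Ω → ℝ := fun p => Real.cosh ‖x‖ * Real.exp (-((t * B) ^ 2 * N)) +
      a * inner ℝ x (t • (A z).indicator ξ p) with hh
    have hξi : Integrable ξ ρ := Integrable.of_bound hξ.aestronglyMeasurable B hξB
    have hint : Integrable (fun p => t • (A z).indicator ξ p) ρ :=
      (hξi.indicator (hAz z)).smul t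
    have hhint : Integrable h ρ :=
      (integrable_const _).add ((hint.const_inner x).const_mul a)
    have hle : ∀ᵐ p ∂ρ, Real.cosh ‖x + t • (A z).indicator ξ p‖ *
          Real.exp (-((t * B) ^ 2 * (N + if p ∈ A z then 1 else 0))) ≤ h p := by
      filter_upwards [hξB] with p hp
      by_cases hpA : p ∈ A z
      · simp only [hpA, if_true, Set.indicator_of_mem, hh]
        have h1 := cosh_norm_add_le x (t • ξ p)
        have h2 : Real.exp (‖t • ξ p‖ ^ 2) ≤ Real.exp ((t * B) ^ 2) := by
          refine Real.exp_le_exp.2 (pow_le_pow_left₀ (norm_nonneg _) ?_ 2)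
          rw [norm_smul, Real.norm_of_nonneg ht]
          gcongr
        have h3 : Real.cosh ‖x + t • ξ p‖ ≤ Real.cosh ‖x‖ * Real.exp ((t * B) ^ 2) +
            inner ℝ x (t • ξ p) * (Real.sinh ‖x‖ / ‖x‖) := by
          refine h1.trans ?_
          gcongr
        have h4 : Real.exp (-((t * B) ^ 2 * (N + 1))) =
            Real.exp (-((t * B) ^ 2 * N)) * Real.exp (-(t * B) ^ 2) := by
          rw [← Real.exp_add]; congr 1; ring
        have h5 : Real.exp ((t * B) ^ 2) * Real.exp (-(t * B) ^ 2) = 1 := by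
          rw [← Real.exp_add]; simp
        rw [h4]
        calc _ ≤ (Real.cosh ‖x‖ * Real.exp ((t * B) ^ 2) +
            inner ℝ x (t • ξ p) * (Real.sinh ‖x‖ / ‖x‖)) *
            (Real.exp (-((t * B) ^ 2 * N)) * Real.exp (-(t * B) ^ 2)) := by gcongr
          _ = Real.cosh ‖x‖ * Real.exp (-((t * B) ^ 2 * N)) *
              (Real.exp ((t * B) ^ 2) * Real.exp (-(t * B) ^ 2)) + a * inner ℝ x (t • ξ p) := by
            rw [ha]; ring
          _ = _ := by rw [h5, mul_one]
      · simp [hpA, hh]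
    calc _ ≤ ∫⁻ p, ENNReal.ofReal (h p) ∂ρ :=
          lintegral_mono_ae (hle.mono fun p hp => ENNReal.ofReal_le_ofReal hp)
      _ = ENNReal.ofReal (∫ p, h p ∂ρ) := by
          refine (ofReal_integral_eq_lintegral_ofReal hhint ?_).symm
          filter_upwards [hle] with p hp
          exact le_trans (mul_nonneg (Real.cosh_pos _).le (Real.exp_pos _).le) hp
      _ = ENNReal.ofReal (Real.cosh ‖x‖ * Real.exp (-((t * B) ^ 2 * N))) := by
          congr 1
          rw [hh, integral_add (integrable_const _) ((hint.const_inner x).const_mul a),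
            integral_const_mul a, integral_inner hint, integral_smul,
            integral_indicator (hAz z), hzero]
          simp
      _ ≤ _ := by simp) R hR
  have hcard : ∀ z, ∑ i ∈ R, ind i z = ((R.filter fun i => z i ∈ A z).card : ℝ) := by
    intro z
    rw [Finset.card_filter]; push_cast; rfl
  have hsum : ∀ z, ∑ i ∈ R, vec i z = ∑ i ∈ R.filter fun i => z i ∈ A z, ξ (z i) := by
    intro z
    rw [Finset.sum_filter]
  calc _ ≤ ∫⁻ z, ENNReal.ofReal (2 * Real.exp (-L)) * G R z ∂(Measure.pi fun _ => ρ) := by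
        refine meas_le_lintegral₀ ((hGm R).const_mul _).aemeasurable fun z hz => ?_
        simp only [hG]
        rw [← ENNReal.ofReal_mul (by positivity), ENNReal.one_le_ofReal, hcard, hsum]
        have h1 : L + (t * B) ^ 2 * ((R.filter fun i => z i ∈ A z).card : ℝ) ≤
          t * ‖∑ i ∈ R.filter fun i => z i ∈ A z, ξ (z i)‖ := hz
        rw [norm_smul, Real.norm_of_nonneg ht]
        set y := t * ‖∑ i ∈ R.filter fun i => z i ∈ A z, ξ (z i)‖
        have h2 : Real.exp y / 2 ≤ Real.cosh y := by
          rw [Real.cosh_eq]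
          linarith [Real.exp_pos (-y)]
        calc (1 : ℝ) ≤ Real.exp (y + (-L + -((t * B) ^ 2 *
              ((R.filter fun i => z i ∈ A z).card : ℝ)))) := Real.one_le_exp (by linarith)
          _ = 2 * Real.exp (-L) * (Real.exp y / 2 * Real.exp (-((t * B) ^ 2 *
              ((R.filter fun i => z i ∈ A z).card : ℝ)))) := by
            rw [Real.exp_add, Real.exp_add]; ring
          _ ≤ _ := by gcongr
    _ = ENNReal.ofReal (2 * Real.exp (-L)) * ∫⁻ z, G R z ∂(Measure.pi fun _ => ρ) :=
        lintegral_const_mul _ (hGm R)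
    _ ≤ _ := mul_le_of_le_one_right' key

open Classical in
/-- Good behaviour of the sample on a set: its mass and the sum of the noise vectors over its sample
points are controlled by the number of these points, up to the precision `K`. -/
def Controlled {H : Type*} [NormedAddCommGroup H] (ρ : Measure Ω) (ξ : Ω → H) (B K : ℝ)
    (z : Fin n → Ω) (A : Set Ω) : Prop :=
  n * ρ.real A ≤ 2 * ((Finset.univ.filter fun i => z i ∈ A).card : ℝ) + K ∧
  ‖∑ i ∈ Finset.univ.filter fun i => z i ∈ A, ξ (z i)‖ ^ 2 ≤
    B ^ 2 * (4 * K * ((Finset.univ.filter fun i => z i ∈ A).card : ℝ))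

open Classical in
/-- Sample compression: a set depending on few sample points is controlled with high probability.
The points in `I`, on which the set depends, contribute at most `I.card` to the counts. -/
theorem measure_not_controlled_le {H : Type*} [NormedAddCommGroup H] [InnerProductSpace ℝ H]
    [CompleteSpace H] [MeasurableSpace H] [BorelSpace H] [SecondCountableTopology H]
    {ξ : Ω → H} (hξ : Measurable ξ) {B : ℝ} (hB : 0 < B) (hξB : ∀ᵐ p ∂ρ, ‖ξ p‖ ≤ B)
    (hA : MeasurableSet {q : (Fin n → Ω) × Ω | q.2 ∈ A q.1})
    (hAI : ∀ z z', (∀ i ∈ I, z i = z' i) → A z = A z') (hzero : ∀ z, ∫ p in A z, ξ p ∂ρ = 0)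
    {L : ℝ} (hL : 0 < L) :
    (Measure.pi fun _ => ρ) {z | ¬ Controlled ρ ξ B (2 * L + I.card) z (A z)} ≤
      ENNReal.ofReal ((2 * n + 1) * Real.exp (-L)) := by
  set R := Iᶜ with hRdef
  have hR : Disjoint R I := disjoint_compl_left
  set NR : (Fin n → Ω) → ℝ := fun z => ((R.filter fun i => z i ∈ A z).card : ℝ) with hNR
  -- the optimal parameter depends on the random number `N` of points, hence a union over `N`
  set t : ℕ → ℝ := fun N => √(L / N) / B with ht
  have ht0 : ∀ N, 0 ≤ t N := fun N => by positivity
  set E₁ : Set (Fin n → Ω) := {z | L + ((R.filter fun i => z i ∈ A z).card : ℝ) ≤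
      R.card * ρ.real (A z) / 2} with hE₁
  set E₂ : ℕ → Set (Fin n → Ω) := fun N => {z |
      L + (t N * B) ^ 2 * ((R.filter fun i => z i ∈ A z).card : ℝ) ≤
      t N * ‖∑ i ∈ R.filter fun i => z i ∈ A z, ξ (z i)‖} with hE₂
  have hsplit : ∀ z, (Finset.univ.filter fun i => z i ∈ A z) =
      (I.filter fun i => z i ∈ A z) ∪ R.filter fun i => z i ∈ A z := by
    intro z
    rw [← Finset.filter_union, hRdef, Finset.union_compl]
  have hdisj : ∀ z, Disjoint (I.filter fun i => z i ∈ A z) (R.filter fun i => z i ∈ A z) :=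
    fun z => Finset.disjoint_filter_filter hR.symm
  have hsub : {z | ¬ Controlled ρ ξ B (2 * L + I.card) z (A z)} ⊆
      ({z | ¬ ∀ i, ‖ξ (z i)‖ ≤ B} ∪ E₁) ∪ ⋃ N ∈ Finset.Icc 1 n, E₂ N := by
    intro z hz
    by_contra hcon
    simp only [Set.mem_union, Set.mem_iUnion, not_or, not_exists, Set.mem_ofPred_eq, not_not] at hcon
    obtain ⟨⟨hb, h1⟩, h2⟩ := hcon
    refine hz ?_
    set N := (Finset.univ.filter fun i => z i ∈ A z).card with hN
    have hNle : N ≤ n := by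
      simpa using (Finset.univ.filter fun i => z i ∈ A z).card_le_univ
    have hcard : N = (I.filter fun i => z i ∈ A z).card + (R.filter fun i => z i ∈ A z).card := by
      rw [hN, hsplit, Finset.card_union_of_disjoint (hdisj z)]
    have hcR : ((R.filter fun i => z i ∈ A z).card : ℝ) ≤ N := by
      exact_mod_cast (by omega : (R.filter fun i => z i ∈ A z).card ≤ N)
    have hcI : ((I.filter fun i => z i ∈ A z).card : ℝ) ≤ N := by
      exact_mod_cast (by omega : (I.filter fun i => z i ∈ A z).card ≤ N)
    have hcI' : ((I.filter fun i => z i ∈ A z).card : ℝ) ≤ I.card := by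
      exact_mod_cast Finset.card_filter_le _ _
    constructor
    · have h3 : (R.card : ℝ) = n - I.card := by
        rw [hRdef, Finset.card_compl, Fintype.card_fin,
          Nat.cast_sub (by simpa using I.card_le_univ)]
      simp only [hE₁, Set.mem_ofPred_eq, not_le, h3] at h1
      have h4 : (I.card : ℝ) * ρ.real (A z) ≤ I.card :=
        mul_le_of_le_one_right (by positivity) measureReal_le_one
      rw [← hN]
      nlinarith
    · rw [← hN, hsplit, Finset.sum_union (hdisj z)]
      have hSI : ‖∑ i ∈ I.filter fun i => z i ∈ A z, ξ (z i)‖ ≤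
          B * (I.filter fun i => z i ∈ A z).card := by
        refine (norm_sum_le_of_le _ fun i _ => hb i).trans ?_
        rw [Finset.sum_const, nsmul_eq_mul, mul_comm]
      rcases Nat.eq_zero_or_pos N with h0 | hpos
      · have e1 : (I.filter fun i => z i ∈ A z) = ∅ := Finset.card_eq_zero.1 (by omega)
        have e2 : (R.filter fun i => z i ∈ A z) = ∅ := Finset.card_eq_zero.1 (by omega)
        rw [e1, e2, h0]; simp
      have hN0 : (0 : ℝ) < N := by exact_mod_cast hpos
      have h3 := h2 N (Finset.mem_Icc.2 ⟨hpos, hNle⟩)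
      simp only [hE₂, Set.mem_ofPred_eq, not_le] at h3
      set SR := ‖∑ i ∈ R.filter fun i => z i ∈ A z, ξ (z i)‖ with hSR
      set SI := ‖∑ i ∈ I.filter fun i => z i ∈ A z, ξ (z i)‖ with hSI'
      have htB : t N * B = √(L / N) := by rw [ht]; field_simp
      have hsq : √(L / N) ^ 2 = L / N := Real.sq_sqrt (by positivity)
      have h4 : t N * SR ≤ 2 * L := by
        refine h3.le.trans ?_
        rw [htB, hsq]
        have : L / N * ((R.filter fun i => z i ∈ A z).card : ℝ) ≤ L / N * N := by gcongr
        rw [div_mul_cancel₀ _ hN0.ne'] at this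
        linarith
      have h5 : SR ^ 2 ≤ B ^ 2 * (4 * L * N) := by
        have h6 : √(L / N) * SR ≤ 2 * L * B := by
          have : t N * SR * B ≤ 2 * L * B := by gcongr
          calc √(L / N) * SR = t N * SR * B := by rw [← htB]; ring
            _ ≤ _ := this
        have h7 : L / N * SR ^ 2 ≤ 4 * L ^ 2 * B ^ 2 := by
          calc L / N * SR ^ 2 = (√(L / N) * SR) ^ 2 := by rw [mul_pow, hsq]
            _ ≤ (2 * L * B) ^ 2 := pow_le_pow_left₀ (by positivity) h6 2
            _ = _ := by ring
        rw [div_mul_eq_mul_div, div_le_iff₀ hN0] at h7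
        refine le_of_mul_le_mul_left ?_ hL
        linarith
      have h8 : SI ^ 2 ≤ B ^ 2 * (I.card * N) := by
        calc SI ^ 2 ≤ (B * (I.filter fun i => z i ∈ A z).card) ^ 2 :=
              pow_le_pow_left₀ (norm_nonneg _) hSI 2
          _ = B ^ 2 * ((I.filter fun i => z i ∈ A z).card * (I.filter fun i => z i ∈ A z).card) := by
              ring
          _ ≤ _ := by gcongr
      have h9 := norm_add_le (∑ i ∈ I.filter fun i => z i ∈ A z, ξ (z i))
        (∑ i ∈ R.filter fun i => z i ∈ A z, ξ (z i))
      have h10 : (SI + SR) ^ 2 ≤ 2 * SI ^ 2 + 2 * SR ^ 2 := by nlinarith [sq_nonneg (SI - SR)]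
      have h11 : 0 ≤ B ^ 2 * ((I.card : ℝ) * N) := by positivity
      calc _ ≤ (SI + SR) ^ 2 := pow_le_pow_left₀ (norm_nonneg _) h9 2
        _ ≤ _ := by nlinarith
  have hnull : (Measure.pi fun _ => ρ) {z : Fin n → Ω | ¬ ∀ i, ‖ξ (z i)‖ ≤ B} = 0 := by
    have : ∀ᵐ z ∂(Measure.pi fun _ : Fin n => ρ), ∀ i, ‖ξ (z i)‖ ≤ B :=
      ae_all_iff.2 fun i =>
        (measurePreserving_eval (fun _ : Fin n => ρ) i).quasiMeasurePreserving.ae hξB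
    exact this
  calc _ ≤ (Measure.pi fun _ => ρ) {z : Fin n → Ω | ¬ ∀ i, ‖ξ (z i)‖ ≤ B} +
        (Measure.pi fun _ => ρ) E₁ + ∑ N ∈ Finset.Icc 1 n, (Measure.pi fun _ => ρ) (E₂ N) :=
        (measure_mono hsub).trans ((measure_union_le _ _).trans (add_le_add (measure_union_le _ _)
          (measure_biUnion_finset_le _ _)))
    _ ≤ 0 + ENNReal.ofReal (Real.exp (-L)) +
        ∑ _N ∈ Finset.Icc 1 n, ENNReal.ofReal (2 * Real.exp (-L)) := by
        refine add_le_add (add_le_add hnull.le (measure_mass_gt hA hAI R hR L))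
          (Finset.sum_le_sum fun N _ => ?_)
        exact measure_norm_sum_gt hξ hξB hA hAI hzero R hR L (t N) (ht0 N)
    _ = _ := by
        rw [Finset.sum_const, Nat.card_Icc, nsmul_eq_mul, zero_add, ← ENNReal.ofReal_natCast,
          ← ENNReal.ofReal_mul (by positivity), ← ENNReal.ofReal_add (by positivity) (by positivity)]
        congr 1
        push_cast [Nat.add_sub_cancel]; ring

end Compression

/-! ### Codes of the cells -/

/-- Instructions for one split in the description of a cell: the side of the hyperplane that is
kept, the step and the trial in which the split is made, two sample points whose projections have
the median of the projected data as their midpoint, two sample points at distance `Δ_n(A₀)`, and a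
flag telling whether there are data to take the median of. -/
abbrev Step (L T n : ℕ) : Type :=
  (Bool × Fin L × Fin T) × (Fin n × Fin n) × (Fin n × Fin n) × Bool

section Code

variable {D n L T : ℕ} {S : Set (E D)}

/-- Address of the node described by a list of instructions, the last split coming first. -/
def codeAddr (l : List (Step L T n)) : List Bool := l.map fun s => s.1.1

/-- Threshold of the split described by the instructions `s` at the node with address `a`. -/
def codeThreshold (X : Fin n → E D) (ω : Seeds D) (a : List Bool) (s : Step L T n) : ℝ :=
  let ξ := ω (a.drop s.1.2.1, s.1.2.2, s.1.2.1)
  (if s.2.2.2 then (inner ℝ (X s.2.1.1) ξ.1 + inner ℝ (X s.2.1.2) ξ.1) / 2 else 0) +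
    ξ.2 * (6 / √(D : ℝ)) * ‖X s.2.2.1.1 - X s.2.2.1.2‖

/-- The region described by a list of instructions. -/
def codeRegion (S : Set (E D)) (X : Fin n → E D) (ω : Seeds D) : List (Step L T n) → Set (E D)
  | [] => S
  | s :: l => {x ∈ codeRegion S X ω l |
      (¬ inner ℝ x (ω ((codeAddr l).drop s.1.2.1, s.1.2.2, s.1.2.1)).1 ≤
        codeThreshold X ω (codeAddr l) s) ↔ s.1.1}

/-- Indices of the sample points used by the instructions. -/
def codeIdx : List (Step L T n) → Finset (Fin n)
  | [] => ∅
  | s :: l => {s.2.1.1, s.2.1.2, s.2.2.1.1, s.2.2.1.2} ∪ codeIdx l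

theorem card_codeIdx_le (l : List (Step L T n)) : (codeIdx l).card ≤ 4 * l.length := by
  induction l with
  | nil => simp [codeIdx]
  | cons s l ih =>
    have h1 := Finset.card_union_le {s.2.1.1, s.2.1.2, s.2.2.1.1, s.2.2.1.2} (codeIdx l)
    have h2 := Finset.card_le_four (a := s.2.1.1) (b := s.2.1.2) (c := s.2.2.1.1) (d := s.2.2.1.2)
    rw [codeIdx, List.length_cons]
    omega

theorem codeRegion_congr {X X' : Fin n → E D} (ω : Seeds D) {l : List (Step L T n)}
    (h : ∀ i ∈ codeIdx l, X i = X' i) : codeRegion S X ω l = codeRegion S X' ω l := by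
  induction l with
  | nil => rfl
  | cons s l ih =>
    simp only [codeIdx, Finset.mem_union, Finset.mem_insert, Finset.mem_singleton] at h
    rw [codeRegion, codeRegion, ih fun i hi => h i (Or.inr hi)]
    simp only [codeThreshold, h s.2.1.1 (by simp), h s.2.1.2 (by simp), h s.2.2.1.1 (by simp),
      h s.2.2.1.2 (by simp)]

theorem measurableSet_codeRegion {Ω : Type*} [MeasurableSpace Ω] {X : Ω → Fin n → E D}
    {w : Ω → Seeds D} {x : Ω → E D} (hS : MeasurableSet S) (hX : Measurable X) (hw : Measurable w)
    (hx : Measurable x) (l : List (Step L T n)) :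
    MeasurableSet {o | x o ∈ codeRegion S (X o) (w o) l} := by
  have hXi : ∀ i, Measurable fun o => X o i := fun i => (measurable_pi_apply i).comp hX
  have hwk : ∀ k, Measurable fun o => w o k := fun k => (measurable_pi_apply k).comp hw
  induction l with
  | nil => exact hx hS
  | cons s l ih =>
    have h1 : Measurable fun o => codeThreshold (X o) (w o) (codeAddr l) s := by
      unfold codeThreshold
      refine Measurable.add ?_ ((((hwk _).snd).mul_const _).mul ((hXi _).sub (hXi _)).norm)
      by_cases hb : s.2.2.2 = true
      · simp only [hb, if_true]
        exact (((hXi _).inner (hwk _).fst).add ((hXi _).inner (hwk _).fst)).div_const _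
      · simp only [hb]
        exact measurable_const
    have h2 : MeasurableSet {o | (inner ℝ (x o)
        (w o ((codeAddr l).drop s.1.2.1, s.1.2.2, s.1.2.1)).1 : ℝ) ≤
        codeThreshold (X o) (w o) (codeAddr l) s} :=
      measurableSet_le (hx.inner (hwk _).fst) h1
    have h3 : {o | x o ∈ codeRegion S (X o) (w o) (s :: l)} =
        {o | x o ∈ codeRegion S (X o) (w o) l} ∩ (if s.1.1 then {o | (inner ℝ (x o)
        (w o ((codeAddr l).drop s.1.2.1, s.1.2.2, s.1.2.1)).1 : ℝ) ≤
        codeThreshold (X o) (w o) (codeAddr l) s}ᶜ else {o | (inner ℝ (x o)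
        (w o ((codeAddr l).drop s.1.2.1, s.1.2.2, s.1.2.1)).1 : ℝ) ≤
        codeThreshold (X o) (w o) (codeAddr l) s}) := by
      ext o
      by_cases hb : s.1.1 = true <;>
        simp [codeRegion, hb]
    rw [h3]
    refine ih.inter ?_
    split_ifs
    · exact h2.compl
    · exact h2

/-! ### Every cell of the tree has a code -/

theorem exists_dataDiam_eq_norm (hn : 0 < n) (X : Fin n → E D) (A : Set (E D)) :
    ∃ p q : Fin n, dataDiam X A = ‖X p - X q‖ := by
  rcases (Set.range X ∩ A).eq_empty_or_nonempty with h | ⟨_, ⟨i, rfl⟩, hi⟩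
  · exact ⟨⟨0, hn⟩, ⟨0, hn⟩, by simp [dataDiam, h]⟩
  · have hne : ((idxSet X A) ×ˢ (idxSet X A)).Nonempty := ⟨(i, i), by simp [hi]⟩
    obtain ⟨⟨p, q⟩, hpq, hmax⟩ := Finset.exists_max_image _ (fun r => dist (X r.1) (X r.2)) hne
    simp only [Finset.mem_product, mem_idxSet] at hpq hmax
    refine ⟨p, q, ?_⟩
    rw [← dist_eq_norm]
    refine le_antisymm (Metric.diam_le_of_forall_dist_le dist_nonneg ?_)
      (dist_le_dataDiam hpq.1 hpq.2)
    rintro _ ⟨⟨k, rfl⟩, hk⟩ _ ⟨⟨k', rfl⟩, hk'⟩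
    exact hmax (k, k') ⟨hk, hk'⟩

theorem exists_projMedian_eq (hn : 0 < n) (X : Fin n → E D) (A : Set (E D)) (v : E D) :
    ∃ (b : Bool) (p q : Fin n), projMedian X A v =
      if b then (inner ℝ (X p) v + inner ℝ (X q) v) / 2 else 0 := by
  by_cases h : (pointsIn X A).val.map (fun z => (inner ℝ z v : ℝ)) = 0
  · exact ⟨false, ⟨0, hn⟩, ⟨0, hn⟩, by rw [projMedian, h, median_zero]; simp⟩
  · obtain ⟨a, ha, b, hb, hab⟩ := median_mem h
    obtain ⟨z, hz, rfl⟩ := Multiset.mem_map.1 ha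
    obtain ⟨z', hz', rfl⟩ := Multiset.mem_map.1 hb
    obtain ⟨⟨p, rfl⟩, -⟩ := mem_pointsIn.1 (show z ∈ pointsIn X A from hz)
    obtain ⟨⟨q, rfl⟩, -⟩ := mem_pointsIn.1 (show z' ∈ pointsIn X A from hz')
    exact ⟨true, p, q, by rw [projMedian, hab]; simp⟩

variable {X : Fin n → E D} {δ : ℝ} {ω : Seeds D}

/-- Codes are prolonged split by split: the threshold of a split involves the midpoint of the
projections of two sample points, the distance of two sample points, and the seed of the split. -/
theorem exists_code_of_mem_basicPart (hn : 0 < n) {c : Cell D} {t : Fin T} {l₀ : List (Step L T n)}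
    (h₀ : codeAddr l₀ = c.addr) (h₀' : codeRegion S X ω l₀ = c.carrier) {i : ℕ} {a : Cell D}
    (ha : a ∈ basicPart X c (trialSeeds ω c t) i) (hL : a.level ≤ L) :
    ∃ l : List (Step L T n), codeAddr l = a.addr ∧ codeRegion S X ω l = a.carrier := by
  induction i generalizing a with
  | zero =>
    simp only [basicPart, List.mem_singleton] at ha
    subst ha
    exact ⟨l₀, h₀, h₀'⟩
  | succ i ih =>
    have hlen := (addr_of_mem_basicPart ha).2
    rw [Cell.level] at hL
    obtain ⟨p, hp, hap⟩ := mem_basicPart_succ.1 ha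
    obtain ⟨hsuf, hplen⟩ := addr_of_mem_basicPart hp
    obtain ⟨l, hl, hl'⟩ := ih hp (by rw [Cell.level]; omega)
    have hdrop : p.addr.drop i = c.addr := by
      obtain ⟨u, hu⟩ := hsuf
      have : u.length = i := by
        have := congrArg List.length hu
        simp only [List.length_append] at this
        omega
      rw [← hu, ← this, List.drop_left]
    -- for a median split of the cell itself the noise is switched off by `q = q'`
    obtain ⟨b, p₁, p₂, q₁, q₂, hthr⟩ : ∃ (b : Bool) (p₁ p₂ q₁ q₂ : Fin n),
        threshold X c (trialSeeds ω c t) i p =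
          (if b then (inner ℝ (X p₁) (trialSeeds ω c t i).1 +
            inner ℝ (X p₂) (trialSeeds ω c t i).1) / 2 else 0) +
          (trialSeeds ω c t i).2 * (6 / √(D : ℝ)) * ‖X q₁ - X q₂‖ := by
      unfold threshold
      split_ifs with hodd
      · obtain ⟨b, p₁, p₂, h1⟩ := exists_projMedian_eq hn X c.carrier (trialSeeds ω c t i).1
        obtain ⟨q₁, q₂, h2⟩ := exists_dataDiam_eq_norm hn X c.carrier
        exact ⟨b, p₁, p₂, q₁, q₂, by rw [h1, h2]⟩
      · obtain ⟨b, p₁, p₂, h1⟩ := exists_projMedian_eq hn X p.carrier (trialSeeds ω c t i).1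
        exact ⟨b, p₁, p₂, ⟨0, hn⟩, ⟨0, hn⟩, by rw [h1]; simp⟩
    have hcode : ∀ side : Bool,
        let s : Step L T n := ((side, ⟨i, by omega⟩, t), (p₁, p₂), (q₁, q₂), b)
        codeAddr (s :: l) = side :: p.addr ∧ codeRegion S X ω (s :: l) =
          {x ∈ p.carrier | (¬ inner ℝ x (trialSeeds ω c t i).1 ≤
            threshold X c (trialSeeds ω c t) i p) ↔ side} := by
      intro side s
      refine ⟨by rw [codeAddr, List.map_cons, ← codeAddr, hl], ?_⟩
      rw [codeRegion, hl', hl, hthr]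
      simp only [s, codeThreshold, hdrop, trialSeeds]
    rcases mem_split.1 hap with rfl | rfl
    · obtain ⟨h1, h2⟩ := hcode false
      refine ⟨_, h1, h2.trans ?_⟩
      ext x; simp
    · obtain ⟨h1, h2⟩ := hcode true
      refine ⟨_, h1, h2.trans ?_⟩
      ext x; simp +contextual

theorem exists_code_of_mem_adaptivePart (hn : 0 < n) (hT : 0 < numTrials n δ) {i : ℕ} {a : Cell D}
    (ha : a ∈ adaptivePart S X δ ω i) (hL : a.level ≤ L) :
    ∃ l : List (Step L (numTrials n δ) n),
      codeAddr l = a.addr ∧ codeRegion S X ω l = a.carrier := by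
  induction i generalizing a with
  | zero =>
    simp only [adaptivePart, List.mem_singleton] at ha
    subst ha
    exact ⟨[], rfl, rfl⟩
  | succ i ih =>
    obtain ⟨c, hc, hac⟩ := mem_adaptivePart_succ.1 ha
    have hlen := (addr_of_mem_coreLeaves hac).2
    rw [Cell.level] at hL
    obtain ⟨l₀, h₀, h₀'⟩ := ih hc (by rw [Cell.level]; omega)
    exact exists_code_of_mem_basicPart hn (t := ⟨_, (bestTrial_spec hT).1⟩) h₀ h₀' hac hL

/-! ### All the cells are controlled -/

/-- A code of a region possibly deprived of a ball centred at a sample point and having a distance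
between sample points as its radius. -/
abbrev Code (L T n : ℕ) : Type := List (Step L T n) × Option (Fin n × Fin n × Fin n)

/-- The set with a given code. -/
def codeSet (S : Set (E D)) (X : Fin n → E D) (ω : Seeds D) : Code L T n → Set (E D)
  | (l, none) => codeRegion S X ω l
  | (l, some r) => codeRegion S X ω l \ Metric.closedBall (X r.1) ‖X r.2.1 - X r.2.2‖

/-- Indices of the sample points on which the set with a given code depends. -/
def codeSetIdx : Code L T n → Finset (Fin n)
  | (l, none) => codeIdx l
  | (l, some r) => {r.1, r.2.1, r.2.2} ∪ codeIdx l

theorem card_codeSetIdx_le (κ : Code L T n) : (codeSetIdx κ).card ≤ 4 * κ.1.length + 3 := by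
  rcases κ with ⟨l, _ | r⟩
  · exact (card_codeIdx_le l).trans (by simp)
  · have h1 := Finset.card_union_le {r.1, r.2.1, r.2.2} (codeIdx l)
    have h2 := Finset.card_le_three (a := r.1) (b := r.2.1) (c := r.2.2)
    have h3 := card_codeIdx_le l
    simp only [codeSetIdx]
    omega

theorem codeSet_congr {X X' : Fin n → E D} (ω : Seeds D) {κ : Code L T n}
    (h : ∀ i ∈ codeSetIdx κ, X i = X' i) : codeSet S X ω κ = codeSet S X' ω κ := by
  rcases κ with ⟨l, _ | r⟩
  · exact codeRegion_congr ω h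
  · simp only [codeSetIdx, Finset.mem_union, Finset.mem_insert, Finset.mem_singleton] at h
    simp only [codeSet, codeRegion_congr ω fun i hi => h i (Or.inr hi), h r.1 (by simp),
      h r.2.1 (by simp), h r.2.2 (by simp)]

theorem measurableSet_codeSet {Ω : Type*} [MeasurableSpace Ω] {X : Ω → Fin n → E D}
    {w : Ω → Seeds D} {x : Ω → E D} (hS : MeasurableSet S) (hX : Measurable X) (hw : Measurable w)
    (hx : Measurable x) (κ : Code L T n) :
    MeasurableSet {o | x o ∈ codeSet S (X o) (w o) κ} := by
  have hXi : ∀ i, Measurable fun o => X o i := fun i => (measurable_pi_apply i).comp hX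
  rcases κ with ⟨l, _ | r⟩
  · exact measurableSet_codeRegion hS hX hw hx l
  · exact (measurableSet_codeRegion hS hX hw hx l).diff
      (measurableSet_le (hx.dist (hXi _)) ((hXi _).sub (hXi _)).norm)

theorem exists_finset_lists (α : Type*) [Fintype α] (m : ℕ) (h : 2 ≤ Fintype.card α) :
    ∃ A : Finset (List α), A.card ≤ Fintype.card α ^ (m + 1) ∧
      ∀ l : List α, l.length ≤ m → l ∈ A := by
  classical
  refine ⟨(Finset.range (m + 1)).biUnion fun r =>
    Finset.univ.image fun g : Fin r → α => List.ofFn g, ?_, fun l hl => ?_⟩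
  · refine Finset.card_biUnion_le.trans ?_
    calc _ ≤ ∑ r ∈ Finset.range (m + 1), Fintype.card α ^ r := Finset.sum_le_sum fun r _ => by
            refine Finset.card_image_le.trans ?_
            simp
      _ ≤ _ := (Nat.geomSum_lt h fun r hr => Finset.mem_range.1 hr).le
  · refine Finset.mem_biUnion.2 ⟨l.length, Finset.mem_range.2 (by omega), Finset.mem_image.2
      ⟨fun i => l.get i, Finset.mem_univ _, ?_⟩⟩
    exact List.ofFn_get l

theorem exists_finset_codes (L : ℕ) {T n : ℕ} (hL : 0 < L) (hT : 0 < T) (hn : 0 < n) :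
    ∃ A : Finset (Code L T n), A.card ≤ (4 * L * T * n ^ 4) ^ (L + 1) * (n ^ 3 + 1) ∧
      ∀ κ : Code L T n, κ.1.length ≤ L → κ ∈ A := by
  have hcard : Fintype.card (Step L T n) = 4 * L * T * n ^ 4 := by
    simp only [Step, Fintype.card_prod, Fintype.card_fin, Fintype.card_bool]
    ring
  obtain ⟨A, hA, hmem⟩ := exists_finset_lists (Step L T n) L (by
    rw [hcard]
    have : 0 < L * T * n ^ 4 := by positivity
    nlinarith)
  refine ⟨A ×ˢ Finset.univ, ?_, fun κ hκ => Finset.mem_product.2 ⟨hmem _ hκ, Finset.mem_univ _⟩⟩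
  rw [Finset.card_product, Finset.card_univ]
  refine Nat.mul_le_mul (by rwa [hcard] at hA) (le_of_eq ?_)
  simp only [Fintype.card_option, Fintype.card_prod, Fintype.card_fin]
  ring

end Code

open Classical in
theorem measurableSet_controlled {Ω O H : Type*} [MeasurableSpace Ω] [MeasurableSpace O]
    {ρ : Measure Ω} [IsProbabilityMeasure ρ] {n : ℕ} [NormedAddCommGroup H] [MeasurableSpace H]
    [BorelSpace H] [SecondCountableTopology H] {ξ : Ω → H} (hξ : Measurable ξ) (B K : ℝ)
    {z : O → Fin n → Ω} (hz : Measurable z) {A : O → Set Ω}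
    (hA : MeasurableSet {q : O × Ω | q.2 ∈ A q.1}) :
    MeasurableSet {o | Controlled ρ ξ B K (z o) (A o)} := by
  have hzi : ∀ i, Measurable fun o => z o i := fun i => (measurable_pi_apply i).comp hz
  have hmem : ∀ i, MeasurableSet {o | z o i ∈ A o} := fun i =>
    hA.preimage (measurable_id.prodMk (hzi i))
  have h1 : Measurable fun o => ((Finset.univ.filter fun i => z o i ∈ A o).card : ℝ) := by
    simp only [Finset.card_filter, Nat.cast_sum]
    refine Finset.measurable_sum _ fun i _ => ?_
    simp only [Nat.cast_ite]
    exact Measurable.ite (hmem i) measurable_const measurable_const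
  have h2 : Measurable fun o => ∑ i ∈ Finset.univ.filter fun i => z o i ∈ A o, ξ (z o i) := by
    simp only [Finset.sum_filter]
    exact Finset.measurable_sum _ fun i _ =>
      Measurable.ite (hmem i) (hξ.comp (hzi i)) measurable_const
  have h3 : Measurable fun o => ρ.real (A o) := (measurable_measure_prodMk_left hA).ennreal_toReal
  exact (measurableSet_le (h3.const_mul _) ((h1.const_mul _).add_const _)).inter
    (measurableSet_le (h2.norm.pow_const 2) ((h1.const_mul _).const_mul _))

/-- The noise vector of an observation with respect to the regression function `g`. -/
def noise {D D' : ℕ} (g : E D → E D') (p : E D × E D') : E D' := p.2 - g p.1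

/-- All the sets with codes of length at most `L` are controlled. -/
def AllControlled {D D' n : ℕ} (ρ : Measure (E D × E D')) (S : Set (E D)) (g : E D → E D')
    (B K : ℝ) (L T : ℕ) (z : Fin n → E D × E D') (ω : Seeds D) : Prop :=
  ∀ κ : Code L T n, κ.1.length ≤ L → Controlled ρ (noise g) B K z
    (Prod.fst ⁻¹' codeSet S (fun i => (z i).1) ω κ)

/-- Union bound over the codes, for fixed seeds; `4 * L + 3` bounds the number of sample points on
which a set with a code of length at most `L` depends. -/
theorem measure_not_allControlled_le {D D' n L T : ℕ} {ρ : Measure (E D × E D')}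
    [IsProbabilityMeasure ρ] {S : Set (E D)} (hS : MeasurableSet S) {g : E D → E D'}
    (hg : Measurable g) {B : ℝ} (hB : 0 < B) (hgB : ∀ᵐ p ∂ρ, ‖noise g p‖ ≤ B)
    (hzero : ∀ A : Set (E D), MeasurableSet A → ∫ p in Prod.fst ⁻¹' A, noise g p ∂ρ = 0)
    (hL : 0 < L) (hT : 0 < T) (hn : 0 < n) {l : ℝ} (hl : 0 < l) :
    ((Measure.pi fun _ : Fin n => ρ).prod (seedsLaw D))
        {e | ¬ AllControlled ρ S g B (2 * l + (4 * L + 3)) L T e.1 e.2} ≤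
      ENNReal.ofReal (((4 * L * T * n ^ 4) ^ (L + 1) * (n ^ 3 + 1) : ℕ) *
        ((2 * n + 1) * Real.exp (-l))) := by
  have hnoise : Measurable (noise g) := measurable_snd.sub (hg.comp measurable_fst)
  obtain ⟨F, hF, hmem⟩ := exists_finset_codes L (T := T) (n := n) hL hT hn
  set bad : Code L T n → Set ((Fin n → E D × E D') × Seeds D) := fun κ =>
    {e | ¬ Controlled ρ (noise g) B (2 * l + (codeSetIdx κ).card) e.1
      (Prod.fst ⁻¹' codeSet S (fun i => (e.1 i).1) e.2 κ)} with hbad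
  have hsub : {e | ¬ AllControlled ρ S g B (2 * l + (4 * L + 3)) L T e.1 e.2} ⊆
      ⋃ κ ∈ F, bad κ := by
    intro e he
    simp only [Set.mem_ofPred_eq, AllControlled, not_forall] at he
    obtain ⟨κ, hκ, hc⟩ := he
    refine Set.mem_iUnion₂.2 ⟨κ, hmem κ hκ, fun h => hc ?_⟩
    have hle : 2 * l + ((codeSetIdx κ).card : ℝ) ≤ 2 * l + (4 * L + 3) := by
      have h1 : (codeSetIdx κ).card ≤ 4 * L + 3 := (card_codeSetIdx_le κ).trans (by omega)
      have h2 : ((codeSetIdx κ).card : ℝ) ≤ 4 * L + 3 := by exact_mod_cast h1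
      linarith
    refine ⟨h.1.trans (by linarith), h.2.trans ?_⟩
    gcongr
  have hfst : Measurable fun q : ((Fin n → E D × E D') × Seeds D) × (E D × E D') =>
      fun i => (q.1.1 i).1 :=
    measurable_pi_lambda _ fun i => ((measurable_pi_apply i).comp measurable_fst.fst).fst
  have hmeas : ∀ κ, MeasurableSet (bad κ) := fun κ =>
    (measurableSet_controlled hnoise B _ measurable_fst
      (measurableSet_codeSet hS hfst measurable_fst.snd measurable_snd.fst κ)).compl
  have hle : ∀ κ, ((Measure.pi fun _ : Fin n => ρ).prod (seedsLaw D)) (bad κ) ≤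
      ENNReal.ofReal ((2 * n + 1) * Real.exp (-l)) := by
    intro κ
    rw [Measure.prod_apply_symm (hmeas κ)]
    calc _ ≤ ∫⁻ _, ENNReal.ofReal ((2 * n + 1) * Real.exp (-l)) ∂(seedsLaw D) := by
          refine lintegral_mono fun ω => ?_
          have hX : Measurable fun q : (Fin n → E D × E D') × (E D × E D') =>
              fun i => (q.1 i).1 :=
            measurable_pi_lambda _ fun i => ((measurable_pi_apply i).comp measurable_fst).fst
          refine measure_not_controlled_le (I := codeSetIdx κ)
            (A := fun z => Prod.fst ⁻¹' codeSet S (fun i => (z i).1) ω κ) hnoise hB hgB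
            (measurableSet_codeSet hS hX measurable_const measurable_snd.fst κ)
            (fun z z' h => ?_) (fun z => hzero _ ?_) hl
          · exact congrArg _ (codeSet_congr ω fun i hi => by rw [h i hi])
          · exact measurableSet_codeSet hS measurable_const measurable_const measurable_id κ
      _ = _ := by simp
  calc _ ≤ ∑ κ ∈ F, ((Measure.pi fun _ : Fin n => ρ).prod (seedsLaw D)) (bad κ) :=
        (measure_mono hsub).trans (measure_biUnion_finset_le _ _)
    _ ≤ ∑ _κ ∈ F, ENNReal.ofReal ((2 * n + 1) * Real.exp (-l)) :=
        Finset.sum_le_sum fun κ _ => hle κ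
    _ = ENNReal.ofReal (F.card * ((2 * n + 1) * Real.exp (-l))) := by
        rw [Finset.sum_const, nsmul_eq_mul, ENNReal.ofReal_mul (p := (F.card : ℝ)) (by positivity),
          ENNReal.ofReal_natCast]
    _ ≤ _ := by
        refine ENNReal.ofReal_le_ofReal ?_
        gcongr

/-! ### The regression model -/

/-- A regression model in which the regression function `g` is measurable, takes its values in the
ball that contains the responses, and is Lipschitz on a set `S` of full measure. -/
structure MeasurableModel {D D' : ℕ} (ρ : Measure (E D × E D')) (S : Set (E D)) (g : E D → E D')
    (lam : ℝ) (cY : E D') (B : ℝ) : Prop where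
  measurableSet : MeasurableSet S
  measurable : Measurable g
  lipschitz : ∀ x ∈ S, ∀ y ∈ S, ‖g x - g y‖ ≤ lam * ‖x - y‖
  mem : ∀ᵐ p ∂ρ, p.1 ∈ S ∧ p.2 ∈ Metric.closedBall cY (B / 2)
  bounded : ∀ x, g x ∈ Metric.closedBall cY (B / 2)
  condExp : ρ[noise g | MeasurableSpace.comap (Prod.fst : E D × E D' → E D) inferInstance] =ᵐ[ρ] 0

theorem norm_sub_le_of_mem_closedBall {H : Type*} [NormedAddCommGroup H] {c x y : H} {B : ℝ}
    (hx : x ∈ Metric.closedBall c (B / 2)) (hy : y ∈ Metric.closedBall c (B / 2)) :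
    ‖x - y‖ ≤ B := by
  rw [← dist_eq_norm]
  have h1 := dist_triangle_right x y c
  rw [Metric.mem_closedBall] at hx hy
  linarith

theorem norm_le_of_mem_closedBall {H : Type*} [NormedAddCommGroup H] {c x : H} {B : ℝ}
    (hx : x ∈ Metric.closedBall c (B / 2)) : ‖x‖ ≤ ‖c‖ + B / 2 := by
  have h1 := norm_le_norm_add_norm_sub' x c
  rw [Metric.mem_closedBall, dist_eq_norm] at hx
  linarith

/-- The regression function of a regression model with Lipschitz regression function agrees with
that of a measurable model on a set of full measure. -/
theorem exists_measurableModel {D D' : ℕ} {ρ : Measure (E D × E D')} [IsProbabilityMeasure ρ]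
    {S : Set (E D)} {T : Set (E D')} {f : E D → E D'} {lam : NNReal} {cY : E D'} {B : ℝ} (hB : 0 < B)
    (hS : MeasurableSet S) (hT : T ⊆ Metric.closedBall cY (B / 2))
    (hf : IsRegressionModel ρ S T f) (hlip : LipschitzOnWith lam f S) :
    ∃ g S', S' ⊆ S ∧ (∀ x ∈ S', g x = f x) ∧ MeasurableModel ρ S' g lam cY B := by
  classical
  set K := Metric.closedBall cY (B / 2) with hK
  have hmle : MeasurableSpace.comap (Prod.fst : E D × E D' → E D) inferInstance ≤
      Prod.instMeasurableSpace := measurable_fst.comap_le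
  have hY : ∀ᵐ p ∂ρ, p.2 ∈ K := hf.mem.mono fun p hp => hT hp.2
  have hYi : Integrable (Prod.snd : E D × E D' → E D') ρ :=
    Integrable.of_bound measurable_snd.aestronglyMeasurable (‖cY‖ + B / 2)
      (hY.mono fun p hp => norm_le_of_mem_closedBall hp)
  have hfK : ∀ᵐ p ∂ρ, f p.1 ∈ K := by
    filter_upwards [hf.condExp, Convex.condExp_mem hmle hYi Metric.isClosed_closedBall
      (convex_closedBall cY (B / 2)) hY] with p hp hp'
    rw [hp]; exact hp'
  set S' := S ∩ f ⁻¹' K with hS'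
  have hS'm : MeasurableSet S' := by
    obtain ⟨u, hu, hu'⟩ := continuousOn_iff_isClosed.1 hlip.continuousOn K Metric.isClosed_closedBall
    rw [hS', Set.inter_comm, hu']
    exact hu.measurableSet.inter hS
  set g := S'.piecewise f fun _ => cY with hg
  have hgf : ∀ x ∈ S', g x = f x := fun x hx => Set.piecewise_eq_of_mem _ _ _ hx
  have hmem : ∀ᵐ p ∂ρ, p.1 ∈ S' ∧ p.2 ∈ K := by
    filter_upwards [hf.mem, hfK, hY] with p h1 h2 h3
    exact ⟨⟨h1.1, h2⟩, h3⟩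
  have hgm : Measurable g :=
    (hlip.continuousOn.mono Set.inter_subset_left).measurable_piecewise continuousOn_const hS'm
  have hgK : ∀ x, g x ∈ K := by
    intro x
    by_cases hx : x ∈ S'
    · rw [hgf x hx]; exact hx.2
    · rw [hg, Set.piecewise_eq_of_notMem _ _ _ hx]
      exact Metric.mem_closedBall_self (by positivity)
  refine ⟨g, S', Set.inter_subset_left, hgf, hS'm, hgm, ?_, hmem, hgK, ?_⟩
  · intro x hx y hy
    rw [hgf x hx, hgf y hy, ← dist_eq_norm, ← dist_eq_norm]
    exact hlip.dist_le_mul x hx.1 y hy.1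
  · have hgi : Integrable (fun p : E D × E D' => g p.1) ρ :=
      Integrable.of_bound (hgm.comp measurable_fst).aestronglyMeasurable (‖cY‖ + B / 2)
        (ae_of_all _ fun p => norm_le_of_mem_closedBall (hgK p.1))
    have h1 : ρ[noise g | MeasurableSpace.comap (Prod.fst : E D × E D' → E D) inferInstance] =ᵐ[ρ]
        ρ[(Prod.snd : E D × E D' → E D') |
          MeasurableSpace.comap (Prod.fst : E D × E D' → E D) inferInstance] -
        ρ[(fun p : E D × E D' => g p.1) |
          MeasurableSpace.comap (Prod.fst : E D × E D' → E D) inferInstance] :=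
      condExp_sub hYi hgi _
    have h2 : ρ[(fun p : E D × E D' => g p.1) |
        MeasurableSpace.comap (Prod.fst : E D × E D' → E D) inferInstance] = fun p => g p.1 :=
      condExp_of_stronglyMeasurable hmle
        (hgm.comp (comap_measurable Prod.fst)).stronglyMeasurable hgi
    filter_upwards [h1, hf.condExp, hmem] with p hp hp' hp''
    rw [hp, Pi.sub_apply, ← hp', h2]
    simp [hgf _ hp''.1]

namespace MeasurableModel

variable {D D' : ℕ} {ρ : Measure (E D × E D')} {S : Set (E D)}
  {g : E D → E D'} {lam : ℝ} {cY : E D'} {B : ℝ}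

theorem measurable_noise (hM : MeasurableModel ρ S g lam cY B) : Measurable (noise g) :=
  measurable_snd.sub (hM.measurable.comp measurable_fst)

theorem norm_noise_le (hM : MeasurableModel ρ S g lam cY B) : ∀ᵐ p ∂ρ, ‖noise g p‖ ≤ B :=
  hM.mem.mono fun _ hp => norm_sub_le_of_mem_closedBall hp.2 (hM.bounded _)

theorem integrable_noise [IsProbabilityMeasure ρ] (hM : MeasurableModel ρ S g lam cY B) :
    Integrable (noise g) ρ :=
  Integrable.of_bound hM.measurable_noise.aestronglyMeasurable B hM.norm_noise_le

theorem setIntegral_noise [IsProbabilityMeasure ρ] (hM : MeasurableModel ρ S g lam cY B)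
    {A : Set (E D)} (hA : MeasurableSet A) : ∫ p in Prod.fst ⁻¹' A, noise g p ∂ρ = 0 := by
  rw [← setIntegral_condExp measurable_fst.comap_le hM.integrable_noise ⟨A, hA, rfl⟩,
    setIntegral_congr_ae (measurable_fst hA) (hM.condExp.mono fun p hp _ => hp)]
  simp

theorem integral_inner_noise [IsProbabilityMeasure ρ] (hM : MeasurableModel ρ S g lam cY B)
    {φ : E D → E D'} (hφ : Measurable φ) {b : ℝ} (hb : ∀ x, ‖φ x‖ ≤ b) :
    ∫ p, inner ℝ (φ p.1) (noise g p) ∂ρ = 0 := by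
  have hm : MeasurableSpace.comap (Prod.fst : E D × E D' → E D) inferInstance ≤
      Prod.instMeasurableSpace := measurable_fst.comap_le
  have hint : Integrable (fun p => inner ℝ (φ p.1) (noise g p)) ρ := by
    refine Integrable.of_bound ((hφ.comp measurable_fst).inner
      hM.measurable_noise).aestronglyMeasurable (b * B) ?_
    filter_upwards [hM.norm_noise_le] with p hp
    refine (norm_inner_le_norm _ _).trans ?_
    gcongr
    · exact (norm_nonneg _).trans (hb p.1)
    · exact hb _
  have h1 := condExp_bilin_of_stronglyMeasurable_left
    (m := MeasurableSpace.comap (Prod.fst : E D × E D' → E D) inferInstance) (innerSL ℝ)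
    (f := fun p : E D × E D' => φ p.1) (g := noise g)
    (hφ.comp (comap_measurable Prod.fst)).stronglyMeasurable hint hM.integrable_noise
  rw [← integral_condExp hm]
  calc _ = ∫ _, (0 : ℝ) ∂ρ := by
        refine integral_congr_ae ?_
        filter_upwards [h1, hM.condExp] with p hp hp'
        refine hp.trans ?_
        rw [hp']
        simp
    _ = 0 := by simp

/-- The excess quadratic risk over the regression function is the squared distance to it. -/
theorem integral_sq_sub [IsProbabilityMeasure ρ] (hM : MeasurableModel ρ S g lam cY B)
    {h : E D → E D'} (hh : Measurable h) (hhB : ∀ x, h x ∈ Metric.closedBall cY (B / 2)) :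
    ∫ p, ‖p.2 - h p.1‖ ^ 2 ∂ρ = (∫ p, ‖noise g p‖ ^ 2 ∂ρ) + ∫ x, ‖h x - g x‖ ^ 2 ∂ρ.fst := by
  have hd : Measurable fun x => h x - g x := hh.sub hM.measurable
  have hdB : ∀ x, ‖h x - g x‖ ≤ B := fun x => norm_sub_le_of_mem_closedBall (hhB x) (hM.bounded x)
  have e1 : ∫ x, ‖h x - g x‖ ^ 2 ∂ρ.fst = ∫ p, ‖h p.1 - g p.1‖ ^ 2 ∂ρ := by
    rw [Measure.fst, integral_map measurable_fst.aemeasurable]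
    exact (hd.norm.pow_const 2).aestronglyMeasurable
  have i1 : Integrable (fun p => ‖noise g p‖ ^ 2) ρ := by
    refine Integrable.of_bound (hM.measurable_noise.norm.pow_const 2).aestronglyMeasurable (B ^ 2) ?_
    filter_upwards [hM.norm_noise_le] with p hp
    rw [Real.norm_of_nonneg (sq_nonneg _)]
    exact pow_le_pow_left₀ (norm_nonneg _) hp 2
  have i2 : Integrable (fun p : E D × E D' => ‖h p.1 - g p.1‖ ^ 2) ρ := by
    refine Integrable.of_bound ((hd.comp measurable_fst).norm.pow_const 2).aestronglyMeasurable
      (B ^ 2) (ae_of_all _ fun p => ?_)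
    rw [Real.norm_of_nonneg (sq_nonneg _)]
    exact pow_le_pow_left₀ (norm_nonneg _) (hdB p.1) 2
  have i3 : Integrable (fun p => inner ℝ (h p.1 - g p.1) (noise g p)) ρ := by
    refine Integrable.of_bound ((hd.comp measurable_fst).inner
      hM.measurable_noise).aestronglyMeasurable (B * B) ?_
    filter_upwards [hM.norm_noise_le] with p hp
    refine (norm_inner_le_norm _ _).trans ?_
    gcongr
    · exact (norm_nonneg _).trans (hdB p.1)
    · exact hdB _
  calc _ = ∫ p, (‖noise g p‖ ^ 2 - 2 * inner ℝ (h p.1 - g p.1) (noise g p) +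
        ‖h p.1 - g p.1‖ ^ 2) ∂ρ := by
        refine integral_congr_ae (ae_of_all _ fun p => ?_)
        dsimp only
        have : p.2 - h p.1 = noise g p - (h p.1 - g p.1) := by simp [noise]
        rw [this, norm_sub_sq_real, real_inner_comm]
    _ = _ := by
        have h0 : ∫ p, inner ℝ (h p.1 - g p.1) (noise g p) ∂ρ = 0 :=
          hM.integral_inner_noise hd hdB
        have i4 : Integrable (fun p => ‖noise g p‖ ^ 2 -
            2 * inner ℝ (h p.1 - g p.1) (noise g p)) ρ := i1.sub (i3.const_mul 2)
        rw [integral_add i4 i2, integral_sub i1 (i3.const_mul 2),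
          integral_const_mul, h0, e1]
        ring

theorem ae_fst_mem (hM : MeasurableModel ρ S g lam cY B) : ∀ᵐ x ∂ρ.fst, x ∈ S := by
  exact (ae_map_iff (p := fun x => x ∈ S) measurable_fst.aemeasurable hM.measurableSet).2
    (hM.mem.mono fun _ hp => hp.1)

end MeasurableModel

/-! ### Concentration for the test sample and for the root -/

section Concentration

variable {Ω : Type*} [MeasurableSpace Ω] {ρ : Measure Ω} [IsProbabilityMeasure ρ] {n : ℕ}

/-- Hoeffding's inequality for the coordinates of a product space. -/
theorem measure_pi_sum_ge {φ : Ω → ℝ} (hφ : Measurable φ) {a b : ℝ} (hab : a < b)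
    (hb : ∀ᵐ p ∂ρ, φ p ∈ Set.Icc a b) (hn : 0 < n) {ε : ℝ} (hε : 0 ≤ ε) :
    (Measure.pi fun _ : Fin n => ρ) {z | n * (∫ p, φ p ∂ρ) + n * ε ≤ ∑ i, φ (z i)} ≤
      ENNReal.ofReal (Real.exp (-(2 * n * ε ^ 2) / (b - a) ^ 2)) := by
  have hn' : (0 : ℝ) < n := by exact_mod_cast hn
  set m := ∫ p, φ p ∂ρ with hm
  have hind : iIndepFun (fun (i : Fin n) (z : Fin n → Ω) => φ (z i) - m)
      (Measure.pi fun _ : Fin n => ρ) :=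
    iIndepFun_pi (X := fun _ p => φ p - m) fun i => (hφ.sub_const m).aemeasurable
  have hsub : ∀ i ∈ Finset.univ, HasSubgaussianMGF (fun z : Fin n → Ω => φ (z i) - m)
      ((‖b - a‖₊ / 2) ^ 2) (Measure.pi fun _ : Fin n => ρ) := by
    intro i _
    have hmp := measurePreserving_eval (fun _ : Fin n => ρ) i
    have h := hasSubgaussianMGF_of_mem_Icc (μ := Measure.pi fun _ : Fin n => ρ)
      (X := fun z => φ (z i)) (hφ.comp (measurable_pi_apply i)).aemeasurable
      (hmp.quasiMeasurePreserving.ae hb)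
    have hmean : ∫ z, φ (z i) ∂(Measure.pi fun _ : Fin n => ρ) = m := by
      have := integral_map (μ := Measure.pi fun _ : Fin n => ρ) (φ := Function.eval i)
        (measurable_pi_apply i).aemeasurable (f := φ) hφ.aestronglyMeasurable
      rw [hmp.map_eq] at this
      exact this.symm
    rw [hmean] at h
    exact h
  have key := HasSubgaussianMGF.measure_sum_ge_le_of_iIndepFun hind hsub
    (ε := n * ε) (by positivity)
  have hset : {z : Fin n → Ω | n * m + n * ε ≤ ∑ i, φ (z i)} =
      {z | n * ε ≤ ∑ i ∈ Finset.univ, (φ (z i) - m)} := by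
    ext z
    simp only [Set.mem_ofPred_eq, Finset.sum_sub_distrib, Finset.sum_const, Finset.card_univ,
      Fintype.card_fin, nsmul_eq_mul]
    constructor <;> intro h <;> linarith
  rw [hset, ← ofReal_measureReal]
  refine ENNReal.ofReal_le_ofReal (key.trans (le_of_eq ?_))
  have : (0 : ℝ) < b - a := by linarith
  have hsum : ((∑ _i : Fin n, (‖b - a‖₊ / 2) ^ 2 : NNReal) : ℝ) = n * ((b - a) / 2) ^ 2 := by
    push_cast
    rw [Real.norm_of_nonneg this.le, Finset.sum_const, Finset.card_univ, Fintype.card_fin,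
      nsmul_eq_mul]
  rw [hsum]
  congr 1
  field_simp

/-- Exponential moment of one step of the random walk `x ↦ x + ζ`. -/
theorem integral_exp_sq_norm_add_le {H : Type*} [NormedAddCommGroup H] [InnerProductSpace ℝ H]
    [CompleteSpace H] [MeasurableSpace H] [BorelSpace H] [SecondCountableTopology H]
    {ζ : Ω → H} (hζ : Measurable ζ) {c : H} (hc : ∀ᵐ p ∂ρ, ‖ζ p - c‖ ≤ 1 / 2)
    (h0 : ∫ p, ζ p ∂ρ = 0) (x : H) {N : ℝ} (hN : 7 / 2 ≤ N) :
    ∫⁻ p, ENNReal.ofReal (Real.exp (‖x + ζ p‖ ^ 2 / N) / N) ∂ρ ≤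
      ENNReal.ofReal (Real.exp (‖x‖ ^ 2 / (N - 3 / 5)) / (N - 3 / 5)) := by
  set w := x + c with hw
  set u : Ω → ℝ := fun p => ‖x + ζ p‖ ^ 2 with hu
  have hum : Measurable u := (hζ.const_add x).norm.pow_const 2
  have hζb : ∀ᵐ p ∂ρ, ‖ζ p‖ ≤ ‖c‖ + 1 / 2 := hc.mono fun p hp => by
    have := norm_le_norm_add_norm_sub' (ζ p) c; linarith
  have hζi : Integrable ζ ρ := Integrable.of_bound hζ.aestronglyMeasurable _ hζb
  have hcn : ‖c‖ ≤ 1 / 2 := by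
    have h1 : ∫ p, (ζ p - c) ∂ρ = -c := by
      rw [integral_sub hζi (integrable_const _), h0]; simp
    rw [← norm_neg, ← h1]
    refine (norm_integral_le_of_norm_le_const hc).trans ?_
    simp
  have hub : ∀ᵐ p ∂ρ, u p ∈ Set.Icc (‖w‖ ^ 2 - ‖w‖) (‖w‖ ^ 2 + ‖w‖ + 1 / 4) := by
    filter_upwards [hc] with p hp
    have h1 : x + ζ p = w + (ζ p - c) := by rw [hw]; abel
    have h2 : u p = ‖w‖ ^ 2 + 2 * inner ℝ w (ζ p - c) + ‖ζ p - c‖ ^ 2 := by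
      simp only [hu]; rw [h1, norm_add_sq_real]
    have h3 := abs_le.1 (abs_real_inner_le_norm w (ζ p - c))
    have h4 : ‖w‖ * ‖ζ p - c‖ ≤ ‖w‖ * (1 / 2) := by gcongr
    have h5 : ‖ζ p - c‖ ^ 2 ≤ (1 / 2) ^ 2 := pow_le_pow_left₀ (norm_nonneg _) hp 2
    rw [h2]
    constructor <;> nlinarith [sq_nonneg ‖ζ p - c‖]
  have hui : Integrable u ρ := Integrable.of_mem_Icc _ _ hum.aemeasurable hub
  have hmean : ∫ p, u p ∂ρ ≤ ‖x‖ ^ 2 + 1 / 4 := by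
    have hle : ∀ᵐ p ∂ρ, u p ≤ ‖x‖ ^ 2 + 1 / 4 + 2 * inner ℝ (x + c) (ζ p) := by
      filter_upwards [hc] with p hp
      have h5 : ‖ζ p - c‖ ^ 2 ≤ (1 / 2) ^ 2 := pow_le_pow_left₀ (norm_nonneg _) hp 2
      rw [norm_sub_sq_real] at h5
      simp only [hu]
      rw [norm_add_sq_real, inner_add_left, real_inner_comm (ζ p) c]
      nlinarith [sq_nonneg ‖c‖]
    have hii := hζi.const_inner (𝕜 := ℝ) (x + c)
    calc _ ≤ ∫ p, (‖x‖ ^ 2 + 1 / 4 + 2 * inner ℝ (x + c) (ζ p)) ∂ρ :=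
          integral_mono_ae hui ((integrable_const _).add (hii.const_mul 2)) hle
      _ = ‖x‖ ^ 2 + 1 / 4 := by
          rw [integral_add (integrable_const _) (hii.const_mul 2), integral_const_mul,
            integral_inner hζi, h0]
          simp
  have hsub := hasSubgaussianMGF_of_mem_Icc hum.aemeasurable hub
  have hmgf := hsub.mgf_le N⁻¹
  have hN0 : 0 < N := by linarith
  have hN1 : 0 < N - 3 / 5 := by linarith
  have hexpi : Integrable (fun p => Real.exp (u p / N)) ρ := by
    have := integrable_exp_mul_of_mem_Icc (t := N⁻¹) hum.aemeasurable hub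
    refine this.congr (ae_of_all _ fun p => ?_)
    dsimp only
    rw [div_eq_inv_mul]
  have hlen : ((((‖(‖w‖ ^ 2 + ‖w‖ + 1 / 4) - (‖w‖ ^ 2 - ‖w‖)‖₊ / 2) ^ 2 : NNReal) : ℝ)) =
      (2 * ‖w‖ + 1 / 4) ^ 2 / 4 := by
    rw [NNReal.coe_pow, NNReal.coe_div, coe_nnnorm, NNReal.coe_ofNat,
      Real.norm_of_nonneg (by linarith [norm_nonneg w])]
    ring
  rw [hlen] at hmgf
  have hwn : ‖w‖ ≤ ‖x‖ + 1 / 2 := (norm_add_le _ _).trans (by linarith)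
  have hquad : (2 * ‖w‖ + 1 / 4) ^ 2 / 8 ≤ 3 / 5 * ‖x‖ ^ 2 + 6 / 5 := by
    have h1 : (2 * ‖w‖ + 1 / 4) ^ 2 ≤ (2 * (‖x‖ + 1 / 2) + 1 / 4) ^ 2 :=
      pow_le_pow_left₀ (by positivity) (by linarith) 2
    nlinarith [sq_nonneg (‖x‖ - 25 / 8)]
  have hmain : ∫ p, Real.exp (u p / N) ∂ρ ≤
      Real.exp (‖x‖ ^ 2 / (N - 3 / 5) + 3 / 5 / N) := by
    have e1 : ∫ p, Real.exp (u p / N) ∂ρ =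
        Real.exp (N⁻¹ * ∫ p, u p ∂ρ) * mgf (fun p => u p - ∫ p, u p ∂ρ) ρ N⁻¹ := by
      rw [mgf, ← integral_const_mul]
      refine integral_congr_ae (ae_of_all _ fun p => ?_)
      dsimp only
      rw [← Real.exp_add]; congr 1; ring
    rw [e1]
    calc _ ≤ Real.exp (N⁻¹ * (‖x‖ ^ 2 + 1 / 4)) *
          Real.exp ((2 * ‖w‖ + 1 / 4) ^ 2 / 4 * N⁻¹ ^ 2 / 2) := by
          gcongr
          exact mgf_nonneg
      _ ≤ _ := by
          rw [← Real.exp_add]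
          refine Real.exp_le_exp.2 ?_
          have h1 : N⁻¹ ≤ 2 / 7 := by
            rw [inv_le_comm₀ hN0 (by norm_num)]; linarith
          have h2 : 0 < N⁻¹ := inv_pos.2 hN0
          have h3 : (2 * ‖w‖ + 1 / 4) ^ 2 / 4 * N⁻¹ ^ 2 / 2 ≤
              (3 / 5 * ‖x‖ ^ 2 + 6 / 5) * N⁻¹ ^ 2 := by
            have := mul_le_mul_of_nonneg_right hquad (sq_nonneg N⁻¹)
            linarith
          have h4 : N⁻¹ + 3 / 5 * N⁻¹ ^ 2 ≤ 1 / (N - 3 / 5) := by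
            rw [le_div_iff₀ hN1]
            have h5 : N⁻¹ * N = 1 := inv_mul_cancel₀ hN0.ne'
            have : (N⁻¹ + 3 / 5 * N⁻¹ ^ 2) * (N - 3 / 5) = 1 - 9 / 25 * N⁻¹ ^ 2 := by
              linear_combination (1 + 3 / 5 * N⁻¹) * h5
            rw [this]
            nlinarith [sq_nonneg N⁻¹]
          have h6 : (N⁻¹ + 3 / 5 * N⁻¹ ^ 2) * ‖x‖ ^ 2 ≤ 1 / (N - 3 / 5) * ‖x‖ ^ 2 := by gcongr
          have h7 : N⁻¹ * (1 / 4) + 6 / 5 * N⁻¹ ^ 2 ≤ 3 / 5 / N := by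
            rw [div_eq_mul_inv (3 / 5 : ℝ) N]; nlinarith
          have h8 : ‖x‖ ^ 2 / (N - 3 / 5) = 1 / (N - 3 / 5) * ‖x‖ ^ 2 := by ring
          rw [h8]
          linarith
  have hfin : Real.exp (3 / 5 / N) / N ≤ 1 / (N - 3 / 5) := by
    rw [div_le_div_iff₀ hN0 hN1, one_mul]
    have h1 : (N - 3 / 5) / N ≤ Real.exp (-(3 / 5 / N)) := by
      have := Real.one_sub_le_exp_neg (3 / 5 / N)
      refine le_trans (le_of_eq ?_) this
      field_simp
    rw [div_le_iff₀ hN0] at h1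
    calc Real.exp (3 / 5 / N) * (N - 3 / 5) ≤
        Real.exp (3 / 5 / N) * (Real.exp (-(3 / 5 / N)) * N) := by gcongr
      _ = N := by rw [← mul_assoc, ← Real.exp_add]; simp
  rw [← ofReal_integral_eq_lintegral_ofReal (hexpi.div_const N)
    (ae_of_all _ fun p => by positivity), integral_div]
  refine ENNReal.ofReal_le_ofReal ?_
  calc _ ≤ Real.exp (‖x‖ ^ 2 / (N - 3 / 5) + 3 / 5 / N) / N := by gcongr
    _ = Real.exp (‖x‖ ^ 2 / (N - 3 / 5)) * (Real.exp (3 / 5 / N) / N) := by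
        rw [Real.exp_add]; ring
    _ ≤ Real.exp (‖x‖ ^ 2 / (N - 3 / 5)) * (1 / (N - 3 / 5)) := by gcongr
    _ = _ := by ring

/-- Exponential moment of the squared norm of a sum of independent centred vectors. -/
theorem lintegral_exp_sq_norm_sum_le {H : Type*} [NormedAddCommGroup H] [InnerProductSpace ℝ H]
    [CompleteSpace H] [MeasurableSpace H] [BorelSpace H] [SecondCountableTopology H]
    {ζ : Ω → H} (hζ : Measurable ζ) {c : H} (hc : ∀ᵐ p ∂ρ, ‖ζ p - c‖ ≤ 1 / 2)
    (h0 : ∫ p, ζ p ∂ρ = 0) (hn : 8 ≤ n) :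
    ∫⁻ z, ENNReal.ofReal (Real.exp (‖∑ i, ζ (z i)‖ ^ 2 / n)) ∂(Measure.pi fun _ : Fin n => ρ) ≤
      ENNReal.ofReal (5 / 2) := by
  have hn' : (8 : ℝ) ≤ n := by exact_mod_cast hn
  -- the value after revealing the coordinates in `R`
  -- (each step costs `3 / 5`, and `N ∅ = 2 n / 5` accounts for the constant `5 / 2`)
  set N : Finset (Fin n) → ℝ := fun R => n - 3 / 5 * (n - R.card) with hN
  set G : Finset (Fin n) → (Fin n → Ω) → ENNReal := fun R z =>
    ENNReal.ofReal (2 * n / 5) *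
      ENNReal.ofReal (Real.exp (‖∑ i ∈ R, ζ (z i)‖ ^ 2 / N R) / N R) with hG
  have hGm : ∀ R, Measurable (G R) := fun R =>
    ((((Finset.measurable_sum _ fun i _ => hζ.comp (measurable_pi_apply i)).norm.pow_const
      2).div_const _).exp.div_const _).ennreal_ofReal.const_mul _
  have key := lintegral_pi_le_one (ρ := ρ) (I := ∅) hGm (fun z => by
      have : N ∅ = 2 * n / 5 := by simp only [hN, Finset.card_empty, Nat.cast_zero]; ring
      simp only [hG, Finset.sum_empty, this]
      rw [← ENNReal.ofReal_mul (by positivity), ENNReal.ofReal_le_one]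
      simp
      field_simp
      simp) (fun R i hi _ z => by
      have hsum : ∀ p, ∑ j ∈ R, ζ (Function.update z i p j) = ∑ j ∈ R, ζ (z j) := fun p =>
        Finset.sum_congr rfl fun j hj => by
          rw [Function.update_of_ne (ne_of_mem_of_not_mem hj hi)]
      have hsum' : ∀ p, ∑ j ∈ insert i R, ζ (Function.update z i p j) = ∑ j ∈ R, ζ (z j) + ζ p := by
        intro p
        rw [Finset.sum_insert hi, hsum, Function.update_self, add_comm]
      have hNi : N R = N (insert i R) - 3 / 5 := by
        simp only [hN, Finset.card_insert_of_notMem hi]; push_cast; ring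
      have hNge : 7 / 2 ≤ N (insert i R) := by
        simp only [hN, Finset.card_insert_of_notMem hi]
        push_cast
        have : (0 : ℝ) ≤ R.card := by positivity
        linarith
      simp only [hG, hsum, hsum']
      rw [lintegral_const_mul _ ((((hζ.const_add _).norm.pow_const
        2).div_const _).exp.div_const _).ennreal_ofReal, lintegral_const, measure_univ, mul_one, hNi]
      gcongr
      exact integral_exp_sq_norm_add_le hζ hc h0 _ hNge) Finset.univ (Finset.disjoint_empty_right _)
  have hNu : N Finset.univ = n := by simp [hN]
  have hGu : ∀ z, G Finset.univ z = ENNReal.ofReal (2 / 5) *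
      ENNReal.ofReal (Real.exp (‖∑ i, ζ (z i)‖ ^ 2 / n)) := by
    intro z
    simp only [hG, hNu]
    rw [← ENNReal.ofReal_mul (by positivity), ← ENNReal.ofReal_mul (by positivity)]
    congr 1
    field_simp
  simp only [hGu] at key
  rw [lintegral_const_mul' _ _ ENNReal.ofReal_ne_top] at key
  calc _ = ENNReal.ofReal (5 / 2) * (ENNReal.ofReal (2 / 5) *
        ∫⁻ z, ENNReal.ofReal (Real.exp (‖∑ i, ζ (z i)‖ ^ 2 / n)) ∂(Measure.pi fun _ => ρ)) := by
        rw [← mul_assoc, ← ENNReal.ofReal_mul (by norm_num)]; norm_num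
    _ ≤ _ := mul_le_of_le_one_right' key

end Concentration

/-! ### The width of the confidence intervals for cross-validation -/

/-- Half of the additive term of the risk bound, relative to the squared diameter of the
responses. -/
def cvWidth (n : ℕ) (δ : ℝ) : ℝ :=
  √((Real.log (Real.logb 2 ((n : ℝ) ^ 6)) + Real.log (3 / δ)) / (2 * n))

section Width

variable {n : ℕ} {δ : ℝ}

theorem cvWidth_nonneg : 0 ≤ cvWidth n δ := Real.sqrt_nonneg _

theorem one_le_logb (hn : 2 ≤ n) : 1 ≤ Real.logb 2 n := by
  have hn' : (2 : ℝ) ≤ n := by exact_mod_cast hn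
  rw [Real.le_logb_iff_rpow_le (by norm_num) (by linarith)]
  simpa using hn'

theorem exp_cvWidth (hn : 2 ≤ n) (hδ : 0 < δ) (hδ1 : δ < 1) :
    Real.exp (-(2 * n * cvWidth n δ ^ 2)) = δ / (18 * Real.logb 2 n) := by
  have hn' : (0 : ℝ) < n := by positivity
  have hl := one_le_logb hn
  have e1 : Real.logb 2 ((n : ℝ) ^ 6) = 6 * Real.logb 2 n := by
    rw [Real.logb_pow]; norm_num
  have h1 : 0 ≤ Real.log (Real.logb 2 ((n : ℝ) ^ 6)) := Real.log_nonneg (by rw [e1]; linarith)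
  have h2 : 0 ≤ Real.log (3 / δ) := Real.log_nonneg (by rw [le_div_iff₀ hδ]; linarith)
  rw [cvWidth, Real.sq_sqrt (by positivity), mul_div_cancel₀ _ (by positivity), e1, neg_add,
    Real.exp_add, Real.exp_neg, Real.exp_neg, Real.exp_log (by linarith),
    Real.exp_log (by positivity)]
  field_simp
  norm_num

/-- The additive term of the risk bound is nontrivial only for samples that are not tiny. -/
theorem eight_le_of_cvWidth_lt (hn : 2 ≤ n) (hδ : 0 < δ) (hδ1 : δ < 1)
    (hs : cvWidth n δ < 1 / 2) : 8 ≤ n := by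
  have hn' : (0 : ℝ) < n := by positivity
  have hl := one_le_logb hn
  have h1 : Real.exp (-(n / 2)) < δ / (18 * Real.logb 2 n) := by
    rw [← exp_cvWidth hn hδ hδ1]
    refine Real.exp_lt_exp.2 ?_
    have : cvWidth n δ ^ 2 < (1 / 2) ^ 2 := pow_lt_pow_left₀ hs cvWidth_nonneg (by norm_num)
    nlinarith
  have h2 : 18 * Real.logb 2 n < Real.exp (n / 2) := by
    rw [Real.exp_neg, lt_div_iff₀ (by positivity), inv_mul_lt_iff₀ (Real.exp_pos _)] at h1
    nlinarith [Real.exp_pos ((n : ℝ) / 2)]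
  by_contra! hlt
  have h7 : (n : ℝ) ≤ 7 := by exact_mod_cast (by omega : n ≤ 7)
  have he : Real.exp (1 / 2) < 1.65 := by
    have h3 : Real.exp (1 / 2) ^ 2 = Real.exp 1 := by rw [← Real.exp_nat_mul]; norm_num
    have h4 := Real.exp_one_lt_d9
    by_contra! hcon
    nlinarith
  rcases le_or_gt n 5 with h5 | h5
  · have h6 : (n : ℝ) ≤ 5 := by exact_mod_cast h5
    have h8 : Real.exp (n / 2) ≤ 1.65 ^ 5 := by
      calc Real.exp (n / 2) ≤ Real.exp ((5 : ℕ) * (1 / 2)) :=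
            Real.exp_le_exp.2 (by push_cast; linarith)
        _ = Real.exp (1 / 2) ^ 5 := Real.exp_nat_mul _ _
        _ ≤ _ := pow_le_pow_left₀ (Real.exp_pos _).le he.le 5
    norm_num at h8
    linarith
  · have h6 : (2 : ℝ) ≤ Real.logb 2 n := by
      have : (6 : ℝ) ≤ n := by exact_mod_cast h5
      rw [Real.le_logb_iff_rpow_le (by norm_num) (by linarith)]
      norm_num
      linarith
    have h8 : Real.exp (n / 2) ≤ 1.65 ^ 7 := by
      calc Real.exp (n / 2) ≤ Real.exp ((7 : ℕ) * (1 / 2)) :=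
            Real.exp_le_exp.2 (by push_cast; linarith)
        _ = Real.exp (1 / 2) ^ 7 := Real.exp_nat_mul _ _
        _ ≤ _ := pow_le_pow_left₀ (Real.exp_pos _).le he.le 7
    norm_num at h8
    linarith

theorem three_le_logb (hn : 8 ≤ n) : 3 ≤ Real.logb 2 n := by
  have hn' : (8 : ℝ) ≤ n := by exact_mod_cast hn
  rw [Real.le_logb_iff_rpow_le (by norm_num) (by linarith)]
  norm_num
  exact_mod_cast hn

theorem ceil_logb_sq_le (hn : 2 ≤ n) :
    (⌈Real.logb 2 ((n : ℝ) ^ 2)⌉₊ : ℝ) ≤ 2 * Real.logb 2 n + 1 := by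
  have hl := one_le_logb hn
  have e1 : Real.logb 2 ((n : ℝ) ^ 2) = 2 * Real.logb 2 n := by
    rw [Real.logb_pow]; norm_num
  rw [e1]
  exact (Nat.ceil_lt_add_one (by linarith)).le

end Width

/-! ### Events of the experiment -/

section Experiment

variable {D D' n : ℕ} {ρ : Measure (E D × E D')} [IsProbabilityMeasure ρ]

instance : IsProbabilityMeasure (experiment ρ n) := by unfold experiment; infer_instance

/-- An event that is unlikely over the test sample for almost every training sample and all the
seeds. -/
theorem experiment_le_lintegral {A : Set ((Fin n → E D × E D') × (Fin n → E D × E D') × Seeds D)}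
    (hA : MeasurableSet A) {c : (Fin n → E D × E D') → ENNReal}
    (hc : ∀ᵐ z ∂(Measure.pi fun _ : Fin n => ρ), ∀ ω,
      (Measure.pi fun _ : Fin n => ρ) {z' | (z, z', ω) ∈ A} ≤ c z) :
    experiment ρ n A ≤ ∫⁻ z, c z ∂(Measure.pi fun _ : Fin n => ρ) := by
  rw [experiment, Measure.prod_apply hA]
  refine lintegral_mono_ae (hc.mono fun z hz => ?_)
  rw [Measure.prod_apply_symm (measurable_prodMk_left hA)]
  calc _ ≤ ∫⁻ _, c z ∂(seedsLaw D) := lintegral_mono fun ω => hz ω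
    _ = c z := by simp

/-- The training sample and the seeds. -/
theorem measurePreserving_train :
    MeasurePreserving (fun e : (Fin n → E D × E D') × (Fin n → E D × E D') × Seeds D =>
      (e.1, e.2.2)) (experiment ρ n) ((Measure.pi fun _ : Fin n => ρ).prod (seedsLaw D)) :=
  (MeasurePreserving.id _).prod measurePreserving_snd

theorem experiment_train_le (A : Set ((Fin n → E D × E D') × Seeds D)) :
    experiment ρ n {e | (e.1, e.2.2) ∈ A} ≤
      ((Measure.pi fun _ : Fin n => ρ).prod (seedsLaw D)) A := by
  rw [← measurePreserving_train.map_eq]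
  exact Measure.le_map_apply (measurePreserving_train (ρ := ρ)).measurable.aemeasurable A

theorem ae_experiment_train {P : E D × E D' → Prop} (h : ∀ᵐ p ∂ρ, P p) :
    ∀ᵐ e ∂(experiment ρ n), ∀ i, P (e.1 i) :=
  Measure.quasiMeasurePreserving_fst.ae
    (p := fun z : Fin n → E D × E D' => ∀ i, P (z i)) (ae_all_iff.2 fun i =>
      (measurePreserving_eval (fun _ : Fin n => ρ) i).quasiMeasurePreserving.ae h)

end Experiment

/-! ### Risks of the candidates -/

section Risk

variable {D D' n : ℕ} {ρ : Measure (E D × E D')} [IsProbabilityMeasure ρ] {S : Set (E D)}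
  {y₀ : E D'} {δ : ℝ} {cY : E D'} {B : ℝ}

/-- Empirical risk of the candidate number `j` over the test sample. -/
def candEmp (S : Set (E D)) (y₀ : E D') (δ : ℝ) (j : ℕ) (z z' : Fin n → E D × E D')
    (ω : Seeds D) : ℝ :=
  empRisk (fun l => (z' l).1) (fun l => (z' l).2) (candidate S y₀ δ z ω j)

/-- Quadratic risk of the candidate number `j`. -/
def candRisk (ρ : Measure (E D × E D')) (S : Set (E D)) (y₀ : E D') (δ : ℝ) (j : ℕ)
    (z : Fin n → E D × E D') (ω : Seeds D) : ℝ :=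
  ∫ p, ‖p.2 - candidate S y₀ δ z ω j p.1‖ ^ 2 ∂ρ

theorem measurable_candEmp (hS : MeasurableSet S) (j : ℕ) :
    Measurable fun e : (Fin n → E D × E D') × (Fin n → E D × E D') × Seeds D =>
      candEmp S y₀ δ j e.1 e.2.1 e.2.2 := by
  have hz : ∀ i, Measurable fun e : (Fin n → E D × E D') × (Fin n → E D × E D') × Seeds D =>
      e.2.1 i := fun i => (measurable_pi_apply i).comp measurable_snd.fst
  unfold candEmp empRisk
  refine (Finset.measurable_sum _ fun i _ => ?_).const_mul _
  exact ((hz i).snd.sub (measurable_candidate hS y₀ measurable_fst (hz i).fst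
    measurable_snd.snd j)).norm.pow_const 2

theorem measurable_candRisk (hS : MeasurableSet S) (j : ℕ) :
    Measurable fun e : (Fin n → E D × E D') × (Fin n → E D × E D') × Seeds D =>
      candRisk ρ S y₀ δ j e.1 e.2.2 := by
  have h : Measurable fun q : ((Fin n → E D × E D') × (Fin n → E D × E D') × Seeds D) ×
      (E D × E D') => ‖q.2.2 - candidate S y₀ δ q.1.1 q.1.2.2 j q.2.1‖ ^ 2 :=
    (measurable_snd.snd.sub (measurable_candidate hS y₀ measurable_fst.fst measurable_snd.fst
      measurable_fst.snd.snd j)).norm.pow_const 2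
  exact (h.stronglyMeasurable.integral_prod_right (ν := ρ)).measurable

theorem measurable_candidate_right (hS : MeasurableSet S) (z : Fin n → E D × E D') (ω : Seeds D)
    (j : ℕ) : Measurable (candidate S y₀ δ z ω j) :=
  measurable_candidate hS y₀ measurable_const measurable_id measurable_const j

theorem ae_sq_loss_mem {ρ : Measure (E D × E D')} {h : E D → E D'}
    (hY : ∀ᵐ p ∂ρ, p.2 ∈ Metric.closedBall cY (B / 2))
    (hh : ∀ x, h x ∈ Metric.closedBall cY (B / 2)) :
    ∀ᵐ p ∂ρ, ‖p.2 - h p.1‖ ^ 2 ∈ Set.Icc 0 (B ^ 2) :=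
  hY.mono fun p hp => ⟨sq_nonneg _,
    pow_le_pow_left₀ (norm_nonneg _) (norm_sub_le_of_mem_closedBall hp (hh p.1)) 2⟩

/-- The empirical risk of a fixed regressor is close to its risk. -/
theorem measure_pi_abs_empRisk_sub_ge (hB : 0 < B)
    (hY : ∀ᵐ p ∂ρ, p.2 ∈ Metric.closedBall cY (B / 2)) {h : E D → E D'} (hhm : Measurable h)
    (hhb : ∀ x, h x ∈ Metric.closedBall cY (B / 2)) (hn : 2 ≤ n) (hδ : 0 < δ) (hδ1 : δ < 1) :
    (Measure.pi fun _ : Fin n => ρ) {z' | cvWidth n δ * B ^ 2 ≤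
      |empRisk (fun l => (z' l).1) (fun l => (z' l).2) h - ∫ p, ‖p.2 - h p.1‖ ^ 2 ∂ρ|} ≤
    ENNReal.ofReal (2 * (δ / (18 * Real.logb 2 n))) := by
  have hn' : (0 : ℝ) < n := by positivity
  obtain ⟨s, hs⟩ : ∃ s, s = cvWidth n δ := ⟨_, rfl⟩
  have hs0 : 0 ≤ s := hs ▸ cvWidth_nonneg
  rw [← hs]
  set φ : E D × E D' → ℝ := fun p => ‖p.2 - h p.1‖ ^ 2 with hφ
  have hφm : Measurable φ :=
    (measurable_snd.sub (hhm.comp measurable_fst)).norm.pow_const 2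
  have hφb : ∀ᵐ p ∂ρ, φ p ∈ Set.Icc 0 (B ^ 2) := ae_sq_loss_mem hY hhb
  have hφb' : ∀ᵐ p ∂ρ, -φ p ∈ Set.Icc (-B ^ 2) 0 := hφb.mono fun p hp =>
    ⟨by linarith [hp.2], by linarith [hp.1]⟩
  have h1 := measure_pi_sum_ge hφm (by positivity) hφb (n := n) (by omega)
    (ε := s * B ^ 2) (by positivity)
  have h2 := measure_pi_sum_ge hφm.neg (by have := sq_pos_of_pos hB; linarith) hφb'
    (n := n) (by omega) (ε := s * B ^ 2) (by positivity)
  have e1 : -(2 * n * (s * B ^ 2) ^ 2) / (B ^ 2 - 0) ^ 2 = -(2 * n * s ^ 2) := by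
    field_simp
    ring
  have e2 : -(2 * n * (s * B ^ 2) ^ 2) / (0 - -B ^ 2) ^ 2 = -(2 * n * s ^ 2) := by
    rw [← e1]; ring
  rw [e1, hs, exp_cvWidth hn hδ hδ1] at h1
  rw [e2, hs, exp_cvWidth hn hδ hδ1] at h2
  rw [← hs] at h1 h2
  have hl := one_le_logb hn
  rw [two_mul, ENNReal.ofReal_add (by positivity) (by positivity)]
  refine (measure_mono ?_).trans ((measure_union_le _ _).trans (add_le_add h1 h2))
  intro z' hz'
  have hz'' : s * B ^ 2 ≤ |1 / (n : ℝ) * ∑ i, φ (z' i) - ∫ p, φ p ∂ρ| := hz'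
  have e3 : ∑ i, φ (z' i) = n * (1 / (n : ℝ) * ∑ i, φ (z' i)) := by field_simp
  rcases le_abs.1 hz'' with h3 | h3
  · left
    simp only [Set.mem_ofPred_eq]
    rw [e3, ← mul_add]
    gcongr
    linarith
  · right
    simp only [Set.mem_ofPred_eq, Pi.neg_apply, Finset.sum_neg_distrib, integral_neg]
    rw [e3, ← mul_add, ← mul_neg]
    gcongr
    linarith

/-- The empirical risks of all the candidates are close to their risks. -/
theorem experiment_exists_abs_candEmp_sub_gt (hS : MeasurableSet S) (hB : 0 < B)
    (hy₀ : y₀ ∈ Metric.closedBall cY (B / 2))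
    (hY : ∀ᵐ p ∂ρ, p.2 ∈ Metric.closedBall cY (B / 2)) (hn : 2 ≤ n) (hδ : 0 < δ) (hδ1 : δ < 1)
    (hs : cvWidth n δ < 1 / 2) :
    experiment ρ n {e | ¬ ∀ j ≤ ⌈Real.logb 2 ((n : ℝ) ^ 2)⌉₊,
      |candEmp S y₀ δ j e.1 e.2.1 e.2.2 - candRisk ρ S y₀ δ j e.1 e.2.2| ≤
        cvWidth n δ * B ^ 2} ≤ ENNReal.ofReal (δ / 3) := by
  have h8 := eight_le_of_cvWidth_lt hn hδ hδ1 hs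
  have hl := three_le_logb h8
  have hn' : (0 : ℝ) < n := by positivity
  set s := cvWidth n δ with hsdef
  have hs0 : 0 ≤ s := cvWidth_nonneg
  set M := ⌈Real.logb 2 ((n : ℝ) ^ 2)⌉₊ with hM
  set bad : ℕ → Set ((Fin n → E D × E D') × (Fin n → E D × E D') × Seeds D) := fun j =>
    {e | s * B ^ 2 ≤ |candEmp S y₀ δ j e.1 e.2.1 e.2.2 - candRisk ρ S y₀ δ j e.1 e.2.2|} with hbad
  have hbm : ∀ j, MeasurableSet (bad j) := fun j => by
    have h2 : Measurable fun e : (Fin n → E D × E D') × (Fin n → E D × E D') × Seeds D =>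
        |candEmp S y₀ δ j e.1 e.2.1 e.2.2 - candRisk ρ S y₀ δ j e.1 e.2.2| :=
      ((measurable_candEmp hS j).sub (measurable_candRisk hS j)).abs
    exact measurableSet_le measurable_const h2
  have hle : ∀ j, experiment ρ n (bad j) ≤ ENNReal.ofReal (2 * (δ / (18 * Real.logb 2 n))) := by
    intro j
    calc _ ≤ ∫⁻ _, ENNReal.ofReal (2 * (δ / (18 * Real.logb 2 n)))
          ∂(Measure.pi fun _ : Fin n => ρ) := by
          refine experiment_le_lintegral (hbm j) ?_
          have hgood : ∀ᵐ z ∂(Measure.pi fun _ : Fin n => ρ), ∀ i,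
              (z i).2 ∈ Metric.closedBall cY (B / 2) := ae_all_iff.2 fun i =>
            (measurePreserving_eval (fun _ : Fin n => ρ) i).quasiMeasurePreserving.ae hY
          filter_upwards [hgood] with z hz ω
          have hhb : ∀ x, candidate S y₀ δ z ω j x ∈ Metric.closedBall cY (B / 2) :=
            candidate_mem (convex_closedBall _ _) hy₀ hz j
          have h1 := measure_pi_abs_empRisk_sub_ge hB hY
            (measurable_candidate_right (y₀ := y₀) (δ := δ) hS z ω j) hhb hn hδ hδ1
          exact (measure_mono fun z' hz' => hz').trans h1
      _ = _ := by simp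
  have hsub : {e : (Fin n → E D × E D') × (Fin n → E D × E D') × Seeds D | ¬ ∀ j ≤ M,
      |candEmp S y₀ δ j e.1 e.2.1 e.2.2 - candRisk ρ S y₀ δ j e.1 e.2.2| ≤ s * B ^ 2} ⊆
      ⋃ j ∈ Finset.range (M + 1), bad j := by
    intro e he
    simp only [Set.mem_ofPred_eq, not_forall, not_le] at he
    obtain ⟨j, hj, hlt⟩ := he
    exact Set.mem_iUnion₂.2 ⟨j, Finset.mem_range.2 (by omega), hlt.le⟩
  calc _ ≤ ∑ j ∈ Finset.range (M + 1), experiment ρ n (bad j) :=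
        (measure_mono hsub).trans (measure_biUnion_finset_le _ _)
    _ ≤ ∑ _j ∈ Finset.range (M + 1), ENNReal.ofReal (2 * (δ / (18 * Real.logb 2 n))) :=
        Finset.sum_le_sum fun j _ => hle j
    _ = ENNReal.ofReal ((M + 1 : ℕ) * (2 * (δ / (18 * Real.logb 2 n)))) := by
        rw [Finset.sum_const, Finset.card_range, nsmul_eq_mul,
          ENNReal.ofReal_mul (p := ((M + 1 : ℕ) : ℝ)) (by positivity), ENNReal.ofReal_natCast]
    _ ≤ _ := by
        refine ENNReal.ofReal_le_ofReal ?_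
        have hMle : (M : ℝ) ≤ 2 * Real.logb 2 n + 1 := ceil_logb_sq_le hn
        push_cast
        have e4 : ((M : ℝ) + 1) * (2 * (δ / (18 * Real.logb 2 n))) =
            (2 * (M + 1)) / (18 * Real.logb 2 n) * δ := by field_simp
        have h4 : (2 * ((M : ℝ) + 1)) / (18 * Real.logb 2 n) ≤ 1 / 3 := by
          rw [div_le_iff₀ (by positivity)]; linarith
        rw [e4]
        calc _ ≤ 1 / 3 * δ := by gcongr
          _ = _ := by ring

/-- Normalised deviation of a response from its mean. -/
def centred (ρ : Measure (E D × E D')) (B : ℝ) (p : E D × E D') : E D' :=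
  B⁻¹ • (p.2 - ∫ q, q.2 ∂ρ)

/-- Squared norm of the normalised deviation of the mean response of the sample. -/
def meanDev (ρ : Measure (E D × E D')) (B : ℝ) (z : Fin n → E D × E D') : ℝ :=
  ‖∑ i, centred ρ B (z i)‖ ^ 2 / n ^ 2

theorem meanDev_nonneg {ρ : Measure (E D × E D')} (z : Fin n → E D × E D') : 0 ≤ meanDev ρ B z := by
  unfold meanDev; positivity

theorem measurable_centred {ρ : Measure (E D × E D')} : Measurable (centred ρ B) :=
  (measurable_snd.sub_const _).const_smul B⁻¹

theorem measurable_meanDev {ρ : Measure (E D × E D')} : Measurable (meanDev (n := n) ρ B) :=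
  ((Finset.measurable_sum _ fun i _ =>
    measurable_centred.comp (measurable_pi_apply i)).norm.pow_const 2).div_const _

theorem lintegral_exp_meanDev_le (hB : 0 < B) (hY : ∀ᵐ p ∂ρ, p.2 ∈ Metric.closedBall cY (B / 2))
    (hn : 8 ≤ n) :
    ∫⁻ z, ENNReal.ofReal (Real.exp (n * meanDev ρ B z)) ∂(Measure.pi fun _ : Fin n => ρ) ≤
      ENNReal.ofReal (5 / 2) := by
  have hYi : Integrable (fun p : E D × E D' => p.2) ρ :=
    Integrable.of_bound measurable_snd.aestronglyMeasurable (‖cY‖ + B / 2)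
      (hY.mono fun p hp => norm_le_of_mem_closedBall hp)
  have h := lintegral_exp_sq_norm_sum_le (ρ := ρ) (n := n) (ζ := centred ρ B)
    (c := B⁻¹ • (cY - ∫ q, q.2 ∂ρ)) measurable_centred (by
      filter_upwards [hY] with p hp
      rw [centred, ← smul_sub, norm_smul, Real.norm_of_nonneg (by positivity),
        sub_sub_sub_cancel_right]
      rw [Metric.mem_closedBall, dist_eq_norm] at hp
      calc B⁻¹ * ‖p.2 - cY‖ ≤ B⁻¹ * (B / 2) := by gcongr
        _ = 1 / 2 := by field_simp) (by
      unfold centred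
      rw [integral_smul, integral_sub hYi (integrable_const _)]
      simp) hn
  refine le_trans (le_of_eq ?_) h
  refine lintegral_congr fun z => ?_
  have hn' : (n : ℝ) ≠ 0 := by positivity
  rw [meanDev]
  congr 2
  field_simp

/-- A regressor `h'` that is worse than `h` is unlikely to have the smaller empirical risk. -/
theorem measure_pi_empRisk_le (hB : 0 < B)
    (hY : ∀ᵐ p ∂ρ, p.2 ∈ Metric.closedBall cY (B / 2)) {h h' : E D → E D'} (hhm : Measurable h)
    (hhb : ∀ x, h x ∈ Metric.closedBall cY (B / 2)) (hhm' : Measurable h')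
    (hhb' : ∀ x, h' x ∈ Metric.closedBall cY (B / 2)) (hn : 0 < n) {m : ℝ} (hm0 : 0 < m)
    (hm : (∫ p, ‖p.2 - h' p.1‖ ^ 2 ∂ρ) - ∫ p, ‖p.2 - h p.1‖ ^ 2 ∂ρ = B ^ 2 * m) :
    (Measure.pi fun _ : Fin n => ρ) {z' |
      empRisk (fun l => (z' l).1) (fun l => (z' l).2) h' ≤
        empRisk (fun l => (z' l).1) (fun l => (z' l).2) h} ≤
    ENNReal.ofReal (Real.exp (-(n * m ^ 2 / 2))) := by
  have hn' : (0 : ℝ) < n := by positivity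
  have hm2 : ∀ {h : E D → E D'}, Measurable h →
      Measurable fun p : E D × E D' => ‖p.2 - h p.1‖ ^ 2 := fun hh =>
    (measurable_snd.sub (hh.comp measurable_fst)).norm.pow_const 2
  have hφb := ae_sq_loss_mem hY hhb
  have hφb' := ae_sq_loss_mem hY hhb'
  have hψb : ∀ᵐ p ∂ρ, ‖p.2 - h p.1‖ ^ 2 - ‖p.2 - h' p.1‖ ^ 2 ∈ Set.Icc (-B ^ 2) (B ^ 2) := by
    filter_upwards [hφb, hφb'] with p h0 h1
    exact ⟨by linarith [h0.1, h1.2], by linarith [h0.2, h1.1]⟩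
  have h1 := measure_pi_sum_ge ((hm2 hhm).sub (hm2 hhm'))
    (by have := sq_pos_of_pos hB; linarith) hψb (n := n) hn (ε := B ^ 2 * m) (by positivity)
  have hmean : ∫ p, (‖p.2 - h p.1‖ ^ 2 - ‖p.2 - h' p.1‖ ^ 2) ∂ρ = -(B ^ 2 * m) := by
    rw [integral_sub (Integrable.of_mem_Icc _ _ (hm2 hhm).aemeasurable hφb)
      (Integrable.of_mem_Icc _ _ (hm2 hhm').aemeasurable hφb'), ← hm]
    ring
  have e1 : -(2 * n * (B ^ 2 * m) ^ 2) / (B ^ 2 - -B ^ 2) ^ 2 = -(n * m ^ 2 / 2) := by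
    field_simp
    ring
  rw [← e1]
  refine (measure_mono ?_).trans h1
  intro z' hz'
  simp only [Set.mem_ofPred_eq, Pi.sub_apply]
  rw [hmean, Finset.sum_sub_distrib]
  have h3 : 1 / (n : ℝ) * ∑ i, ‖(z' i).2 - h' (z' i).1‖ ^ 2 ≤
    1 / (n : ℝ) * ∑ i, ‖(z' i).2 - h (z' i).1‖ ^ 2 := hz'
  have h4 := le_of_mul_le_mul_left h3 (by positivity)
  linarith

/-- Candidates that beat the root of the tree on the test sample are not much worse than the
root. -/
theorem experiment_exists_beats_root (hS : MeasurableSet S) (hB : 0 < B)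
    (hy₀ : y₀ ∈ Metric.closedBall cY (B / 2))
    (hY : ∀ᵐ p ∂ρ, p.2 ∈ Metric.closedBall cY (B / 2)) (hn : 2 ≤ n) (hδ : 0 < δ) (hδ1 : δ < 1)
    (hs : cvWidth n δ < 1 / 2) :
    experiment ρ n {e | ¬ (meanDev ρ B e.1 ≤ 2 * cvWidth n δ ∧
      ∀ j ≤ ⌈Real.logb 2 ((n : ℝ) ^ 2)⌉₊,
        candEmp S y₀ δ j e.1 e.2.1 e.2.2 ≤ candEmp S y₀ δ 0 e.1 e.2.1 e.2.2 →
        candRisk ρ S y₀ δ j e.1 e.2.2 - candRisk ρ S y₀ δ 0 e.1 e.2.2 ≤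
          B ^ 2 * (2 * cvWidth n δ - meanDev ρ B e.1))} ≤ ENNReal.ofReal (δ / 3) := by
  have h8 := eight_le_of_cvWidth_lt hn hδ hδ1 hs
  have hl := three_le_logb h8
  have hn' : (0 : ℝ) < n := by positivity
  set s := cvWidth n δ with hsdef
  have hs0 : 0 ≤ s := cvWidth_nonneg
  obtain ⟨ε, hε⟩ : ∃ ε, ε = δ / (18 * Real.logb 2 n) := ⟨_, rfl⟩
  have hε0 : 0 ≤ ε := by rw [hε]; positivity
  have hexp : Real.exp (-(2 * n * s ^ 2)) = ε := by rw [hε, exp_cvWidth hn hδ hδ1]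
  set M := ⌈Real.logb 2 ((n : ℝ) ^ 2)⌉₊ with hM
  set bad : ℕ → Set ((Fin n → E D × E D') × (Fin n → E D × E D') × Seeds D) := fun j =>
    {e | candEmp S y₀ δ j e.1 e.2.1 e.2.2 ≤ candEmp S y₀ δ 0 e.1 e.2.1 e.2.2} ∩
    {e | B ^ 2 * (2 * s - meanDev ρ B e.1) <
      candRisk ρ S y₀ δ j e.1 e.2.2 - candRisk ρ S y₀ δ 0 e.1 e.2.2} with hbad
  have hmd : Measurable fun e : (Fin n → E D × E D') × (Fin n → E D × E D') × Seeds D =>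
      meanDev ρ B e.1 := measurable_meanDev.comp measurable_fst
  have hexpm : Measurable fun z : Fin n → E D × E D' =>
      ENNReal.ofReal (Real.exp (n * meanDev ρ B z)) :=
    (measurable_meanDev.const_mul _).exp.ennreal_ofReal
  have hbm : ∀ j, MeasurableSet (bad j) := fun j => by
    exact (measurableSet_le (measurable_candEmp hS j) (measurable_candEmp hS 0)).inter
      (measurableSet_lt ((hmd.const_sub _).const_mul _) ((measurable_candRisk hS j).sub
        (measurable_candRisk hS 0)))
  have hle : ∀ j, experiment ρ n (bad j) ≤ ENNReal.ofReal (5 / 2 * ε) := by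
    intro j
    calc _ ≤ ∫⁻ z, ENNReal.ofReal ε * ENNReal.ofReal (Real.exp (n * meanDev ρ B z))
          ∂(Measure.pi fun _ : Fin n => ρ) := by
          refine experiment_le_lintegral (hbm j) ?_
          have hgood : ∀ᵐ z ∂(Measure.pi fun _ : Fin n => ρ), ∀ i,
              (z i).2 ∈ Metric.closedBall cY (B / 2) := ae_all_iff.2 fun i =>
            (measurePreserving_eval (fun _ : Fin n => ρ) i).quasiMeasurePreserving.ae hY
          filter_upwards [hgood] with z hz ω
          have hcm : ∀ j x, candidate S y₀ δ z ω j x ∈ Metric.closedBall cY (B / 2) := fun j =>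
            candidate_mem (convex_closedBall _ _) hy₀ hz j
          set η := meanDev ρ B z with hη
          obtain ⟨m, hm⟩ : ∃ m, candRisk ρ S y₀ δ j z ω - candRisk ρ S y₀ δ 0 z ω = B ^ 2 * m :=
            ⟨(candRisk ρ S y₀ δ j z ω - candRisk ρ S y₀ δ 0 z ω) / B ^ 2, by field_simp⟩
          rw [← ENNReal.ofReal_mul hε0]
          rcases le_or_gt m (2 * s - η) with hmle | hmlt
          · have : {z' | (z, z', ω) ∈ bad j} = ∅ := by
              ext z'
              simp only [hbad, Set.mem_inter_iff, Set.mem_ofPred_eq, hm, Set.mem_empty_iff_false,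
                iff_false, not_and, not_lt]
              exact fun _ => mul_le_mul_of_nonneg_left hmle (sq_nonneg B)
            rw [this]; simp
          rcases le_or_gt (2 * s - η) 0 with hneg | hpos
          · refine prob_le_one.trans (ENNReal.one_le_ofReal.2 ?_)
            rw [← hexp, ← Real.exp_add]
            refine Real.one_le_exp ?_
            have h1 : 2 * s ^ 2 ≤ η := by nlinarith
            nlinarith
          have h1' := measure_pi_empRisk_le hB hY (measurable_candidate_right (y₀ := y₀) (δ := δ)
            hS z ω 0) (hcm 0) (measurable_candidate_right hS z ω j) (hcm j) (n := n) (by omega)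
            (hpos.trans hmlt) hm
          refine le_trans (measure_mono fun z' hz' => ?_) (h1'.trans (ENNReal.ofReal_le_ofReal ?_))
          · exact hz'.1
          rw [← hexp, ← Real.exp_add]
          refine Real.exp_le_exp.2 ?_
          have h5 : (2 * s - η) ^ 2 ≤ m ^ 2 := pow_le_pow_left₀ hpos.le hmlt.le 2
          have hη0 : 0 ≤ η := meanDev_nonneg z
          have h6 : 2 * s ^ 2 - η ≤ m ^ 2 / 2 := by nlinarith [sq_nonneg η]
          nlinarith
      _ = ENNReal.ofReal ε * ∫⁻ z, ENNReal.ofReal (Real.exp (n * meanDev ρ B z))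
          ∂(Measure.pi fun _ : Fin n => ρ) := lintegral_const_mul _ hexpm
      _ ≤ ENNReal.ofReal ε * ENNReal.ofReal (5 / 2) := by
          gcongr
          exact lintegral_exp_meanDev_le hB hY h8
      _ = _ := by rw [← ENNReal.ofReal_mul hε0, mul_comm]
  have hroot : experiment ρ n {e | 2 * s < meanDev ρ B e.1} ≤ ENNReal.ofReal (5 / 2 * (ε / 54)) := by
    have hε54 : ε ≤ 1 / 54 := by
      rw [hε, div_le_iff₀ (by positivity)]; linarith
    have h1 : Real.exp (-(2 * n * s)) ≤ ε / 54 := by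
      calc Real.exp (-(2 * n * s)) ≤ Real.exp (-(2 * n * s ^ 2) + -(2 * n * s ^ 2)) := by
            refine Real.exp_le_exp.2 ?_
            have : s * s ≤ 1 / 2 * s := by gcongr
            nlinarith
        _ = ε * ε := by rw [Real.exp_add, hexp]
        _ ≤ _ := by nlinarith
    have h2 : (Measure.pi fun _ : Fin n => ρ) {z | 2 * s < meanDev ρ B z} ≤
        ENNReal.ofReal (ε / 54) * ENNReal.ofReal (5 / 2) := by
      calc _ ≤ ∫⁻ z, ENNReal.ofReal (Real.exp (-(2 * n * s))) *
            ENNReal.ofReal (Real.exp (n * meanDev ρ B z)) ∂(Measure.pi fun _ : Fin n => ρ) := by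
            refine meas_le_lintegral₀ (hexpm.const_mul _).aemeasurable fun z hz => ?_
            rw [← ENNReal.ofReal_mul (Real.exp_pos _).le, ← Real.exp_add, ENNReal.one_le_ofReal]
            refine Real.one_le_exp ?_
            have : 2 * s < meanDev ρ B z := hz
            nlinarith
        _ ≤ _ := by
            rw [lintegral_const_mul _ hexpm]
            gcongr
            exact lintegral_exp_meanDev_le hB hY h8
    calc _ ≤ ((Measure.pi fun _ : Fin n => ρ).prod (seedsLaw D))
          ({z | 2 * s < meanDev ρ B z} ×ˢ Set.univ) := by
          refine le_trans (measure_mono fun e he => ?_)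
            (experiment_train_le ({z | 2 * s < meanDev ρ B z} ×ˢ Set.univ))
          exact ⟨he, Set.mem_univ _⟩
      _ = (Measure.pi fun _ : Fin n => ρ) {z | 2 * s < meanDev ρ B z} := by
          rw [Measure.prod_prod, measure_univ, mul_one]
      _ ≤ _ := h2
      _ = _ := by rw [← ENNReal.ofReal_mul (by positivity), mul_comm]
  have hsub : {e : (Fin n → E D × E D') × (Fin n → E D × E D') × Seeds D |
      ¬ (meanDev ρ B e.1 ≤ 2 * s ∧ ∀ j ≤ M,
        candEmp S y₀ δ j e.1 e.2.1 e.2.2 ≤ candEmp S y₀ δ 0 e.1 e.2.1 e.2.2 →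
        candRisk ρ S y₀ δ j e.1 e.2.2 - candRisk ρ S y₀ δ 0 e.1 e.2.2 ≤
          B ^ 2 * (2 * s - meanDev ρ B e.1))} ⊆
      {e | 2 * s < meanDev ρ B e.1} ∪ ⋃ j ∈ Finset.Icc 1 M, bad j := by
    intro e he
    by_contra hcon
    simp only [Set.mem_union, Set.mem_iUnion, not_or, not_exists, Set.mem_ofPred_eq, not_lt] at hcon
    refine he ⟨hcon.1, fun j hj hemp => ?_⟩
    rcases Nat.eq_zero_or_pos j with rfl | hpos
    · rw [sub_self]
      exact mul_nonneg (sq_nonneg _) (by linarith [hcon.1])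
    · have h1 := hcon.2 j (Finset.mem_Icc.2 ⟨hpos, hj⟩)
      by_contra! hlt
      exact h1 ⟨hemp, hlt⟩
  calc _ ≤ experiment ρ n {e | 2 * s < meanDev ρ B e.1} +
        ∑ j ∈ Finset.Icc 1 M, experiment ρ n (bad j) :=
        (measure_mono hsub).trans ((measure_union_le _ _).trans
          (add_le_add le_rfl (measure_biUnion_finset_le _ _)))
    _ ≤ ENNReal.ofReal (5 / 2 * (ε / 54)) + ∑ _j ∈ Finset.Icc 1 M, ENNReal.ofReal (5 / 2 * ε) :=
        add_le_add hroot (Finset.sum_le_sum fun j _ => hle j)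
    _ = ENNReal.ofReal (5 / 2 * (ε / 54) + M * (5 / 2 * ε)) := by
        rw [Finset.sum_const, Nat.card_Icc, nsmul_eq_mul, Nat.add_sub_cancel,
          ENNReal.ofReal_add (by positivity) (by positivity),
          ENNReal.ofReal_mul (p := (M : ℝ)) (by positivity), ENNReal.ofReal_natCast]
    _ ≤ _ := by
        refine ENNReal.ofReal_le_ofReal ?_
        have hMle : (M : ℝ) ≤ 2 * Real.logb 2 n + 1 := ceil_logb_sq_le hn
        have h4 : ε * (18 * Real.logb 2 n) = δ := by rw [hε]; field_simp
        have h5 : 5 / 2 * (ε / 54) + M * (5 / 2 * ε) ≤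
            ε * (5 / 2 * (2 * Real.logb 2 n + 1 + 1 / 54)) := by nlinarith
        refine h5.trans ?_
        rw [← h4]
        nlinarith

end Risk

/-! ### Excess risk of a candidate -/

section CellRisk

variable {D D' n : ℕ} {ρ : Measure (E D × E D')} [IsProbabilityMeasure ρ] {S S' : Set (E D)}
  {g : E D → E D'} {lam : ℝ} {cY y₀ : E D'} {B K δ : ℝ} {z : Fin n → E D × E D'} {ω : Seeds D}

theorem candidate_eq_of_mem {j : ℕ} {c : Cell D}
    (hc : c ∈ adaptivePart S (fun i => (z i).1) δ ω j) {x : E D} (hx : x ∈ c.carrier) :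
    candidate S y₀ δ z ω j x = if (idxSet (fun i => (z i).1) c.carrier).Nonempty then
      ((idxSet (fun i => (z i).1) c.carrier).card : ℝ)⁻¹ •
        ∑ i ∈ idxSet (fun i => (z i).1) c.carrier, (z i).2 else y₀ := by
  rw [candidate, regressor_eq, cellOf_eq hc hx]

theorem measurableSet_of_mem_adaptivePart (hS : MeasurableSet S) (hn : 0 < n)
    (hT : 0 < numTrials n δ) {X : Fin n → E D} {j : ℕ} {c : Cell D}
    (hc : c ∈ adaptivePart S X δ ω j) : MeasurableSet c.carrier := by
  obtain ⟨l, -, hl⟩ := exists_code_of_mem_adaptivePart (L := c.level) hn hT hc le_rfl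
  rw [← hl]
  exact measurableSet_codeRegion hS measurable_const measurable_const measurable_id l

theorem setIntegral_le_const_mul {μ : Measure (E D)} [IsFiniteMeasure μ] {φ : E D → ℝ}
    {A : Set (E D)} {b : ℝ} (h0 : ∀ x, 0 ≤ φ x) (h : ∀ᵐ x ∂μ, x ∈ A → φ x ≤ b) :
    ∫ x in A, φ x ∂μ ≤ b * μ.real A := by
  refine (Real.le_norm_self _).trans (norm_setIntegral_le_of_norm_le_const_ae'
    (measure_lt_top μ A) ?_)
  filter_upwards [h] with x hx hxA
  rw [Real.norm_of_nonneg (h0 x)]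
  exact hx hxA

open Classical in
theorem Controlled.mul_fst_le {ρ : Measure (E D × E D')} {ξ : E D × E D' → E D'} {A : Set (E D)}
    (hA : MeasurableSet A)
    (h : Controlled ρ ξ B K z (Prod.fst ⁻¹' A)) (he : ∀ i, (z i).1 ∉ A) :
    n * ρ.fst.real A ≤ K := by
  have h1 := h.1
  have h2 : (Finset.univ.filter fun i => z i ∈ Prod.fst ⁻¹' A).card = 0 := by
    rw [Finset.card_eq_zero, Finset.filter_eq_empty_iff]
    exact fun i _ hi => he i hi
  rw [h2] at h1
  rw [measureReal_def, Measure.fst_apply hA, ← measureReal_def]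
  simpa using h1

/-- Regions without data contribute to the excess risk at most at the statistical error scale. -/
theorem setIntegral_le_of_mul_le (hn : 0 < n) {μ : Measure (E D)} [IsFiniteMeasure μ]
    {φ : E D → ℝ} {A : Set (E D)} (h0 : ∀ x, 0 ≤ φ x) (h : ∀ x, φ x ≤ B ^ 2)
    (hA : n * μ.real A ≤ K) : ∫ x in A, φ x ∂μ ≤ K * (B ^ 2 / n) := by
  have hn' : (0 : ℝ) < n := by exact_mod_cast hn
  refine (setIntegral_le_const_mul h0 (ae_of_all _ fun x _ => h x)).trans ?_
  rw [mul_div_assoc', le_div_iff₀ hn']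
  nlinarith [mul_le_mul_of_nonneg_left hA (sq_nonneg B)]

/-- Excess risk of a candidate within a cell. The data diameter controls the bias only near the
data, but the part of the cell outside of a ball that contains its data has a small mass. -/
theorem setIntegral_cell_le (hM : MeasurableModel ρ S' g lam cY B) (hlam : 0 ≤ lam) (hB : 0 < B)
    (hy₀ : y₀ ∈ Metric.closedBall cY (B / 2)) (hS : MeasurableSet S) (hn : 0 < n)
    (hT : 0 < numTrials n δ) (hz : ∀ i, (z i).1 ∈ S' ∧ (z i).2 ∈ Metric.closedBall cY (B / 2))
    (hK : 0 ≤ K) {j : ℕ} {c : Cell D} (hc : c ∈ adaptivePart S (fun i => (z i).1) δ ω j)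
    (h₁ : Controlled ρ (noise g) B K z (Prod.fst ⁻¹' c.carrier))
    (h₂ : ∀ p, Controlled ρ (noise g) B K z (Prod.fst ⁻¹' (c.carrier \
      Metric.closedBall (z p).1 (dataDiam (fun i => (z i).1) c.carrier)))) :
    ∫ x in c.carrier, ‖candidate S y₀ δ z ω j x - g x‖ ^ 2 ∂ρ.fst ≤
      18 * K * (B ^ 2 / n) + 16 * lam ^ 2 * (empMass (fun i => (z i).1) c.carrier *
        dataDiam (fun i => (z i).1) c.carrier ^ 2) := by
  classical
  have hn' : (0 : ℝ) < n := by exact_mod_cast hn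
  set X : Fin n → E D := fun i => (z i).1 with hX
  set A := c.carrier with hA
  have hAm : MeasurableSet A := measurableSet_of_mem_adaptivePart hS hn hT hc
  set Δ := dataDiam X A with hΔ
  set φ : E D → ℝ := fun x => ‖candidate S y₀ δ z ω j x - g x‖ ^ 2 with hφ
  have hφ0 : ∀ x, 0 ≤ φ x := fun x => sq_nonneg _
  have hcm : ∀ x, candidate S y₀ δ z ω j x ∈ Metric.closedBall cY (B / 2) :=
    candidate_mem (convex_closedBall _ _) hy₀ (fun i => (hz i).2) j
  have hφB : ∀ x, φ x ≤ B ^ 2 := fun x =>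
    pow_le_pow_left₀ (norm_nonneg _) (norm_sub_le_of_mem_closedBall (hcm x) (hM.bounded x)) 2
  have hφm : Measurable φ :=
    ((measurable_candidate_right hS z ω j).sub hM.measurable).norm.pow_const 2
  have hφi : Integrable φ ρ.fst := Integrable.of_bound hφm.aestronglyMeasurable (B ^ 2)
    (ae_of_all _ fun x => by rw [Real.norm_of_nonneg (hφ0 x)]; exact hφB x)
  have hreal : ∀ {A' : Set (E D)}, MeasurableSet A' →
      ρ.real (Prod.fst ⁻¹' A') = ρ.fst.real A' := fun hA' => by
    rw [measureReal_def, measureReal_def, Measure.fst_apply hA']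
  set N := (idxSet X A).card with hN
  have hmass := h₁.1
  have hdev := h₁.2
  have hfil : (Finset.univ.filter fun i => z i ∈ Prod.fst ⁻¹' A) = idxSet X A := by
    ext i; simp [hX]
  rw [hfil, hreal hAm] at hmass
  rw [hfil] at hdev
  have hemp : empMass X A = N / n := empMass_eq X A
  have hright : 0 ≤ 16 * lam ^ 2 * (empMass X A * Δ ^ 2) := by
    have := empMass_nonneg (X := X) A
    positivity
  rcases (idxSet X A).eq_empty_or_nonempty with hemp0 | hne
  · -- no data: the mass of the cell is small
    have h4 := setIntegral_le_of_mul_le hn hφ0 hφB (h₁.mul_fst_le hAm fun i hi => by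
      have : i ∈ idxSet X A := mem_idxSet.2 hi
      simp [hemp0] at this)
    have h5 : 0 ≤ K * (B ^ 2 / n) := by positivity
    linarith
  obtain ⟨p, hp⟩ := hne
  have hNpos : (0 : ℝ) < N := by exact_mod_cast Finset.card_pos.2 ⟨p, hp⟩
  set Q := Metric.closedBall (X p) Δ with hQ
  have hQm : MeasurableSet Q := Metric.isClosed_closedBall.measurableSet
  have hΔ0 : 0 ≤ Δ := dataDiam_nonneg A
  -- outside of the ball
  have hout : ∫ x in A \ Q, φ x ∂ρ.fst ≤ K * (B ^ 2 / n) := by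
    have hno : ∀ i, X i ∉ A \ Q := fun i hi => by
      have h3 : dist (X i) (X p) ≤ dataDiam X A := dist_le_dataDiam hi.1 (mem_idxSet.1 hp)
      exact hi.2 (Metric.mem_closedBall.2 h3)
    have h4 : n * ρ.fst.real (A \ Q) ≤ K := (h₂ p).mul_fst_le (hAm.diff hQm) hno
    exact setIntegral_le_of_mul_le hn hφ0 hφB h4
  -- inside of the ball
  set V := 8 * K * B ^ 2 / N + 8 * lam ^ 2 * Δ ^ 2 with hV
  have hV0 : 0 ≤ V := by positivity
  have hpt : ∀ᵐ x ∂ρ.fst, x ∈ A ∩ Q → φ x ≤ V := by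
    filter_upwards [hM.ae_fst_mem] with x hxS hx
    have hcand := candidate_eq_of_mem (y₀ := y₀) hc hx.1
    rw [if_pos ⟨p, hp⟩] at hcand
    set a := (N : ℝ)⁻¹ • ∑ i ∈ idxSet X A, noise g (z i) with ha
    set b := (N : ℝ)⁻¹ • ∑ i ∈ idxSet X A, (g (X i) - g x) with hb
    have hab : candidate S y₀ δ z ω j x - g x = a + b := by
      rw [hcand, ha, hb, ← smul_add, ← Finset.sum_add_distrib]
      have h6 : ∀ i ∈ idxSet X A, noise g (z i) + (g (X i) - g x) = (z i).2 - g x := by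
        intro i _
        simp [noise, hX]
      rw [Finset.sum_congr rfl h6, Finset.sum_sub_distrib, Finset.sum_const, smul_sub,
        ← Nat.cast_smul_eq_nsmul ℝ, smul_smul, inv_mul_cancel₀ hNpos.ne', one_smul]
    have hna : ‖a‖ ^ 2 ≤ 4 * K * B ^ 2 / N := by
      rw [ha, norm_smul, Real.norm_of_nonneg (by positivity), mul_pow]
      calc _ ≤ (N : ℝ)⁻¹ ^ 2 * (B ^ 2 * (4 * K * N)) := by gcongr
        _ = _ := by field_simp
    have hnb : ‖b‖ ≤ 2 * lam * Δ := by
      have h7 : ‖∑ i ∈ idxSet X A, (g (X i) - g x)‖ ≤ N * (2 * lam * Δ) := by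
        have h11 : ∑ _i ∈ idxSet X A, 2 * lam * Δ = N * (2 * lam * Δ) := by
          rw [Finset.sum_const, nsmul_eq_mul]
        rw [← h11]
        refine norm_sum_le_of_le _ fun i hi => ?_
        refine (hM.lipschitz _ (hz i).1 _ hxS).trans ?_
        have h8 : ‖X i - x‖ ≤ Δ + Δ := by
          rw [← dist_eq_norm]
          refine (dist_triangle _ (X p) _).trans (add_le_add ?_ ?_)
          · exact dist_le_dataDiam (mem_idxSet.1 hi) (mem_idxSet.1 hp)
          · rw [dist_comm]; exact hx.2
        calc lam * ‖X i - x‖ ≤ lam * (Δ + Δ) := by gcongr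
          _ = _ := by ring
      rw [hb, norm_smul, Real.norm_of_nonneg (by positivity)]
      calc _ ≤ (N : ℝ)⁻¹ * (N * (2 * lam * Δ)) := by gcongr
        _ = _ := by field_simp
    have hnb2 : ‖b‖ ^ 2 ≤ (2 * lam * Δ) ^ 2 := pow_le_pow_left₀ (norm_nonneg _) hnb 2
    have h9 : ‖a + b‖ ^ 2 ≤ 2 * ‖a‖ ^ 2 + 2 * ‖b‖ ^ 2 := by
      have := pow_le_pow_left₀ (norm_nonneg _) (norm_add_le a b) 2
      nlinarith [sq_nonneg (‖a‖ - ‖b‖)]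
    simp only [hφ]
    rw [hab, hV]
    have h10 : 8 * K * B ^ 2 / N = 2 * (4 * K * B ^ 2 / N) := by ring
    rw [h10]
    nlinarith
  have hin : ∫ x in A ∩ Q, φ x ∂ρ.fst ≤ V * (2 * N / n) + K * (B ^ 2 / n) := by
    have h3 := setIntegral_le_const_mul (μ := ρ.fst) (A := A ∩ Q) (b := min V (B ^ 2)) hφ0
      (hpt.mono fun x hx hxA => le_min (hx hxA) (hφB x))
    have h4 : ρ.fst.real (A ∩ Q) ≤ 2 * N / n + K / n := by
      refine (measureReal_mono Set.inter_subset_left).trans ?_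
      rw [← add_div, le_div_iff₀ hn']
      linarith
    have h5 : 0 ≤ min V (B ^ 2) := le_min hV0 (sq_nonneg B)
    calc _ ≤ min V (B ^ 2) * (2 * N / n + K / n) := h3.trans (by gcongr)
      _ = min V (B ^ 2) * (2 * N / n) + min V (B ^ 2) * (K / n) := by ring
      _ ≤ V * (2 * N / n) + B ^ 2 * (K / n) := by
          gcongr
          · exact min_le_left _ _
          · exact min_le_right _ _
      _ = _ := by ring
  rw [← integral_inter_add_sdiff hQm hφi.integrableOn]
  have hVN : V * (2 * N / n) = 16 * K * (B ^ 2 / n) + 16 * lam ^ 2 * (empMass X A * Δ ^ 2) := by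
    rw [hV, hemp]
    field_simp
    ring
  linarith

/-- Excess risk of a candidate in terms of the partition: a variance term proportional to the
number of cells and a bias term proportional to the average squared diameter. -/
theorem integral_sq_candidate_le (hM : MeasurableModel ρ S' g lam cY B) (hSS : S' ⊆ S)
    (hlam : 0 ≤ lam) (hB : 0 < B)
    (hy₀ : y₀ ∈ Metric.closedBall cY (B / 2)) (hS : MeasurableSet S) (hn : 0 < n)
    (hT : 0 < numTrials n δ) (hz : ∀ i, (z i).1 ∈ S' ∧ (z i).2 ∈ Metric.closedBall cY (B / 2))
    (hK : 0 ≤ K) {L : ℕ} (hctl : AllControlled ρ S g B K L (numTrials n δ) z ω) {j : ℕ}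
    (hL : ∀ c ∈ adaptivePart S (fun i => (z i).1) δ ω j, c.level ≤ L) :
    ∫ x, ‖candidate S y₀ δ z ω j x - g x‖ ^ 2 ∂ρ.fst ≤
      (adaptivePart S (fun i => (z i).1) δ ω j).length * (18 * K * (B ^ 2 / n)) +
        16 * lam ^ 2 * massDiam (fun i => (z i).1) (adaptivePart S (fun i => (z i).1) δ ω j) := by
  set X : Fin n → E D := fun i => (z i).1 with hX
  set φ : E D → ℝ := fun x => ‖candidate S y₀ δ z ω j x - g x‖ ^ 2 with hφ
  have hcm : ∀ x, candidate S y₀ δ z ω j x ∈ Metric.closedBall cY (B / 2) :=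
    candidate_mem (convex_closedBall _ _) hy₀ (fun i => (hz i).2) j
  have hφm : Measurable φ :=
    ((measurable_candidate_right hS z ω j).sub hM.measurable).norm.pow_const 2
  have hφi : Integrable φ ρ.fst := Integrable.of_bound hφm.aestronglyMeasurable (B ^ 2)
    (ae_of_all _ fun x => by
      rw [Real.norm_of_nonneg (sq_nonneg _)]
      exact pow_le_pow_left₀ (norm_nonneg _) (norm_sub_le_of_mem_closedBall (hcm x) (hM.bounded x)) 2)
  have hsum := sum_adaptivePart (S := S) (X := X) (δ := δ) (ω := ω)
    (m := fun A => ∫ x in A, φ x ∂ρ.fst) (fun A v t => by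
      have hH : MeasurableSet {x : E D | (inner ℝ x v : ℝ) ≤ t} :=
        measurableSet_le (measurable_id.inner_const) measurable_const
      have h1 := integral_inter_add_sdiff (s := A) hH (hφi.integrableOn (s := A))
      have h2 : A \ {x ∈ A | (inner ℝ x v : ℝ) ≤ t} = A \ {x | (inner ℝ x v : ℝ) ≤ t} := by
        ext x; simp +contextual
      rw [h2]
      exact h1) j
  have htot : ∫ x, φ x ∂ρ.fst = ∫ x in S, φ x ∂ρ.fst := by
    rw [Measure.restrict_eq_self_of_ae_mem (hM.ae_fst_mem.mono fun x hx => hSS hx)]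
  rw [htot, ← hsum]
  have hcell : ∀ c ∈ adaptivePart S X δ ω j, ∫ x in c.carrier, φ x ∂ρ.fst ≤
      18 * K * (B ^ 2 / n) + 16 * lam ^ 2 * (empMass X c.carrier * dataDiam X c.carrier ^ 2) := by
    intro c hc
    obtain ⟨l, hl, hl'⟩ := exists_code_of_mem_adaptivePart hn hT hc (hL c hc)
    have hlen : l.length ≤ L := by
      have h3 : l.length = c.level := by rw [Cell.level, ← hl, codeAddr, List.length_map]
      rw [h3]; exact hL c hc
    refine setIntegral_cell_le hM hlam hB hy₀ hS hn hT hz hK hc ?_ fun p => ?_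
    · rw [← hl']
      exact hctl (l, none) hlen
    · obtain ⟨q, r, hqr⟩ := exists_dataDiam_eq_norm hn X c.carrier
      rw [hqr, ← hl']
      exact hctl (l, some (p, q, r)) hlen
  calc _ ≤ ((adaptivePart S X δ ω j).map fun c => 18 * K * (B ^ 2 / n) +
        16 * lam ^ 2 * (empMass X c.carrier * dataDiam X c.carrier ^ 2)).sum :=
        List.sum_le_sum hcell
    _ = _ := by
        rw [List.sum_map_add, List.map_const', List.sum_replicate, nsmul_eq_mul,
          List.sum_map_mul_left, massDiam]

end CellRisk

/-! ### Balancing bias and variance -/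

section Balance

theorem balance_variance {ℓ β k : ℝ} (hℓ : 0 < ℓ) (hβ : 0 < β) (hk : 0 < k) :
    β * (ℓ ^ 2 / β) ^ (k / (2 + k)) = ℓ ^ (2 * k / (2 + k)) * β ^ (2 / (2 + k)) := by
  have h2 : (2 + k) ≠ 0 := by positivity
  have e : β = Real.exp (Real.log β) := (Real.exp_log hβ).symm
  rw [Real.rpow_def_of_pos (by positivity), Real.rpow_def_of_pos hℓ, Real.rpow_def_of_pos hβ,
    Real.log_div (by positivity) hβ.ne', Real.log_pow]
  nth_rewrite 1 [e]
  rw [← Real.exp_add, ← Real.exp_add]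
  congr 1
  push_cast
  field_simp
  ring

theorem balance_bias {ℓ β k : ℝ} (hℓ : 0 < ℓ) (hβ : 0 < β) (hk : 0 < k) :
    ℓ ^ 2 * (ℓ ^ 2 / β) ^ (-(2 / (2 + k))) = ℓ ^ (2 * k / (2 + k)) * β ^ (2 / (2 + k)) := by
  have h2 : (2 + k) ≠ 0 := by positivity
  have e : ℓ ^ 2 = Real.exp (2 * Real.log ℓ) := by
    rw [two_mul, Real.exp_add, Real.exp_log hℓ]; ring
  rw [Real.rpow_def_of_pos (by positivity), Real.rpow_def_of_pos hℓ, Real.rpow_def_of_pos hβ,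
    Real.log_div (by positivity) hβ.ne', Real.log_pow]
  nth_rewrite 1 [e]
  rw [← Real.exp_add, ← Real.exp_add]
  congr 1
  push_cast
  field_simp
  ring

variable {D D' n : ℕ} {ρ : Measure (E D × E D')} [IsProbabilityMeasure ρ] {S S' : Set (E D)}
  {g : E D → E D'} {lam ΔX : ℝ} {cX : E D} {cY y₀ : E D'} {B K δ : ℝ} {z : Fin n → E D × E D'}
  {ω : Seeds D}

theorem dataDiam_le_of_subset {X : Fin n → E D} (hX : 0 ≤ ΔX)
    (hS : S ⊆ Metric.closedBall cX (ΔX / 2)) : dataDiam X S ≤ ΔX := by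
  refine (Metric.diam_mono (Set.inter_subset_right.trans hS) Metric.isBounded_closedBall).trans ?_
  exact (Metric.diam_closedBall (by positivity)).trans (by linarith)

theorem empMass_le_one {X : Fin n → E D} (hn : 0 < n) (A : Set (E D)) : empMass X A ≤ 1 := by
  have hn' : (0 : ℝ) < n := by exact_mod_cast hn
  rw [empMass_eq, div_le_one hn']
  exact_mod_cast (Finset.card_le_univ _).trans (by simp)

/-- One of the candidates has a small excess risk. The optimal number of rounds is
`log (ℓ² / β) / (2 + k)`, and the algorithm may stop before only if the bias vanishes. -/
theorem exists_candidate_le (hM : MeasurableModel ρ S' g lam cY B) (hSS : S' ⊆ S)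
    (hlam : 0 ≤ lam) (hB : 0 < B) (hΔX : 0 ≤ ΔX) (hSX : S ⊆ Metric.closedBall cX (ΔX / 2))
    (hy₀ : y₀ ∈ Metric.closedBall cY (B / 2)) (hS : MeasurableSet S) (hn : 2 ≤ n)
    (hT : 0 < numTrials n δ) (hz : ∀ i, (z i).1 ∈ S' ∧ (z i).2 ∈ Metric.closedBall cY (B / 2))
    {L : ℕ} (hL : Real.logb 2 ((n : ℝ) ^ 2) ≤ L) {κ β : ℝ} (hK : 0 ≤ K) (hβ : 0 < β)
    (hKβ : K * (B ^ 2 / n) ≤ κ * β)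
    (hctl : AllControlled ρ S g B K L (numTrials n δ) z ω)
    (hℓβ : β ≤ (lam * ΔX) ^ 2) (hℓn : (lam * ΔX) ^ 2 / β ≤ n ^ 2) {k : ℝ} (hk : 0 < k)
    (hrate : AttainsRate S (fun i => (z i).1) δ ω k) {i : ℕ}
    (hi : StopsAt S (fun i => (z i).1) δ ω i) :
    ∃ j ≤ i, ∫ x, ‖candidate S y₀ δ z ω j x - g x‖ ^ 2 ∂ρ.fst ≤
      (18 * κ + 64) * ((lam * ΔX) ^ (2 * k / (2 + k)) * β ^ (2 / (2 + k))) := by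
  set X : Fin n → E D := fun i => (z i).1 with hX
  set ℓ := lam * ΔX with hℓ
  have hn0 : 0 < n := by omega
  have hℓ0 : 0 < ℓ := by
    have h1 : 0 ≤ ℓ := by positivity
    refine h1.lt_of_ne fun h => ?_
    rw [← h] at hℓβ
    norm_num at hℓβ
    linarith
  set q := ℓ ^ 2 / β with hq
  have hq1 : 1 ≤ q := by rw [hq, one_le_div hβ]; exact hℓβ
  have hq0 : 0 < q := by linarith
  set Lq := Real.logb 2 q with hLq
  have hLq0 : 0 ≤ Lq := Real.logb_nonneg (by norm_num) hq1
  have hqL : (2 : ℝ) ^ Lq = q := Real.rpow_logb (by norm_num) (by norm_num) hq0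
  have hLqn : Lq ≤ Real.logb 2 ((n : ℝ) ^ 2) := Real.logb_le_logb_of_le (by norm_num) hq0 hℓn
  set τ := ℓ ^ (2 * k / (2 + k)) * β ^ (2 / (2 + k)) with hτ
  set J := ⌊Lq / (2 + k)⌋₊ with hJ
  have hJle : (J : ℝ) ≤ Lq / (2 + k) := Nat.floor_le (by positivity)
  have hJlt : Lq / (2 + k) < J + 1 := Nat.lt_floor_add_one _
  have hJk : (J : ℝ) * k ≤ Lq * (k / (2 + k)) := by
    calc (J : ℝ) * k ≤ Lq / (2 + k) * k := by gcongr
      _ = _ := by ring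
  have hfrac : k / (2 + k) ≤ 1 := by rw [div_le_one (by positivity)]; linarith
  have hJkL : (J : ℝ) * k ≤ Lq := hJk.trans (mul_le_of_le_one_right hLq0 hfrac)
  -- bound for the first `J` rounds, up to the bias
  have main : ∀ j ≤ i, j ≤ J → ∫ x, ‖candidate S y₀ δ z ω j x - g x‖ ^ 2 ∂ρ.fst ≤
      18 * κ * τ + 16 * lam ^ 2 * massDiam X (adaptivePart S X δ ω j) := by
    intro j hji hjJ
    have hdepth : DepthLE S X δ ω j k :=
      depthLE_of_attainsRate hrate fun l hl => hi.2 l (hl.trans_le hji)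
    have hjJ' : (j : ℝ) ≤ J := by exact_mod_cast hjJ
    have hlev : ∀ c ∈ adaptivePart S X δ ω j, c.level ≤ L := by
      intro c hc
      have h1 := level_le hdepth hc
      have h2 : (j : ℝ) * k ≤ J * k := by gcongr
      exact_mod_cast (by linarith : (c.level : ℝ) ≤ L)
    refine (integral_sq_candidate_le hM hSS hlam hB hy₀ hS hn0 hT hz hK hctl hlev).trans ?_
    refine add_le_add ?_ le_rfl
    have hlen : ((adaptivePart S X δ ω j).length : ℝ) ≤ q ^ (k / (2 + k)) := by
      refine (length_adaptivePart_le hdepth).trans ?_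
      rw [← hqL, ← Real.rpow_natCast, ← Real.rpow_mul (by norm_num), ← Real.rpow_mul (by norm_num)]
      refine Real.rpow_le_rpow_of_exponent_le (by norm_num) ?_
      calc k * (j : ℝ) ≤ k * J := by gcongr
        _ ≤ _ := by linarith
    have h0 : 0 ≤ K * (B ^ 2 / n) := by positivity
    calc _ = 18 * (((adaptivePart S X δ ω j).length : ℝ) * (K * (B ^ 2 / n))) := by ring
      _ ≤ 18 * (q ^ (k / (2 + k)) * (κ * β)) := by gcongr
      _ = 18 * κ * (β * q ^ (k / (2 + k))) := by ring
      _ = 18 * κ * τ := by rw [hq, balance_variance hℓ0 hβ hk]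
  have hτ0 : 0 ≤ τ := by positivity
  rcases le_or_gt J i with hJi | hiJ
  · refine ⟨J, hJi, (main J hJi le_rfl).trans ?_⟩
    have hdepth : DepthLE S X δ ω J k :=
      depthLE_of_attainsRate hrate fun l hl => hi.2 l (hl.trans_le hJi)
    have h1 := massDiam_adaptivePart_le hT hdepth
    have h2 : empMass X S * dataDiam X S ^ 2 ≤ ΔX ^ 2 := by
      calc _ ≤ 1 * ΔX ^ 2 := by
            gcongr
            · exact empMass_le_one hn0 S
            · exact dataDiam_nonneg S
            · exact dataDiam_le_of_subset hΔX hSX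
        _ = _ := one_mul _
    have h3 : (1 / 4 : ℝ) ^ J ≤ 4 * q ^ (-(2 / (2 + k))) := by
      have e1 : (1 / 4 : ℝ) ^ J = (2 : ℝ) ^ (-(2 * (J : ℝ))) := by
        rw [Real.rpow_neg (by norm_num), Real.rpow_mul (by norm_num), Real.rpow_natCast]
        rw [one_div, inv_pow]
        norm_num
      have e2 : 4 * q ^ (-(2 / (2 + k))) = (2 : ℝ) ^ (2 + Lq * (-(2 / (2 + k)))) := by
        rw [Real.rpow_add (by norm_num), Real.rpow_mul (by norm_num), hqL]
        norm_num
      rw [e1, e2]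
      refine Real.rpow_le_rpow_of_exponent_le (by norm_num) ?_
      have : Lq * (2 / (2 + k)) = 2 * (Lq / (2 + k)) := by ring
      linarith
    calc _ ≤ 18 * κ * τ + 16 * lam ^ 2 * (4 * q ^ (-(2 / (2 + k))) * ΔX ^ 2) := by
          gcongr
          refine h1.trans ?_
          gcongr
          exact mul_nonneg (empMass_nonneg _) (sq_nonneg _)
      _ = 18 * κ * τ + 64 * (ℓ ^ 2 * q ^ (-(2 / (2 + k)))) := by rw [hℓ]; ring
      _ = _ := by rw [hq, balance_bias hℓ0 hβ hk]; ring
  · refine ⟨i, le_rfl, (main i le_rfl hiJ.le).trans ?_⟩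
    have hdepth : DepthLE S X δ ω i k := depthLE_of_attainsRate hrate hi.2
    have hzero : massDiam X (adaptivePart S X δ ω i) = 0 := by
      rcases hi.1.2 with h1 | h1
      · exact massDiam_eq_zero_of_avgDiam h1
      · exfalso
        have h2 : partLevel (adaptivePart S X δ ω i) ≤ ⌊(i : ℝ) * k⌋₊ :=
          partLevel_le fun c hc => Nat.le_floor (level_le hdepth hc)
        have h3 : (partLevel (adaptivePart S X δ ω i) : ℝ) ≤ i * k :=
          le_trans (by exact_mod_cast h2) (Nat.floor_le (by positivity))
        have h4 : (i : ℝ) * k < J * k := by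
          have : (i : ℝ) < J := by exact_mod_cast hiJ
          gcongr
        linarith
    rw [hzero, mul_zero, add_zero]
    nlinarith

end Balance

/-! ### The statistical error scale -/

section Alpha

variable {n : ℕ} {δ : ℝ}

theorem logb_div_eq (hn : 0 < n) (hδ : 0 < δ) :
    Real.logb 2 (n / δ) = Real.logb 2 n + Real.logb 2 (1 / δ) := by
  have hn' : (0 : ℝ) < n := by exact_mod_cast hn
  rw [Real.logb_div hn'.ne' hδ.ne', Real.logb_div one_ne_zero hδ.ne', Real.logb_one]
  ring

theorem logb_one_div_pos (hδ : 0 < δ) (hδ1 : δ < 1) : 0 < Real.logb 2 (1 / δ) :=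
  Real.logb_pos (by norm_num) ((one_lt_div hδ).2 hδ1)

theorem alpha_pos (hn : 2 ≤ n) (hδ : 0 < δ) (hδ1 : δ < 1) : 0 < alpha n δ := by
  have h1 := one_le_logb hn
  have h2 := logb_one_div_pos hδ hδ1
  have h3 : 0 ≤ Real.logb 2 (Real.logb 2 (n / δ)) := by
    refine Real.logb_nonneg (by norm_num) ?_
    rw [logb_div_eq (by omega) hδ]
    linarith
  unfold alpha
  positivity

theorem one_le_logb_logb (hn : 8 ≤ n) (hδ : 0 < δ) (hδ1 : δ < 1) :
    1 ≤ Real.logb 2 (Real.logb 2 (n / δ)) := by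
  have h1 := three_le_logb hn
  have h2 := logb_one_div_pos hδ hδ1
  have h3 : (2 : ℝ) ≤ Real.logb 2 (n / δ) := by
    rw [logb_div_eq (by omega) hδ]
    linarith
  rw [Real.le_logb_iff_rpow_le (by norm_num) (by linarith)]
  simpa using h3

theorem sq_logb_le_alpha (hn : 8 ≤ n) (hδ : 0 < δ) (hδ1 : δ < 1) :
    Real.logb 2 n ^ 2 ≤ alpha n δ := by
  have h1 := one_le_logb_logb hn hδ hδ1
  have h2 := logb_one_div_pos hδ hδ1
  unfold alpha
  nlinarith [sq_nonneg (Real.logb 2 (n : ℝ))]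

theorem numTrials_le (hn : 8 ≤ n) (hδ : 0 < δ) (hδ1 : δ < 1) :
    (numTrials n δ : ℝ) ≤ 4 * Real.logb 2 (n / δ) := by
  have hn' : (0 : ℝ) < n := by exact_mod_cast (by omega : 0 < n)
  have hx := three_le_logb hn
  have hd := logb_one_div_pos hδ hδ1
  have h6 : Real.logb 2 6 ≤ 3 := by
    rw [Real.logb_le_iff_le_rpow (by norm_num) (by norm_num)]
    norm_num
  have h6' : 0 ≤ Real.logb 2 6 := Real.logb_nonneg (by norm_num) (by norm_num)
  have e : Real.logb 2 (6 * (n : ℝ) ^ 2 / δ) =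
      Real.logb 2 6 + 2 * Real.logb 2 n + Real.logb 2 (1 / δ) := by
    rw [Real.logb_div (by positivity) hδ.ne', Real.logb_mul (by norm_num) (by positivity),
      Real.logb_pow, Real.logb_div one_ne_zero hδ.ne', Real.logb_one]
    push_cast
    ring
  have h1 := (Nat.ceil_lt_add_one (a := Real.logb 2 (6 * (n : ℝ) ^ 2 / δ))
    (by rw [e]; positivity)).le
  rw [numTrials, logb_div_eq (by omega) hδ]
  rw [e] at h1 ⊢
  linarith

/-- The number of codes of regions is negligible with respect to `exp (28 α(n))`: with `x = log n`
and `Λ = log log (n / δ)`, a code has at most `3 x` instructions out of `2 ^ (8 x + Λ)`, and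
`x * Λ ≤ x ^ 2 * Λ / 3`, `x ≤ x ^ 2 * Λ / 3` as `3 ≤ x` and `1 ≤ Λ`. -/
theorem card_codes_mul_exp_le (hn : 8 ≤ n) (hδ : 0 < δ) (hδ1 : δ < 1) {L T : ℕ}
    (hL : (L : ℝ) ≤ 2 * Real.logb 2 n + 1) (hT : (T : ℝ) ≤ 4 * Real.logb 2 (n / δ)) :
    (((4 * L * T * n ^ 4) ^ (L + 1) * (n ^ 3 + 1) : ℕ) : ℝ) *
      ((2 * n + 1) * Real.exp (-(28 * alpha n δ))) ≤ δ / 3 := by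
  have hn8 : (8 : ℝ) ≤ n := by exact_mod_cast hn
  have hn' : (0 : ℝ) < n := by linarith
  have hx := three_le_logb hn
  have hd := logb_one_div_pos hδ hδ1
  have hΛ := one_le_logb_logb hn hδ hδ1
  have hM0 : 0 < Real.logb 2 (n / δ) := by rw [logb_div_eq (by omega) hδ]; linarith
  have hxn : Real.logb 2 (n : ℝ) ≤ n := by
    rw [Real.logb_le_iff_le_rpow (by norm_num) hn', Real.rpow_natCast]
    exact_mod_cast Nat.lt_two_pow_self.le
  have e1 : (2 : ℝ) ^ Real.logb 2 (n : ℝ) = n := Real.rpow_logb (by norm_num) (by norm_num) hn'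
  have e2 : (2 : ℝ) ^ Real.logb 2 (1 / δ) = 1 / δ :=
    Real.rpow_logb (by norm_num) (by norm_num) (by positivity)
  have e3 : (2 : ℝ) ^ Real.logb 2 (Real.logb 2 (n / δ)) = Real.logb 2 (n / δ) :=
    Real.rpow_logb (by norm_num) (by norm_num) hM0
  have hα : alpha n δ = Real.logb 2 n ^ 2 * Real.logb 2 (Real.logb 2 (n / δ)) +
    Real.logb 2 (1 / δ) := rfl
  rw [hα]
  generalize Real.logb 2 (n / δ) = M at *
  generalize Real.logb 2 M = Λ at *
  generalize Real.logb 2 (1 / δ) = η at *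
  generalize Real.logb 2 (n : ℝ) = x at *
  have hbase : (4 * L * T * n ^ 4 : ℝ) ≤ (2 : ℝ) ^ (8 * x + Λ) := by
    rw [Real.rpow_add (by norm_num), mul_comm (8 : ℝ), Real.rpow_mul (by norm_num), e1, e3]
    have h1 : (4 * L : ℝ) ≤ n ^ 3 := by
      nlinarith [mul_le_mul_of_nonneg_right (pow_le_pow_left₀ (by norm_num) hn8 2) hn'.le]
    have h2 : (T : ℝ) ≤ n * M := hT.trans (by gcongr; linarith)
    calc (4 * L * T * n ^ 4 : ℝ) ≤ n ^ 3 * (n * M) * n ^ 4 := by gcongr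
      _ = n ^ (8 : ℕ) * M := by ring
      _ = _ := by rw [← Real.rpow_natCast]; norm_num
  have hpow : ((4 * L * T * n ^ 4 : ℝ)) ^ (L + 1) ≤ (2 : ℝ) ^ ((8 * x + Λ) * (3 * x)) := by
    rw [Real.rpow_mul (by norm_num)]
    calc _ ≤ ((2 : ℝ) ^ (8 * x + Λ)) ^ (L + 1) := by gcongr
      _ = ((2 : ℝ) ^ (8 * x + Λ)) ^ ((L + 1 : ℕ) : ℝ) := (Real.rpow_natCast _ _).symm
      _ ≤ _ := by
        refine Real.rpow_le_rpow_of_exponent_le ?_ ?_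
        · exact Real.one_le_rpow (by norm_num) (by positivity)
        · push_cast; linarith
  have hrest : ((n : ℝ) ^ 3 + 1) * (2 * n + 1) * (3 / δ) ≤ (2 : ℝ) ^ (7 * x + η) := by
    rw [Real.rpow_add (by norm_num), mul_comm (7 : ℝ), Real.rpow_mul (by norm_num), e1, e2]
    have h1 : (n : ℝ) ^ 3 + 1 ≤ n ^ 4 := by
      nlinarith [pow_le_pow_left₀ (by norm_num) hn8 3]
    have h2 : (2 * n + 1 : ℝ) ≤ n ^ 2 := by nlinarith
    have h3 : (3 : ℝ) / δ ≤ n * (1 / δ) := by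
      rw [mul_one_div]; gcongr; linarith
    calc _ ≤ (n : ℝ) ^ 4 * n ^ 2 * (n * (1 / δ)) := by gcongr
      _ = n ^ (7 : ℕ) * (1 / δ) := by ring
      _ = _ := by rw [← Real.rpow_natCast]; norm_num
  have hexp : (2 : ℝ) ^ ((8 * x + Λ) * (3 * x) + (7 * x + η)) ≤
      Real.exp (28 * (x ^ 2 * Λ + η)) := by
    rw [Real.rpow_def_of_pos (by norm_num), Real.exp_le_exp]
    have h0 : 0 ≤ (8 * x + Λ) * (3 * x) + (7 * x + η) := by positivity
    have h1 : (8 * x + Λ) * (3 * x) + (7 * x + η) ≤ 28 * (x ^ 2 * Λ + η) := by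
      have h2 : x ^ 2 ≤ x ^ 2 * Λ := le_mul_of_one_le_right (sq_nonneg x) hΛ
      have h3 : 3 * (x * Λ) ≤ x * (x * Λ) := by gcongr
      nlinarith
    have h4 : Real.log 2 ≤ 1 := by linarith [Real.log_two_lt_d9]
    calc _ ≤ 1 * ((8 * x + Λ) * (3 * x) + (7 * x + η)) := by gcongr
      _ ≤ _ := by linarith
  have hall : ((4 * L * T * n ^ 4 : ℝ)) ^ (L + 1) * (((n : ℝ) ^ 3 + 1) * (2 * n + 1) * (3 / δ)) ≤
      Real.exp (28 * (x ^ 2 * Λ + η)) := by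
    refine le_trans ?_ hexp
    rw [Real.rpow_add (by norm_num)]
    gcongr
  rw [Real.exp_neg]
  push_cast
  rw [← mul_assoc, ← div_eq_mul_inv, div_le_iff₀ (Real.exp_pos _)]
  calc _ = δ / 3 * ((4 * L * T * n ^ 4 : ℝ) ^ (L + 1) *
        (((n : ℝ) ^ 3 + 1) * (2 * n + 1) * (3 / δ))) := by field_simp
    _ ≤ _ := by gcongr

end Alpha

/-! ### Selection by cross-validation -/

section Selection

variable {D D' n : ℕ} {ρ : Measure (E D × E D')} [IsProbabilityMeasure ρ] {S S' : Set (E D)}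
  {g : E D → E D'} {lam ΔX : ℝ} {cX : E D} {cY y₀ : E D'} {B δ : ℝ} {z : Fin n → E D × E D'}
  {ω : Seeds D}

theorem MeasurableModel.integral_eq (hM : MeasurableModel ρ S' g lam cY B) :
    ∫ x, g x ∂ρ.fst = ∫ q, q.2 ∂ρ := by
  have h1 := hM.setIntegral_noise MeasurableSet.univ
  have h2 : Integrable (fun p : E D × E D' => g p.1) ρ :=
    Integrable.of_bound (hM.measurable.comp measurable_fst).aestronglyMeasurable (‖cY‖ + B / 2)
      (ae_of_all _ fun p => norm_le_of_mem_closedBall (hM.bounded p.1))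
  have h3 : Integrable (fun p : E D × E D' => p.2) ρ := by
    have := hM.integrable_noise.add h2
    refine this.congr (ae_of_all _ fun p => ?_)
    simp [noise]
  rw [Set.preimage_univ, setIntegral_univ] at h1
  simp only [noise] at h1
  rw [integral_sub h3 h2, sub_eq_zero] at h1
  rw [h1, Measure.fst, integral_map measurable_fst.aemeasurable
    hM.measurable.aestronglyMeasurable]

/-- The root candidate is the mean of the responses: its excess risk splits into the deviation of
this mean and the variance of the regression function. -/
theorem integral_sq_candidate_zero_le (hM : MeasurableModel ρ S' g lam cY B) (hSS : S' ⊆ S)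
    (hlam : 0 ≤ lam) (hB : 0 < B) (hSX : S ⊆ Metric.closedBall cX (ΔX / 2)) (hn : 0 < n)
    (hz : ∀ i, (z i).1 ∈ S') :
    ∫ x, ‖candidate S y₀ δ z ω 0 x - g x‖ ^ 2 ∂ρ.fst ≤
      B ^ 2 * meanDev ρ B z + (lam * ΔX) ^ 2 := by
  have hn' : (0 : ℝ) < n := by exact_mod_cast hn
  set m := ∫ q, q.2 ∂ρ with hm
  set u := (n : ℝ)⁻¹ • ∑ i, (z i).2 - m with hu
  have hgi : Integrable g ρ.fst :=
    Integrable.of_bound hM.measurable.aestronglyMeasurable (‖cY‖ + B / 2)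
      (ae_of_all _ fun x => norm_le_of_mem_closedBall (hM.bounded x))
  have hu2 : ‖u‖ ^ 2 = B ^ 2 * meanDev ρ B z := by
    have h1 : u = (B / n) • ∑ i, centred ρ B (z i) := by
      simp only [centred]
      rw [← Finset.smul_sum, Finset.sum_sub_distrib, Finset.sum_const, Finset.card_univ,
        Fintype.card_fin, ← Nat.cast_smul_eq_nsmul ℝ, smul_smul, div_mul_eq_mul_div,
        mul_inv_cancel₀ hB.ne', one_div, smul_sub, smul_smul, inv_mul_cancel₀ hn'.ne', one_smul]
    rw [h1, norm_smul, Real.norm_of_nonneg (by positivity), meanDev]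
    field_simp
  have hcand : ∀ x ∈ S', candidate S y₀ δ z ω 0 x = u + m := by
    intro x hx
    have hc : (⟨[], S⟩ : Cell D) ∈ adaptivePart S (fun i => (z i).1) δ ω 0 := by
      simp [adaptivePart]
    have hall : idxSet (fun i => (z i).1) S = Finset.univ := by
      ext i; simpa using hSS (hz i)
    rw [candidate_eq_of_mem hc (hSS hx)]
    have hne : (Finset.univ : Finset (Fin n)).Nonempty := ⟨⟨0, hn⟩, Finset.mem_univ _⟩
    simp only [hall, hne, if_true, Finset.card_univ, Fintype.card_fin, hu, sub_add_cancel]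
  have hdev : ∀ x ∈ S', ‖m - g x‖ ≤ lam * ΔX := by
    intro x hx
    have h1 : m - g x = ∫ y, (g y - g x) ∂ρ.fst := by
      rw [integral_sub hgi (integrable_const _), hM.integral_eq]
      simp [hm]
    rw [h1]
    have h2 : ∀ᵐ y ∂ρ.fst, ‖g y - g x‖ ≤ lam * ΔX := by
      filter_upwards [hM.ae_fst_mem] with y hy
      exact (hM.lipschitz y hy x hx).trans (mul_le_mul_of_nonneg_left
        (norm_sub_le_of_mem_closedBall (hSX (hSS hy)) (hSX (hSS hx))) hlam)
    simpa using norm_integral_le_of_norm_le_const h2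
  have hinner : ∫ x, (inner ℝ u (m - g x) : ℝ) ∂ρ.fst = 0 := by
    have h1 : Integrable (fun x => m - g x) ρ.fst := (integrable_const m).sub hgi
    rw [integral_inner h1, integral_sub (integrable_const _) hgi, hM.integral_eq]
    simp [hm]
  have hii : Integrable (fun x => (inner ℝ u (m - g x) : ℝ)) ρ.fst :=
    ((integrable_const m).sub hgi).const_inner u
  have hsq : ∀ᵐ x ∂ρ.fst, ‖candidate S y₀ δ z ω 0 x - g x‖ ^ 2 ≤
      (‖u‖ ^ 2 + (lam * ΔX) ^ 2) + 2 * inner ℝ u (m - g x) := by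
    filter_upwards [hM.ae_fst_mem] with x hx
    rw [hcand x hx, add_sub_assoc, norm_add_sq_real]
    have := pow_le_pow_left₀ (norm_nonneg _) (hdev x hx) 2
    linarith
  calc _ ≤ ∫ x, ((‖u‖ ^ 2 + (lam * ΔX) ^ 2) + 2 * inner ℝ u (m - g x)) ∂ρ.fst :=
        integral_mono_of_nonneg (ae_of_all _ fun x => sq_nonneg _)
          ((integrable_const _).add (hii.const_mul 2)) hsq
    _ = _ := by
        rw [integral_add (integrable_const _) (hii.const_mul 2), integral_const_mul, hinner, hu2]
        simp

theorem stopsAt_le_ceil (hn : 2 ≤ n) (hT : 0 < numTrials n δ) {X : Fin n → E D} {k : ℝ}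
    (h : AttainsRate S X δ ω k) {i : ℕ} (hi : StopsAt S X δ ω i) :
    i ≤ ⌈Real.logb 2 ((n : ℝ) ^ 2)⌉₊ := by
  rcases stopsAt_le hT h hi with h1 | h1
  · exact h1
  · rw [h1, Nat.one_le_ceil_iff, Real.logb_pow]
    have := one_le_logb hn
    push_cast
    linarith

/-- Outside of an event of probability at most `2 δ / 3`, any candidate selected by the test sample
has a small excess risk. When `ℓ = lam * ΔX` is above the noise level, the empirical risks of all
the candidates are close to their risks; otherwise the root candidate is good enough, and no
selected candidate is much worse. -/
theorem exists_selection_event (hM : MeasurableModel ρ S' g lam cY B) (hSS : S' ⊆ S)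
    (hlam : 0 ≤ lam) (hB : 0 < B) (hΔX : 0 ≤ ΔX) (hSX : S ⊆ Metric.closedBall cX (ΔX / 2))
    (hy₀ : y₀ ∈ Metric.closedBall cY (B / 2)) (hS : MeasurableSet S) (hn : 2 ≤ n)
    (hδ : 0 < δ) (hδ1 : δ < 1) (hℓn : (lam * ΔX / B) ^ 2 ≤ n) :
    ∃ A : Set ((Fin n → E D × E D') × (Fin n → E D × E D') × Seeds D),
      experiment ρ n A ≤ ENNReal.ofReal (δ / 3) + ENNReal.ofReal (δ / 3) ∧
      ∀ e ∉ A, (∀ i, (e.1 i).1 ∈ S' ∧ (e.1 i).2 ∈ Metric.closedBall cY (B / 2)) →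
        ∀ k : ℝ, 0 < k → AttainsRate S (fun i => (e.1 i).1) δ e.2.2 k →
        ∀ i, StopsAt S (fun i => (e.1 i).1) δ e.2.2 i → ∀ j ≤ i,
        (∀ j' ≤ i, candEmp S y₀ δ j e.1 e.2.1 e.2.2 ≤ candEmp S y₀ δ j' e.1 e.2.1 e.2.2) →
        ∫ x, ‖candidate S y₀ δ e.1 e.2.2 j x - g x‖ ^ 2 ∂ρ.fst ≤
          1144 * ((lam * ΔX) ^ (2 * k / (2 + k)) * (B ^ 2 * alpha n δ / n) ^ (2 / (2 + k))) +
            2 * B ^ 2 * cvWidth n δ := by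
  have hn0 : 0 < n := by omega
  have hn' : (0 : ℝ) < n := by exact_mod_cast hn0
  have hα := alpha_pos hn hδ hδ1
  have hT := numTrials_pos hn hδ hδ1
  set β := B ^ 2 * alpha n δ / n with hβdef
  set ℓ := lam * ΔX with hℓdef
  have hβ : 0 < β := by positivity
  have hℓ0 : 0 ≤ ℓ := by positivity
  set s := cvWidth n δ with hs
  have hs0 : 0 ≤ s := cvWidth_nonneg
  have hY : ∀ᵐ p ∂ρ, p.2 ∈ Metric.closedBall cY (B / 2) := hM.mem.mono fun p hp => hp.2
  have hτ0 : ∀ k : ℝ, 0 ≤ ℓ ^ (2 * k / (2 + k)) * β ^ (2 / (2 + k)) := fun k => by positivity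
  -- excess risks are differences of risks
  have hrisk : ∀ (e : (Fin n → E D × E D') × (Fin n → E D × E D') × Seeds D),
      (∀ i, (e.1 i).1 ∈ S' ∧ (e.1 i).2 ∈ Metric.closedBall cY (B / 2)) → ∀ j,
      candRisk ρ S y₀ δ j e.1 e.2.2 = (∫ p, ‖noise g p‖ ^ 2 ∂ρ) +
        ∫ x, ‖candidate S y₀ δ e.1 e.2.2 j x - g x‖ ^ 2 ∂ρ.fst := fun e hz j =>
    hM.integral_sq_sub (measurable_candidate_right hS e.1 e.2.2 j)
      (candidate_mem (convex_closedBall _ _) hy₀ (fun i => (hz i).2) j)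
  rcases le_or_gt (1 / 2) s with hs2 | hs2
  · -- the bound is trivial
    refine ⟨∅, by simp, fun e _ hz k _ _ i _ j _ _ => ?_⟩
    have hcm : ∀ x, candidate S y₀ δ e.1 e.2.2 j x ∈ Metric.closedBall cY (B / 2) :=
      candidate_mem (convex_closedBall _ _) hy₀ (fun i => (hz i).2) j
    have h1 : ∫ x, ‖candidate S y₀ δ e.1 e.2.2 j x - g x‖ ^ 2 ∂ρ.fst ≤ ∫ _x, B ^ 2 ∂ρ.fst :=
      integral_mono_of_nonneg (ae_of_all _ fun x => sq_nonneg _) (integrable_const _)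
        (ae_of_all _ fun x => pow_le_pow_left₀ (norm_nonneg _)
          (norm_sub_le_of_mem_closedBall (hcm x) (hM.bounded x)) 2)
    have h2 : ∫ _x, B ^ 2 ∂ρ.fst = B ^ 2 := by simp
    rw [h2] at h1
    have h3 := hτ0 k
    nlinarith [mul_le_mul_of_nonneg_left hs2 (sq_nonneg B)]
  have h8 : 8 ≤ n := eight_le_of_cvWidth_lt hn hδ hδ1 hs2
  have hx := three_le_logb h8
  set L := ⌈Real.logb 2 ((n : ℝ) ^ 2)⌉₊ with hLdef
  have hLle : (L : ℝ) ≤ 2 * Real.logb 2 n + 1 := ceil_logb_sq_le hn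
  have hLpos : 0 < L := by
    rw [hLdef, Nat.ceil_pos, Real.logb_pow]
    push_cast
    linarith
  rcases le_or_gt β (ℓ ^ 2) with hreg | hreg
  · set K := 2 * (28 * alpha n δ) + (4 * (L : ℝ) + 3) with hK
    refine ⟨{e | ¬ AllControlled ρ S g B K L (numTrials n δ) e.1 e.2.2} ∪
      {e | ¬ ∀ j ≤ L, |candEmp S y₀ δ j e.1 e.2.1 e.2.2 - candRisk ρ S y₀ δ j e.1 e.2.2| ≤
        s * B ^ 2}, ?_, ?_⟩
    · refine (measure_union_le _ _).trans (add_le_add ?_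
        (experiment_exists_abs_candEmp_sub_gt hS hB hy₀ hY hn hδ hδ1 hs2))
      have h1 := measure_not_allControlled_le (L := L) (T := numTrials n δ) hS hM.measurable hB
        hM.norm_noise_le (fun A hA => hM.setIntegral_noise hA) hLpos hT hn0
        (l := 28 * alpha n δ) (by positivity)
      refine (experiment_train_le {e | ¬ AllControlled ρ S g B K L (numTrials n δ) e.1 e.2}).trans
        (h1.trans (ENNReal.ofReal_le_ofReal ?_))
      exact card_codes_mul_exp_le h8 hδ hδ1 hLle (numTrials_le h8 hδ hδ1)
    · intro e he hz k hk hrate i hi j hji hmin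
      rw [Set.mem_union, not_or] at he
      have hctl : AllControlled ρ S g B K L (numTrials n δ) e.1 e.2.2 := not_not.1 he.1
      have hcv : ∀ j ≤ L, |candEmp S y₀ δ j e.1 e.2.1 e.2.2 -
        candRisk ρ S y₀ δ j e.1 e.2.2| ≤ s * B ^ 2 := not_not.1 he.2
      have hiL : i ≤ L := stopsAt_le_ceil hn hT hrate hi
      have hKα : K ≤ 60 * alpha n δ := by
        have := sq_logb_le_alpha h8 hδ hδ1
        nlinarith
      have hα1 : 1 ≤ alpha n δ := by
        have := sq_logb_le_alpha h8 hδ hδ1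
        nlinarith
      have hKβ : K * (B ^ 2 / n) ≤ 60 * β := by
        calc K * (B ^ 2 / n) ≤ 60 * alpha n δ * (B ^ 2 / n) := by gcongr
          _ = _ := by rw [hβdef]; ring
      have hq : ℓ ^ 2 / β ≤ n ^ 2 := by
        have h2 : ℓ ^ 2 / β = (ℓ / B) ^ 2 * (n / alpha n δ) := by
          rw [hβdef]; field_simp
        have h3 : (n : ℝ) / alpha n δ ≤ n := div_le_self hn'.le hα1
        rw [h2]
        calc _ ≤ (n : ℝ) * n := by gcongr
          _ = _ := by ring
      obtain ⟨j', hj', hb⟩ := exists_candidate_le hM hSS hlam hB hΔX hSX hy₀ hS hn hT hz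
        (Nat.le_ceil _) (by positivity) hβ hKβ hctl hreg hq hk hrate hi
      have h4 := abs_le.1 (hcv j (hji.trans hiL))
      have h5 := abs_le.1 (hcv j' (hj'.trans hiL))
      have h6 := hmin j' hj'
      rw [hrisk e hz] at h4 h5
      norm_num at hb
      linarith
  · refine ⟨{e | ¬ (meanDev ρ B e.1 ≤ 2 * s ∧ ∀ j ≤ L,
        candEmp S y₀ δ j e.1 e.2.1 e.2.2 ≤ candEmp S y₀ δ 0 e.1 e.2.1 e.2.2 →
        candRisk ρ S y₀ δ j e.1 e.2.2 - candRisk ρ S y₀ δ 0 e.1 e.2.2 ≤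
          B ^ 2 * (2 * s - meanDev ρ B e.1))},
      (experiment_exists_beats_root hS hB hy₀ hY hn hδ hδ1 hs2).trans le_self_add, ?_⟩
    intro e he hz k hk hrate i hi j hji hmin
    have hgood := (not_not.1 he).2 j (hji.trans (stopsAt_le_ceil hn hT hrate hi))
      (hmin 0 (Nat.zero_le _))
    rw [hrisk e hz, hrisk e hz] at hgood
    have h0 := integral_sq_candidate_zero_le (y₀ := y₀) (δ := δ) (ω := e.2.2) hM hSS hlam hB
      hSX hn0 fun i => (hz i).1
    have hτ : ℓ ^ 2 ≤ ℓ ^ (2 * k / (2 + k)) * β ^ (2 / (2 + k)) := by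
      rcases hℓ0.eq_or_lt with h | h
      · rw [← h]; have := hτ0 k; rw [← h] at this; simpa using this
      · rw [← balance_bias h hβ hk]
        refine le_mul_of_one_le_right (sq_nonneg _) ?_
        refine Real.one_le_rpow_of_pos_of_le_one_of_nonpos (by positivity) ?_ ?_
        · rw [div_le_one hβ]; exact hreg.le
        · have : 0 < 2 / (2 + k) := by positivity
          linarith
    have := hτ0 k
    linarith

end Selection

/-! ### The returned regressor -/

section Returned

variable {D D' n : ℕ} {ρ : Measure (E D × E D')} [IsProbabilityMeasure ρ] {S S' : Set (E D)}
  {f g : E D → E D'} {lam : ℝ} {cY y₀ : E D'} {B δ d : ℝ}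

theorem experiment_rateFail_le (hS : MeasurableSet S) (hd : 1 ≤ d) (hdbl : Doubling S d)
    (hn : 2 ≤ n) (hδ : 0 < δ) (hδ1 : δ < 1) :
    experiment ρ n {e | rateFail S δ d (fun i => (e.1 i).1) e.2.2} ≤ ENNReal.ofReal (δ / 3) := by
  have hm : MeasurableSet {e : (Fin n → E D × E D') × Seeds D |
      rateFail S δ d (fun i => (e.1 i).1) e.2} :=
    measurableSet_rateFail hS (measurable_pi_lambda _ fun i =>
      measurable_fst.comp ((measurable_pi_apply i).comp measurable_fst)) measurable_snd
  refine (experiment_train_le {e | rateFail S δ d (fun i => (e.1 i).1) e.2}).trans ?_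
  rw [Measure.prod_apply hm]
  refine (lintegral_mono (g := fun _ => ENNReal.ofReal (δ / 3)) fun z => ?_).trans (by simp)
  exact seedsLaw_rateFail_le (X := fun i => (z i).1) hS hd hdbl hn hδ (numTrials_pos hn hδ hδ1)

theorem exists_isReturned {z z' : Fin n → E D × E D'} {ω : Seeds D} {i : ℕ}
    (hi : StopsAt S (fun l => (z l).1) δ ω i) : ∃ h, IsReturned S y₀ δ z z' ω h := by
  obtain ⟨j, hj, hmin⟩ := Finset.exists_min_image (Finset.range (i + 1))
    (fun j => candEmp S y₀ δ j z z' ω) ⟨0, by simp⟩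
  exact ⟨_, i, hi, j, by simpa [Nat.lt_succ_iff] using hj, rfl,
    fun j' hj' => hmin j' (by simpa [Nat.lt_succ_iff] using hj')⟩

theorem excessRiskLE_of_measurableModel (hM : MeasurableModel ρ S' g lam cY B)
    (hgf : ∀ x ∈ S', g x = f x) {h : E D → E D'} (hh : Measurable h)
    (hhB : ∀ x, h x ∈ Metric.closedBall cY (B / 2)) {b : ℝ}
    (hb : ∫ x, ‖h x - g x‖ ^ 2 ∂ρ.fst ≤ b) : ExcessRiskLE ρ f h b := by
  have hae : (fun x => ‖h x - g x‖ ^ 2) =ᵐ[ρ.fst] fun x => ‖h x - f x‖ ^ 2 :=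
    hM.ae_fst_mem.mono fun x hx => by simp only [hgf x hx]
  refine ⟨Integrable.congr ?_ hae, by rwa [← integral_congr_ae hae]⟩
  refine Integrable.of_bound ((hh.sub hM.measurable).norm.pow_const 2).aestronglyMeasurable
    (B ^ 2) (ae_of_all _ fun x => ?_)
  rw [Real.norm_of_nonneg (sq_nonneg _)]
  exact pow_le_pow_left₀ (norm_nonneg _) (norm_sub_le_of_mem_closedBall (hhB x) (hM.bounded x)) 2

end Returned

end RPTree

end

theorem theorem1 :
    ∃ C C' : ℝ, 0 < C ∧ 0 < C' ∧
      ∀ (D D' : ℕ) (S : Set (RPTree.E D)) (T : Set (RPTree.E D'))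
        (cX : RPTree.E D) (cY : RPTree.E D') (ΔX ΔY d : ℝ)
        (ρ : Measure (RPTree.E D × RPTree.E D')) (f : RPTree.E D → RPTree.E D') (lam : NNReal)
        (y₀ : RPTree.E D') (n : ℕ) (δ : ℝ),
        MeasurableSet S → IsProbabilityMeasure ρ →
        S ⊆ Metric.closedBall cX (ΔX / 2) → T ⊆ Metric.closedBall cY (ΔY / 2) →
        0 < ΔY → y₀ ∈ T →
        RPTree.IsRegressionModel ρ S T f → LipschitzOnWith lam f S →
        RPTree.HasAssouadDim S d → 1 < d →
        0 < δ → δ < 1 → 2 ≤ n →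
        max ((lam * ΔX / ΔY) ^ 2) (RPTree.alpha n δ) ≤ n →
        RPTree.experiment ρ n
          {e | ¬ ((∃ k : ℝ, d ≤ k ∧ k ≤ C' * d * Real.logb 2 d ∧
                    RPTree.AttainsRate S (fun i => (e.1 i).1) δ e.2.2 k) ∧
                  (∃ g, RPTree.IsReturned S y₀ δ e.1 e.2.1 e.2.2 g) ∧
                  ∀ k : ℝ, d ≤ k → k ≤ C' * d * Real.logb 2 d →
                    RPTree.AttainsRate S (fun i => (e.1 i).1) δ e.2.2 k →
                    ∀ g, RPTree.IsReturned S y₀ δ e.1 e.2.1 e.2.2 g →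
                      RPTree.ExcessRiskLE ρ f g (RPTree.riskBound C lam ΔX ΔY δ k n))}
          ≤ ENNReal.ofReal δ := by
  refine ⟨1144, 60000, by norm_num, by norm_num, ?_⟩
  intro D D' S T cX cY ΔX ΔY d ρ f lam y₀ n δ hS hρ hSX hT hΔY hy₀ hf hlip hdim hd hδ hδ1 hn hmax
  have hdbl : RPTree.Doubling S d := hdim.1.2
  have hd32 := RPTree.three_halves_le_of_hasAssouadDim hdim hd
  have hT0 := RPTree.numTrials_pos hn hδ hδ1
  obtain ⟨g, S', hSS, hgf, hM⟩ := RPTree.exists_measurableModel hΔY hS hT hf hlip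
  have hΔX : 0 ≤ ΔX := by
    obtain ⟨p, hp⟩ := hM.mem.exists
    have := Metric.nonempty_closedBall.1 ⟨p.1, hSX (hSS hp.1)⟩
    linarith
  have hy₀' := hT hy₀
  obtain ⟨A, hA, hgood⟩ := RPTree.exists_selection_event (y₀ := y₀) (δ := δ) hM hSS lam.coe_nonneg
    hΔY hΔX hSX hy₀' hS hn hδ hδ1 ((le_max_left _ _).trans hmax)
  set N : Set ((Fin n → RPTree.E D × RPTree.E D') × (Fin n → RPTree.E D × RPTree.E D') ×
    RPTree.Seeds D) := {e | ¬ ∀ i, (e.1 i).1 ∈ S' ∧ (e.1 i).2 ∈ Metric.closedBall cY (ΔY / 2)}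
    with hN
  have hN0 : RPTree.experiment ρ n N = 0 := RPTree.ae_experiment_train hM.mem
  set R : Set ((Fin n → RPTree.E D × RPTree.E D') × (Fin n → RPTree.E D × RPTree.E D') ×
    RPTree.Seeds D) := {e | RPTree.rateFail S δ d (fun i => (e.1 i).1) e.2.2} with hR
  have hR3 : RPTree.experiment ρ n R ≤ ENNReal.ofReal (δ / 3) :=
    RPTree.experiment_rateFail_le hS hd.le hdbl hn hδ hδ1
  have hbound : RPTree.experiment ρ n (N ∪ (R ∪ A)) ≤ ENNReal.ofReal δ := by
    calc _ ≤ 0 + (ENNReal.ofReal (δ / 3) +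
          (ENNReal.ofReal (δ / 3) + ENNReal.ofReal (δ / 3))) :=
          (measure_union_le _ _).trans (add_le_add hN0.le
            ((measure_union_le _ _).trans (add_le_add hR3 hA)))
      _ = _ := by
          rw [zero_add, ← ENNReal.ofReal_add (by positivity) (by positivity),
            ← ENNReal.ofReal_add (by positivity) (by positivity)]
          congr 1
          ring
  refine (measure_mono fun e he => ?_).trans hbound
  by_contra hnot
  rw [Set.mem_union, Set.mem_union, not_or, not_or] at hnot
  obtain ⟨h1, h2, h3⟩ := hnot
  have hz : ∀ i, (e.1 i).1 ∈ S' ∧ (e.1 i).2 ∈ Metric.closedBall cY (ΔY / 2) := not_not.1 h1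
  have hrate : RPTree.AttainsRate S (fun i => (e.1 i).1) δ e.2.2 (60000 * d * Real.logb 2 d) :=
    RPTree.attainsRate_of_not_rateFail hn h2 (RPTree.noisyRounds_le hd32)
  obtain ⟨i₀, hi₀⟩ := RPTree.exists_stopsAt hn hT0 hrate
  refine he ⟨⟨_, ?_, le_rfl, hrate⟩, RPTree.exists_isReturned hi₀, ?_⟩
  -- `d ≥ 3 / 2` keeps `log d` away from zero, so that `d ≤ C' d log d`
  · have hlog : (1 / 2 : ℝ) ≤ Real.logb 2 d := by
      rw [Real.le_logb_iff_rpow_le (by norm_num) (by linarith), ← Real.sqrt_eq_rpow]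
      exact (Real.sqrt_le_left (by norm_num)).2 (by norm_num) |>.trans hd32
    nlinarith
  · rintro k hk - hkrate h ⟨i, hi, j, hji, rfl, hmin⟩
    refine RPTree.excessRiskLE_of_measurableModel hM hgf
      (RPTree.measurable_candidate_right hS e.1 e.2.2 j)
      (RPTree.candidate_mem (convex_closedBall _ _) hy₀' (fun i => (hz i).2) j) ?_
    have := hgood e h3 hz k (by linarith) hkrate i hi j hji hmin
    rw [RPTree.riskBound, mul_assoc (1144 : ℝ)]
    exact this
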